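/- **Setting.** Let $(\mathcal X,\mathcal A,\nu)$ be a measurable space with a $\sigma$-finite measure, $\Theta\subseteq\mathbb R^d$, and let $P_\theta\ll\nu$, $\theta\in\Theta$, be probability measures that are Hellinger differentiable at every $t\in\Theta$: there is $\dot\xi_t\in L_2(\nu;\mathbb R^d)$ with $\int (dP_{t+h}^{1/2}-dP_t^{1/2}-h^\top\dot\xi_t)^2\,d\nu=o(\|h\|^2)$ as $h\to0$, $t+h\in\Theta$. Put $\mathcal I(t)=4\int\dot\xi_t\dot\xi_t^\top d\nu$. Let $\theta_0$ be an interior point of $\Theta$ such that $\mathcal I$ is continuous at $\theta_0$ and $\mathcal I(\theta_0)$ is positive definite, and let $\psi$ be a real-valued function that is differentiable near $\theta_0$ with $\nabla\psi$ continuous at $\theta_0$. Write $$V=\nabla\psi(\theta_0)^\top\mathcal I(\theta_0)^{-1}\nabla\psi(\theta_0),\qquad S_{c,n}=\{\theta:\|\theta-\theta_0\|_2<cn^{-1/2}\},\qquad R_{c,n}=\inf_T\sup_{\theta\in S_{c,n}}\mathbb E_{P_\theta^n}|T(X)-\psi(\theta)|^2,$$ the infimum being over measurable $T:\mathcal X^n\to\mathbb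 R$, and $L(b)=\liminf_{c\to\infty}\liminf_{n\to\infty}n\,b_{c,n}$. Let $H^2(P,Q)=\int(dP^{1/2}-dQ^{1/2})^2$ and $[x]_+=\max(x,0)$. **Bounds.** For a prior with Lebesgue density $q$ let $\mathcal I(Q)=\int \nabla q\nabla q^\top q^{-1}1(q>0)$. A function is called absolutely continuous on $S$ if it is continuous on $S$ and absolutely continuous along each line segment in $S$. For $\phi$ absolutely continuous on $S$, a probability measure $Q$ on $S$ is *nice* for $\phi$ if it has a density $q$ that is absolutely continuous on $S$ with finite positive definite $\mathcal I(Q)$, $\phi$, $\nabla\phi$ and $\operatorname{tr}\mathcal I(\cdot)$ are $Q$-integrable, and $q$ tends to $0$ at the boundary points of $S$ along the coordinate directions. For a diffeomorphism $\varphi:\mathbb R^d\to S$, a probability measure $Q$ on $\mathbb R^d$ and $h\in\mathbb R^d$ let $\widetilde\psi=\psi\circ\varphi$, $d\widetilde{\mathbb P}_h(x,t)=dP^n_{\varphi(t+h)}(x)\,dQ(t+h)$, $N=|\int(\widetilde\psi(t)-\widetilde\psi(t-h))\,dQ(t)|^2$ and $B=\int|\widetilde\psi(t)-\widetilde\psi(t-h)|^2dQ(t)$.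 With $S=S_{c,n}$ define $$b^{\rm app}_{c,n}=\sup_{\phi\text{ abs. cont.},\,Q\text{ nice}}\Big[\Gamma_{Q,\phi}^{1/2}-\Big(\int|\psi-\phi|^2dQ\Big)^{1/2}\Big]_+^2,\quad \Gamma_{Q,\phi}=\Big(\int\nabla\phi\,dQ\Big)^\top\Big(\mathcal I(Q)+n\int\mathcal I(t)\,dQ\Big)^{-1}\Big(\int\nabla\phi\,dQ\Big),$$ $$b^{\chi^2}_{c,n}=\sup_{\varphi,Q,h,\lambda\in[0,1]}\Big[\sqrt{(1-\lambda)^2N/\chi^2(\widetilde{\mathbb P}_h\|\lambda\widetilde{\mathbb P}_h+(1-\lambda)\widetilde{\mathbb P}_0)}-\sqrt{\lambda B}\Big]_+^2,$$ $$b^{H}_{c,n}=\sup_{\varphi,Q,h}\Big[\sqrt{N/(4H^2(\widetilde{\mathbb P}_0,\widetilde{\mathbb P}_h))}-\sqrt B\Big]_+^2,\qquad b^{2}_{c,n}=\sup_{\theta_1,\theta_2\in S}\Big[\tfrac{1-H^2(P^n_{\theta_1},P^n_{\theta_2})}{4}\Big]_+|\psi(\theta_1)-\psi(\theta_2)|^2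 .$$ **Proposition.** The local asymptotic minimax bound $L(R)\ge V$ holds. Moreover: 1. (Approximation by absolutely continuous functionals) for every $c>0$, $b^{\rm app}_{c,n}\le R_{c,n}$ for all large $n$, and $L(b^{\rm app})\ge V$. 2. (Mixture $\chi^2$ bound) if the Fisher defect $4\int\dot\xi_{\theta_0}\dot\xi_{\theta_0}^\top 1(dP_{\theta_0}=0)\,d\nu$ is zero, then for every $c>0$, $b^{\chi^2}_{c,n}\le R_{c,n}$ for all large $n$, and $L(b^{\chi^2})\ge V$. 3. (Mixture Hellinger bound) for every $c>0$, $b^{H}_{c,n}\le R_{c,n}$ for all large $n$, and $L(b^{H})\ge V$. The maps $\varphi(t)=\theta_0+r\,\frac2\pi\arctan(\|t\|/\gamma)\,t/\|t\|$, $r,\gamma>0$, are diffeomorphisms of $\mathbb R^d$ onto the open ball of radius $r$ at $\theta_0$, and $L(b^{H})\ge V$ remains true when the supremum defining $b^H_{c,n}$ is restricted to the maps $\varphi$ of this form (with $r=cn^{-1/2}$, $\gamma>0$). 4. (Two-point Hellinger bound) for every $c>0$, $b^{2}_{c,n}\le R_{c,n}$ for all large $n$, and $L(b^{2})=C\,V$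 with $C=\sup_{\varepsilon\ge0}\big(-\tfrac14+\tfrac12e^{-\varepsilon^2/8}\big)\varepsilon^2\approx0.28953$ (to five decimals). -/

import Mathlib

open MeasureTheory Filter Topology Asymptotics
open scoped ENNReal Matrix

noncomputable section

namespace LAM

/-- The parameter space `ℝ^d` with its Euclidean norm. -/
abbrev Par (d : ℕ) : Type := EuclideanSpace ℝ (Fin d)

variable {d : ℕ} {𝒳 : Type*} [MeasurableSpace 𝒳]

/-! ### Hellinger differentiability, Fisher information, Fisher defect -/

/-- The root density `dP_θ^{1/2}` with respect to `ν`. -/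
def rootDensity (ν : Measure 𝒳) (P : Par d → Measure 𝒳) (θ : Par d) (x : 𝒳) : ℝ :=
  √((P θ).rnDeriv ν x).toReal

/-- Hellinger differentiability of `θ ↦ P_θ`, `θ ∈ Θ`, at `t`, with derivative `ξ`:
`∫ (dP_{t+h}^{1/2} - dP_t^{1/2} - hᵀ ξ)² dν = o(‖h‖²)` as `h → 0` with `t + h ∈ Θ`. -/
def HasHellingerDerivWithinAt (ν : Measure 𝒳) (P : Par d → Measure 𝒳) (Θ : Set (Par d))
    (t : Par d) (ξ : 𝒳 → Par d) : Prop :=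
  MemLp ξ 2 ν ∧
    (fun h : Par d =>
      ∫ x, (rootDensity ν P (t + h) x - rootDensity ν P t x - inner ℝ h (ξ x)) ^ 2 ∂ν)
      =o[𝓝[{h | t + h ∈ Θ}] 0] fun h => ‖h‖ ^ 2

/-- The Fisher information matrix `4 ∫ ξ ξᵀ dν`. -/
def fisherInfo (ν : Measure 𝒳) (ξ : 𝒳 → Par d) : Matrix (Fin d) (Fin d) ℝ :=
  Matrix.of fun i j => 4 * ∫ x, ξ x i * ξ x j ∂ν

/-- The Fisher defect `4 ∫ ξ ξᵀ 1(dP = 0) dν`. -/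
def fisherDefect (ν μ : Measure 𝒳) (ξ : 𝒳 → Par d) : Matrix (Fin d) (Fin d) ℝ :=
  Matrix.of fun i j => 4 * ∫ x in {x | μ.rnDeriv ν x = 0}, ξ x i * ξ x j ∂ν

/-! ### Divergences -/

/-- The squared Hellinger distance `∫ (dP^{1/2} - dQ^{1/2})²` (no factor `1/2`), computed with the
dominating measure `P + Q`; for finite measures its value does not depend on the dominating
measure. -/
def hellingerSq {Ω : Type*} [MeasurableSpace Ω] (μ₁ μ₂ : Measure Ω) : ℝ≥0∞ :=
  ∫⁻ x, ENNReal.ofReal ((√(μ₁.rnDeriv (μ₁ + μ₂) x).toReal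
    - √(μ₂.rnDeriv (μ₁ + μ₂) x).toReal) ^ 2) ∂(μ₁ + μ₂)

open scoped Classical in
/-- The chi-squared divergence `χ²(μ₁ ‖ μ₀)`. -/
def chiSq {Ω : Type*} [MeasurableSpace Ω] (μ₁ μ₀ : Measure Ω) : ℝ≥0∞ :=
  if μ₁ ≪ μ₀ then ∫⁻ x, ENNReal.ofReal (((μ₁.rnDeriv μ₀ x).toReal - 1) ^ 2) ∂μ₀ else ⊤

/-! ### IID experiments and the minimax risk -/

/-- The law `P_θ^n` of `n` IID observations. -/
def iidLaw (P : Par d → Measure 𝒳) (n : ℕ) (θ : Par d) : Measure (Fin n → 𝒳) :=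
  Measure.pi fun _ => P θ

/-- The minimax mean squared error
`inf_T sup_{θ ∈ S} E_{P_θ^n} |T(X₁,…,X_n) - ψ(θ)|²` over measurable `T : 𝒳^n → ℝ`. -/
def minimaxRisk (P : Par d → Measure 𝒳) (ψ : Par d → ℝ) (n : ℕ) (S : Set (Par d)) : ℝ≥0∞ :=
  ⨅ (T : (Fin n → 𝒳) → ℝ) (_ : Measurable T), ⨆ θ ∈ S,
    ∫⁻ x, ENNReal.ofReal ((T x - ψ θ) ^ 2) ∂(iidLaw P n θ)

/-! ### The bound based on approximating functionals -/

/-- Absolute continuity on a subset `S` of `ℝ^d`: continuity on `S`, and absolute continuity along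
every line segment contained in `S`. -/
def IsAbsContOn (f : Par d → ℝ) (S : Set (Par d)) : Prop :=
  ContinuousOn f S ∧
    ∀ a b : Par d, segment ℝ a b ⊆ S →
      AbsolutelyContinuousOnInterval (fun s : ℝ => f (a + s • (b - a))) 0 1

/-- The `i`-th partial derivative (zero where it does not exist). -/
def partialDeriv (f : Par d → ℝ) (i : Fin d) (t : Par d) : ℝ :=
  lineDeriv ℝ f t (EuclideanSpace.single i 1)

/-- The probability measure with Lebesgue density `q`. -/
def priorMeasure (q : Par d → ℝ) : Measure (Par d) :=
  volume.withDensity fun t => ENNReal.ofReal (q t)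

/-- The Fisher information `∫ ∇q ∇qᵀ / q 1(q > 0)` of the location family of the prior
(division by zero gives zero, which is the indicator). -/
def priorFisherInfo (S : Set (Par d)) (q : Par d → ℝ) : Matrix (Fin d) (Fin d) ℝ :=
  Matrix.of fun i j => ∫ t in S, partialDeriv q i t * partialDeriv q j t / q t

/-- `q` is the Lebesgue density of a nice prior on `S`, relative to the Fisher information
`t ↦ I t` of the model and to the functional `φ`. -/
structure IsNicePrior (S : Set (Par d)) (I : Par d → Matrix (Fin d) (Fin d) ℝ)
    (φ : Par d → ℝ) (q : Par d → ℝ) : Prop where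
  nonneg : ∀ t, 0 ≤ q t
  eq_zero : ∀ t ∉ S, q t = 0
  isProbabilityMeasure : IsProbabilityMeasure (priorMeasure q)
  absCont : IsAbsContOn q S
  finite_info : ∀ i, IntegrableOn (fun t => partialDeriv q i t ^ 2 / q t) S
  posDef_info : (priorFisherInfo S q).PosDef
  integrable_phi : Integrable φ (priorMeasure q)
  integrable_grad : ∀ i, Integrable (partialDeriv φ i) (priorMeasure q)
  integrable_trace : Integrable (fun t => (I t).trace) (priorMeasure q)
  /-- `q` vanishes at boundary points of `S` along the canonical directions. -/
  boundary : ∀ x ∈ frontier S, ∀ i : Fin d,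
    Tendsto (fun s : ℝ => q (x + s • EuclideanSpace.single i 1))
      (𝓝[{s : ℝ | x + s • EuclideanSpace.single i 1 ∈ S}] 0) (𝓝 0)

/-- `Γ_{Q,φ} = (∫ ∇φ dQ)ᵀ (I(Q) + n ∫ I(t) dQ)⁻¹ (∫ ∇φ dQ)` for `n` IID observations. -/
def vanTreesGamma (S : Set (Par d)) (I : Par d → Matrix (Fin d) (Fin d) ℝ) (n : ℕ)
    (φ q : Par d → ℝ) : ℝ :=
  let m : Fin d → ℝ := fun i => ∫ t, partialDeriv φ i t ∂(priorMeasure q)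
  let J : Matrix (Fin d) (Fin d) ℝ := Matrix.of fun i j => ∫ t, I t i j ∂(priorMeasure q)
  m ⬝ᵥ ((priorFisherInfo S q + (n : ℝ) • J)⁻¹ *ᵥ m)

/-- The lower bound by approximation, for a real functional `ψ` and `n` IID observations: the
supremum over absolutely continuous `φ` and over priors that are nice for `φ` of
`[Γ_{Q,φ}^{1/2} - (∫ |ψ - φ|² dQ)^{1/2}]_+²`. Subtraction in `ℝ≥0∞` is the positive part. -/
def approximationBound (I : Par d → Matrix (Fin d) (Fin d) ℝ) (ψ : Par d → ℝ) (n : ℕ)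
    (S : Set (Par d)) : ℝ≥0∞ :=
  ⨆ (φ : Par d → ℝ) (_ : IsAbsContOn φ S) (q : Par d → ℝ) (_ : IsNicePrior S I φ q),
    (ENNReal.ofReal (vanTreesGamma S I n φ q) ^ (1 / 2 : ℝ)
      - (∫⁻ t, ENNReal.ofReal ((ψ t - φ t) ^ 2) ∂(priorMeasure q)) ^ (1 / 2 : ℝ)) ^ 2

/-! ### The mixture bounds -/

/-- For a family `κ t` of laws on `Ω` indexed by `t ∈ ℝ^d`, the measure
`d𝙿_h(x, t) = dκ_{t+h}(x) dQ(t+h)` on `Ω × ℝ^d`. -/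
def mixture {Ω : Type*} [MeasurableSpace Ω] (κ : Par d → Measure Ω) (Q : Measure (Par d))
    (h : Par d) : Measure (Ω × Par d) :=
  (Q.map fun t => t - h).bind fun t => (κ (t + h)).prod (Measure.dirac t)

/-- `(∫ (ψ(t) - ψ(t-h)) dQ(t))²`. -/
def meanShiftSq (ψ : Par d → ℝ) (Q : Measure (Par d)) (h : Par d) : ℝ≥0∞ :=
  ENNReal.ofReal ((∫ t, (ψ t - ψ (t - h)) ∂Q) ^ 2)

/-- `B_{ψ,Q,h} = ∫ (ψ(t) - ψ(t-h))² dQ(t)`. -/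
def shiftB (ψ : Par d → ℝ) (Q : Measure (Par d)) (h : Par d) : ℝ≥0∞ :=
  ∫⁻ t, ENNReal.ofReal ((ψ t - ψ (t - h)) ^ 2) ∂Q

/-- The mixture chi-squared bound
`sup_{Q, λ, h} [√((1-λ)² A) - √(λ B)]_+²`, where
`A = (∫ (ψ(t) - ψ(t-h)) dQ)² / χ²(𝙿_h ‖ λ 𝙿_h + (1-λ) 𝙿_0)`, for the model `κ` on `ℝ^d`. -/
def chiSqMixtureBound {Ω : Type*} [MeasurableSpace Ω] (κ : Par d → Measure Ω)
    (ψ : Par d → ℝ) : ℝ≥0∞ :=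
  ⨆ (Q : ProbabilityMeasure (Par d)) (l ∈ Set.Icc (0 : ℝ) 1) (h : Par d),
    ((ENNReal.ofReal ((1 - l) ^ 2) * (meanShiftSq ψ Q h /
        chiSq (mixture κ Q h)
          (ENNReal.ofReal l • mixture κ Q h + ENNReal.ofReal (1 - l) • mixture κ Q 0)))
        ^ (1 / 2 : ℝ)
      - (ENNReal.ofReal l * shiftB ψ Q h) ^ (1 / 2 : ℝ)) ^ 2

/-- The mixture Hellinger bound `sup_{Q, h} [√A - √B]_+²`, where
`A = (∫ (ψ(t) - ψ(t-h)) dQ)² / (4 H²(𝙿_0, 𝙿_h))`, for the model `κ` on `ℝ^d`. -/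
def hellingerMixtureBound {Ω : Type*} [MeasurableSpace Ω] (κ : Par d → Measure Ω)
    (ψ : Par d → ℝ) : ℝ≥0∞ :=
  ⨆ (Q : ProbabilityMeasure (Par d)) (h : Par d),
    ((meanShiftSq ψ Q h / (4 * hellingerSq (mixture κ Q 0) (mixture κ Q h))) ^ (1 / 2 : ℝ)
      - shiftB ψ Q h ^ (1 / 2 : ℝ)) ^ 2

/-- `φ` is a diffeomorphism of `ℝ^d` onto `S`: a differentiable bijection onto `S` whose inverse is
differentiable on `S`. -/
def IsDiffeoOnto (φ : Par d → Par d) (S : Set (Par d)) : Prop :=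
  Differentiable ℝ φ ∧ Set.range φ = S ∧
    ∃ g : Par d → Par d, (∀ t, g (φ t) = t) ∧ DifferentiableOn ℝ g S

/-- The radial arctangent map
`t ↦ θ₀ + r (2/π) arctan(‖t‖/γ) t/‖t‖` from `ℝ^d` to the open ball of radius `r` at `θ₀`. -/
def arctanMap (θ₀ : Par d) (r γ : ℝ) (t : Par d) : Par d :=
  θ₀ + (r * (2 / Real.pi * Real.arctan (‖t‖ / γ))) • (‖t‖⁻¹ • t)

/-- The chi-squared mixture bound for `n` IID observations and the parameter set `S`, through all
diffeomorphisms `φ : ℝ^d → S`. -/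
def chiSqBound (P : Par d → Measure 𝒳) (ψ : Par d → ℝ) (n : ℕ) (S : Set (Par d)) : ℝ≥0∞ :=
  ⨆ (φ : Par d → Par d) (_ : IsDiffeoOnto φ S),
    chiSqMixtureBound (fun t => iidLaw P n (φ t)) (fun t => ψ (φ t))

/-- The Hellinger mixture bound for `n` IID observations and the parameter set `S`, through all
diffeomorphisms `φ : ℝ^d → S`. -/
def hellingerBound (P : Par d → Measure 𝒳) (ψ : Par d → ℝ) (n : ℕ) (S : Set (Par d)) : ℝ≥0∞ :=
  ⨆ (φ : Par d → Par d) (_ : IsDiffeoOnto φ S),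
    hellingerMixtureBound (fun t => iidLaw P n (φ t)) (fun t => ψ (φ t))

/-- The Hellinger mixture bound for `n` IID observations and the ball of radius `r` at `θ₀`, using
only the radial arctangent maps. -/
def arctanHellingerBound (P : Par d → Measure 𝒳) (ψ : Par d → ℝ) (n : ℕ) (θ₀ : Par d)
    (r : ℝ) : ℝ≥0∞ :=
  ⨆ γ ∈ Set.Ioi (0 : ℝ), hellingerMixtureBound (fun t => iidLaw P n (arctanMap θ₀ r γ t))
    (fun t => ψ (arctanMap θ₀ r γ t))

/-! ### The two-point bound -/

/-- `sup_{θ₁, θ₂ ∈ S} [(1 - H²(P_{θ₁}^n, P_{θ₂}^n)) / 4]_+ |ψ(θ₁) - ψ(θ₂)|²`. -/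
def twoPointBound (P : Par d → Measure 𝒳) (ψ : Par d → ℝ) (n : ℕ) (S : Set (Par d)) : ℝ≥0∞ :=
  ⨆ (θ₁ ∈ S) (θ₂ ∈ S), (1 - hellingerSq (iidLaw P n θ₁) (iidLaw P n θ₂)) / 4
    * ENNReal.ofReal ((ψ θ₁ - ψ θ₂) ^ 2)

/-- `C = sup_{ε ≥ 0} (-1/4 + (1/2) exp(-ε²/8)) ε²`. -/
def twoPointConst : ℝ :=
  sSup ((fun ε : ℝ => (-(1 / 4) + 1 / 2 * Real.exp (-ε ^ 2 / 8)) * ε ^ 2) '' Set.Ici 0)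

/-! ### Local asymptotics -/

/-- The shrinking neighbourhood `‖θ - θ₀‖ < c n^{-1/2}`. -/
def localBall (θ₀ : Par d) (c : ℝ) (n : ℕ) : Set (Par d) := Metric.ball θ₀ (c / √(n : ℝ))

/-- `liminf_{c → ∞} liminf_{n → ∞} n b(c, n)`. -/
def localLiminf (b : ℝ → ℕ → ℝ≥0∞) : ℝ≥0∞ :=
  liminf (fun c : ℝ => liminf (fun n : ℕ => (n : ℝ≥0∞) * b c n) atTop) atTop

/-- The constant `∇ψ(θ₀)ᵀ I(θ₀)⁻¹ ∇ψ(θ₀)`. -/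
def lamConst (ψ : Par d → ℝ) (θ₀ : Par d) (I₀ : Matrix (Fin d) (Fin d) ℝ) : ℝ :=
  let g : Fin d → ℝ := fun i => gradient ψ θ₀ i
  g ⬝ᵥ (I₀⁻¹ *ᵥ g)

end LAM

end

/-! Root densities turn laws into unit vectors of L²(ν), and every bound below is a Cauchy–Schwarz
inequality there. For parameters within O(n^{-1/2}) of θ₀, Hellinger differentiability at θ₀ alone
gives n H²(P_θ₁, P_θ₂) ≈ ¼ zᵀ I(θ₀) z with z = √n(θ₁ - θ₂), uniformly in both points (`hsq_scaled`),
while √n(ψ(θ₁) - ψ(θ₂)) ≈ ∇ψ(θ₀)ᵀ z (`gradient_scaled`). The extremal direction is I(θ₀)⁻¹ ∇ψ(θ₀)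
(`effDir`), at which the quadratic form of I(θ₀) and the linear form ∇ψ(θ₀)ᵀ both take the value V.

Finite-sample validity. As ψ is bounded near θ₀, estimators may be clipped
(`le_minimaxRisk_of_bounded`). The two-point bound is Cauchy–Schwarz for ∫ (T - ψ(θᵢ)) f g. The χ²
mixture bound is the Chapman–Robbins inequality for Z(x, t) = T(x) - ψ(t) on the joint space of data
and parameter: passing from 𝙿_0 to 𝙿_h shifts the mean of Z by an amount free of T and enlarges its
second moment by a Minkowski term only. At λ = 1/2 it dominates the Hellinger mixture bound. The
approximation bound is a van Trees inequality: with m(t) = E_t T, integration by parts against the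
prior (`integral_stein_eq_zero`) expresses ∫ ∇φ dQ through ∇m and (m - φ)∇q/q, to which Cramér–Rao
is applied pointwise in t (`sqrt_vanTreesGamma_le`).

Sharpness. For the mixture bounds the prior is uniform on a long arithmetic progression of localized
points in the efficient direction with small step s. Subadditivity of H² over atoms bounds the
Hellinger distance between the mixture and its shift by the average distance between neighbours plus
2/(m+1) for the two unmatched end atoms. The limiting value is √V - sV, and s is arbitrarily small
(`le_localLiminf_arctan`). This needs arctangent maps only; it passes to all diffeomorphisms, then
to the χ² bound, then to the minimax risk. For the approximation bound, φ is the affine tangent of ψ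
and the prior is the biweight density on the ball of radius c n^{-1/2}, whose information is O(n/c²)
and hence negligible against n I(θ₀) as c → ∞. For two points, n-fold affinities converge to
exp(-ε²/8) with ε² = zᵀ I(θ₀) z, and Cauchy–Schwarz shows that no direction beats the efficient one,
which leaves a one-variable supremum, enclosed numerically by a tangent-line estimate. -/

namespace LAM

/-! ### Root densities and the Hellinger distance -/

/-- `f` is a root density of `μ` with respect to `ρ`: `dμ = f² dρ` with `f ≥ 0` measurable. -/
structure HasRootDensity {Ω : Type*} [MeasurableSpace Ω] (μ ρ : Measure Ω) (f : Ω → ℝ) : Prop where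
  measurable : Measurable f
  nonneg : ∀ x, 0 ≤ f x
  eq : μ = ρ.withDensity fun x => ENNReal.ofReal (f x ^ 2)

section Root

variable {Ω : Type*} [MeasurableSpace Ω] {μ μ₁ μ₂ ρ : Measure Ω} {f g : Ω → ℝ}

theorem HasRootDensity.absolutelyContinuous (h : HasRootDensity μ ρ f) : μ ≪ ρ := by
  rw [h.eq]; exact withDensity_absolutelyContinuous _ _

theorem HasRootDensity.rnDeriv_ae [SigmaFinite ρ] (h : HasRootDensity μ ρ f) :
    μ.rnDeriv ρ =ᵐ[ρ] fun x => ENNReal.ofReal (f x ^ 2) := by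
  rw [h.eq]
  exact Measure.rnDeriv_withDensity _ (h.measurable.pow_const 2).ennreal_ofReal

theorem hasRootDensity_sqrt_rnDeriv [SigmaFinite μ] [SigmaFinite ρ] (h : μ ≪ ρ) :
    HasRootDensity μ ρ fun x => √(μ.rnDeriv ρ x).toReal where
  measurable := by fun_prop
  nonneg x := Real.sqrt_nonneg _
  eq := by
    conv_lhs => rw [← Measure.withDensity_rnDeriv_eq μ ρ h]
    refine withDensity_congr_ae ?_
    filter_upwards [μ.rnDeriv_ne_top ρ] with x hx
    rw [Real.sq_sqrt ENNReal.toReal_nonneg, ENNReal.ofReal_toReal hx]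

theorem HasRootDensity.lintegral_eq (h : HasRootDensity μ ρ f) (F : Ω → ℝ≥0∞) (hF : Measurable F) :
    ∫⁻ x, F x ∂μ = ∫⁻ x, ENNReal.ofReal (f x ^ 2) * F x ∂ρ := by
  rw [h.eq, lintegral_withDensity_eq_lintegral_mul _ (h.measurable.pow_const 2).ennreal_ofReal hF]
  rfl

theorem HasRootDensity.integral_eq (h : HasRootDensity μ ρ f) (F : Ω → ℝ) :
    ∫ x, F x ∂μ = ∫ x, f x ^ 2 * F x ∂ρ := by
  rw [h.eq, integral_withDensity_eq_integral_toReal_smul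
    (h.measurable.pow_const 2).ennreal_ofReal (by simp)]
  simp [ENNReal.toReal_ofReal (sq_nonneg _)]

theorem HasRootDensity.integrable_iff (h : HasRootDensity μ ρ f) (F : Ω → ℝ) :
    Integrable F μ ↔ Integrable (fun x => f x ^ 2 * F x) ρ := by
  rw [h.eq, integrable_withDensity_iff_integrable_smul'
    (h.measurable.pow_const 2).ennreal_ofReal (by simp)]
  simp [ENNReal.toReal_ofReal (sq_nonneg _)]

theorem HasRootDensity.memLp [IsFiniteMeasure μ] (h : HasRootDensity μ ρ f) : MemLp f 2 ρ := by
  rw [memLp_two_iff_integrable_sq h.measurable.aestronglyMeasurable]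
  simpa using (h.integrable_iff (fun _ => 1)).1 (integrable_const 1)

theorem HasRootDensity.integral_sq [IsProbabilityMeasure μ] (h : HasRootDensity μ ρ f) :
    ∫ x, f x ^ 2 ∂ρ = 1 := by
  have := h.integral_eq (fun _ => 1)
  simpa using this.symm

/-- The chain rule for Radon–Nikodym derivatives, applied under the square root, makes the integrand
scale exactly like the change of dominating measure from `μ₁ + μ₂` to `ρ`. -/
theorem hellingerSq_eq_lintegral [SigmaFinite ρ] [IsFiniteMeasure μ₁] [IsFiniteMeasure μ₂]
    (h₁ : HasRootDensity μ₁ ρ f) (h₂ : HasRootDensity μ₂ ρ g) :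
    hellingerSq μ₁ μ₂ = ∫⁻ x, ENNReal.ofReal ((f x - g x) ^ 2) ∂ρ := by
  have hac : μ₁ + μ₂ ≪ ρ := by
    refine Measure.AbsolutelyContinuous.add_left h₁.absolutelyContinuous h₂.absolutelyContinuous
  have a₁ : μ₁ ≪ μ₁ + μ₂ := Measure.AbsolutelyContinuous.add_right .rfl _
  have a₂ : μ₂ ≪ μ₁ + μ₂ := by
    rw [add_comm]; exact Measure.AbsolutelyContinuous.add_right .rfl _
  unfold hellingerSq
  rw [← lintegral_rnDeriv_mul hac (Measurable.aemeasurable (by fun_prop))]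
  refine lintegral_congr_ae ?_
  filter_upwards [Measure.rnDeriv_mul_rnDeriv a₁ (κ := ρ), Measure.rnDeriv_mul_rnDeriv a₂ (κ := ρ),
    h₁.rnDeriv_ae, h₂.rnDeriv_ae, (μ₁ + μ₂).rnDeriv_ne_top ρ] with x e₁ e₂ e₃ e₄ e₅
  rw [e₃] at e₁
  rw [e₄] at e₂
  have k₁ := congrArg ENNReal.toReal e₁
  have k₂ := congrArg ENNReal.toReal e₂
  simp only [Pi.mul_apply, ENNReal.toReal_mul, ENNReal.toReal_ofReal (sq_nonneg _)] at k₁ k₂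
  have q₁ := congrArg Real.sqrt k₁
  have q₂ := congrArg Real.sqrt k₂
  rw [Real.sqrt_mul' _ ENNReal.toReal_nonneg, Real.sqrt_sq (h₁.nonneg x)] at q₁
  rw [Real.sqrt_mul' _ ENNReal.toReal_nonneg, Real.sqrt_sq (h₂.nonneg x)] at q₂
  rw [← q₁, ← q₂, ← ENNReal.ofReal_toReal e₅, ← ENNReal.ofReal_mul ENNReal.toReal_nonneg]
  congr 1
  rw [← sub_mul, mul_pow, Real.sq_sqrt ENNReal.toReal_nonneg, ENNReal.toReal_ofReal
    ENNReal.toReal_nonneg, mul_comm]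

theorem hellingerSq_eq_ofReal_integral [SigmaFinite ρ] [IsFiniteMeasure μ₁] [IsFiniteMeasure μ₂]
    (h₁ : HasRootDensity μ₁ ρ f) (h₂ : HasRootDensity μ₂ ρ g) :
    hellingerSq μ₁ μ₂ = ENNReal.ofReal (∫ x, (f x - g x) ^ 2 ∂ρ) := by
  have md : MemLp (fun x => f x - g x) 2 ρ := h₁.memLp.sub h₂.memLp
  rw [hellingerSq_eq_lintegral h₁ h₂, ofReal_integral_eq_lintegral_ofReal
    md.integrable_sq (Eventually.of_forall fun x => sq_nonneg _)]

theorem HasRootDensity.integrable_mul [IsFiniteMeasure μ₁] [IsFiniteMeasure μ₂]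
    (h₁ : HasRootDensity μ₁ ρ f) (h₂ : HasRootDensity μ₂ ρ g) :
    Integrable (fun x => f x * g x) ρ :=
  h₁.memLp.integrable_mul h₂.memLp

theorem integral_sub_sq_eq_affinity [IsProbabilityMeasure μ₁] [IsProbabilityMeasure μ₂]
    (h₁ : HasRootDensity μ₁ ρ f) (h₂ : HasRootDensity μ₂ ρ g) :
    ∫ x, (f x - g x) ^ 2 ∂ρ = 2 - 2 * ∫ x, f x * g x ∂ρ := by
  have e : ∀ x, (f x - g x) ^ 2 = f x ^ 2 + g x ^ 2 - 2 * (f x * g x) := fun x => by ring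
  have i₁ : Integrable (fun x => f x ^ 2 + g x ^ 2) ρ :=
    h₁.memLp.integrable_sq.add h₂.memLp.integrable_sq
  simp_rw [e]
  rw [integral_sub i₁ ((h₁.integrable_mul h₂).const_mul 2), integral_add h₁.memLp.integrable_sq
    h₂.memLp.integrable_sq, h₁.integral_sq, h₂.integral_sq, integral_const_mul]
  ring

theorem sq_integral_mul_le {u v : Ω → ℝ} (hu : MemLp u 2 ρ) (hv : MemLp v 2 ρ) :
    (∫ x, u x * v x ∂ρ) ^ 2 ≤ (∫ x, u x ^ 2 ∂ρ) * ∫ x, v x ^ 2 ∂ρ := by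
  have hu' : MemLp (fun x => |u x|) (ENNReal.ofReal 2) ρ := by simpa using hu.norm
  have hv' : MemLp (fun x => |v x|) (ENNReal.ofReal 2) ρ := by simpa using hv.norm
  have := integral_mul_le_Lp_mul_Lq_of_nonneg
    Real.HolderConjugate.two_two (Eventually.of_forall fun x => abs_nonneg (u x))
    (Eventually.of_forall fun x => abs_nonneg (v x)) hu' hv'
  simp only [Real.rpow_two, sq_abs, ← abs_mul] at this
  have h0 := (abs_integral_le_integral_abs (f := fun x => u x * v x)).trans this
  rw [← sq_abs]
  refine (pow_le_pow_left₀ (abs_nonneg _) h0 2).trans (le_of_eq ?_)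
  rw [mul_pow, ← Real.sqrt_eq_rpow, ← Real.sqrt_eq_rpow, Real.sq_sqrt, Real.sq_sqrt]
  · exact integral_nonneg fun x => sq_nonneg _
  · exact integral_nonneg fun x => sq_nonneg _

/-- Expectations of a square integrable function under two laws differ by at most the
Hellinger distance times second moments. -/
theorem sq_integral_sub_integral_le [IsFiniteMeasure μ₁] [IsFiniteMeasure μ₂]
    (h₁ : HasRootDensity μ₁ ρ f) (h₂ : HasRootDensity μ₂ ρ g) {Z : Ω → ℝ} (hZ : Measurable Z)
    (hZ₁ : MemLp Z 2 μ₁) (hZ₂ : MemLp Z 2 μ₂) :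
    (∫ x, Z x ∂μ₁ - ∫ x, Z x ∂μ₂) ^ 2 ≤
      (∫ x, (f x - g x) ^ 2 ∂ρ) * (2 * ∫ x, Z x ^ 2 ∂μ₁ + 2 * ∫ x, Z x ^ 2 ∂μ₂) := by
  have i₁ := (h₁.integrable_iff _).1 (hZ₁.integrable (by norm_num))
  have i₂ := (h₂.integrable_iff _).1 (hZ₂.integrable (by norm_num))
  have s₁ := (h₁.integrable_iff _).1 hZ₁.integrable_sq
  have s₂ := (h₂.integrable_iff _).1 hZ₂.integrable_sq
  have m₁ : MemLp (fun x => f x * Z x) 2 ρ := by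
    refine (memLp_two_iff_integrable_sq (h₁.measurable.mul hZ).aestronglyMeasurable).2 ?_
    simpa [mul_pow] using s₁
  have m₂ : MemLp (fun x => g x * Z x) 2 ρ := by
    refine (memLp_two_iff_integrable_sq (h₂.measurable.mul hZ).aestronglyMeasurable).2 ?_
    simpa [mul_pow] using s₂
  have ms : MemLp (fun x => f x * Z x + g x * Z x) 2 ρ := m₁.add m₂
  have md : MemLp (fun x => f x - g x) 2 ρ := h₁.memLp.sub h₂.memLp
  -- The difference of densities is factored as f² - g² = (f - g)(f + g), so that Cauchy–Schwarz
  -- separates the Hellinger distance from the second moments.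
  have e : ∫ x, Z x ∂μ₁ - ∫ x, Z x ∂μ₂ = ∫ x, (f x - g x) * (f x * Z x + g x * Z x) ∂ρ := by
    rw [h₁.integral_eq, h₂.integral_eq, ← integral_sub i₁ i₂]
    congr 1; ext x; ring
  rw [e]
  refine (sq_integral_mul_le md ms).trans (mul_le_mul_of_nonneg_left ?_ (integral_nonneg fun x => sq_nonneg _))
  rw [h₁.integral_eq, h₂.integral_eq, ← integral_const_mul, ← integral_const_mul,
    ← integral_add (s₁.const_mul 2) (s₂.const_mul 2)]
  refine integral_mono ms.integrable_sq ((s₁.const_mul 2).add (s₂.const_mul 2)) fun x => ?_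
  nlinarith [sq_nonneg (f x * Z x - g x * Z x)]

theorem HasRootDensity.pi [SigmaFinite ρ] [IsFiniteMeasure μ] (h : HasRootDensity μ ρ f) (n : ℕ) :
    HasRootDensity (Measure.pi fun _ : Fin n => μ) (Measure.pi fun _ => ρ)
      fun x => ∏ i, f (x i) where
  measurable := Finset.measurable_prod _ fun i _ => h.measurable.comp (measurable_pi_apply i)
  nonneg x := Finset.prod_nonneg fun i _ => h.nonneg _
  eq := by
    refine (Measure.pi_eq fun s hs => ?_)
    rw [withDensity_apply _ (MeasurableSet.univ_pi hs), Measure.restrict_pi_pi]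
    have : ∀ i, Integrable (fun x => f x ^ 2) (ρ.restrict (s i)) := fun i =>
      h.memLp.integrable_sq.restrict
    simp_rw [← Finset.prod_pow]
    rw [← ofReal_integral_eq_lintegral_ofReal
      (Integrable.fintype_prod_dep (f := fun (_ : Fin n) x => f x ^ 2) this)
      (Eventually.of_forall fun x => Finset.prod_nonneg fun i _ => sq_nonneg _),
      integral_fintype_prod_eq_prod (fun (_ : Fin n) x => f x ^ 2),
      ENNReal.ofReal_prod_of_nonneg fun i _ => integral_nonneg fun x => sq_nonneg _]
    refine Finset.prod_congr rfl fun i _ => ?_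
    rw [ofReal_integral_eq_lintegral_ofReal (this i) (Eventually.of_forall fun x => sq_nonneg _),
      ← withDensity_apply _ (hs i), ← h.eq]

/-- Tensorization of the squared Hellinger distance. -/
theorem integral_pi_sub_sq [SigmaFinite ρ] [IsProbabilityMeasure μ₁] [IsProbabilityMeasure μ₂]
    (h₁ : HasRootDensity μ₁ ρ f) (h₂ : HasRootDensity μ₂ ρ g) (n : ℕ) :
    ∫ x, (∏ i, f (x i) - ∏ i, g (x i)) ^ 2 ∂(Measure.pi fun _ : Fin n => ρ) =
      2 - 2 * (1 - (∫ x, (f x - g x) ^ 2 ∂ρ) / 2) ^ n := by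
  rw [integral_sub_sq_eq_affinity (h₁.pi n) (h₂.pi n), integral_sub_sq_eq_affinity h₁ h₂]
  simp_rw [← Finset.prod_mul_distrib]
  rw [integral_fintype_prod_eq_pow (ι := Fin n) (fun x => f x * g x), Fintype.card_fin]
  congr 3; ring

theorem integral_sub_sq_le_two [IsProbabilityMeasure μ₁] [IsProbabilityMeasure μ₂]
    (h₁ : HasRootDensity μ₁ ρ f) (h₂ : HasRootDensity μ₂ ρ g) :
    ∫ x, (f x - g x) ^ 2 ∂ρ ≤ 2 := by
  rw [integral_sub_sq_eq_affinity h₁ h₂]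
  have : 0 ≤ ∫ x, f x * g x ∂ρ := integral_nonneg fun x => mul_nonneg (h₁.nonneg x) (h₂.nonneg x)
  linarith

/-- Bernoulli's inequality applied to the tensorized affinity; it only needs the one-sample squared
distance to be at most 2. -/
theorem integral_pi_sub_sq_le [SigmaFinite ρ] [IsProbabilityMeasure μ₁] [IsProbabilityMeasure μ₂]
    (h₁ : HasRootDensity μ₁ ρ f) (h₂ : HasRootDensity μ₂ ρ g) (n : ℕ) :
    ∫ x, (∏ i, f (x i) - ∏ i, g (x i)) ^ 2 ∂(Measure.pi fun _ : Fin n => ρ) ≤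
      n * ∫ x, (f x - g x) ^ 2 ∂ρ := by
  rw [integral_pi_sub_sq h₁ h₂]
  have h2 := integral_sub_sq_le_two h₁ h₂
  have := one_add_mul_le_pow (a := -((∫ x, (f x - g x) ^ 2 ∂ρ) / 2)) (by linarith) n
  rw [← sub_eq_add_neg] at this
  linarith

end Root

end LAM

namespace LAM

variable {d : ℕ} {𝒳 : Type*} [MeasurableSpace 𝒳]

/-! ### Minimax risk: truncation and the two-point bound -/

/-- Clipping an estimator to an interval that contains all values of ψ on S never increases its
loss, so only bounded estimators matter and their integrability is automatic. The interval uses |K|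
because K may be negative when S is empty. -/
theorem le_minimaxRisk_of_bounded {P : Par d → Measure 𝒳} {ψ : Par d → ℝ} {n : ℕ}
    {S : Set (Par d)} {K : ℝ} (hK : ∀ θ ∈ S, |ψ θ| ≤ K) {b : ℝ≥0∞}
    (h : ∀ T : (Fin n → 𝒳) → ℝ, Measurable T → (∀ x, |T x| ≤ |K|) →
      b ≤ ⨆ θ ∈ S, ∫⁻ x, ENNReal.ofReal ((T x - ψ θ) ^ 2) ∂(iidLaw P n θ)) :
    b ≤ minimaxRisk P ψ n S := by
  refine le_iInf₂ fun T hT => ?_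
  refine (h (fun x => max (-|K|) (min |K| (T x))) (by fun_prop) fun x => ?_).trans ?_
  · rw [abs_le]
    exact ⟨le_max_left _ _, max_le (by linarith [abs_nonneg K]) (min_le_left _ _)⟩
  · refine iSup₂_mono fun θ hθ => lintegral_mono fun x => ENNReal.ofReal_le_ofReal ?_
    have := abs_le.1 ((hK θ hθ).trans (le_abs_self K))
    rw [sq_le_sq, abs_le]
    have h0 := abs_nonneg K
    constructor
    · rcases le_total (T x) |K| with h1 | h1
      · rw [min_eq_right h1]
        rcases le_total (-|K|) (T x) with h2 | h2
        · rw [max_eq_right h2]; linarith [neg_abs_le (T x - ψ θ)]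
        · rw [max_eq_left h2]; rw [abs_of_nonpos (by linarith)]; linarith
      · rw [min_eq_left h1, max_eq_right (by linarith)]
        linarith [abs_nonneg (T x - ψ θ)]
    · rcases le_total (T x) |K| with h1 | h1
      · rw [min_eq_right h1]
        rcases le_total (-|K|) (T x) with h2 | h2
        · rw [max_eq_right h2]; exact le_abs_self _
        · rw [max_eq_left h2]; linarith [abs_nonneg (T x - ψ θ)]
      · rw [min_eq_left h1, max_eq_right (by linarith)]
        linarith [le_abs_self (T x - ψ θ)]

/-- With A the affinity, (b - a)A is a difference of two integrals, each at most √r in absolute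
value by Cauchy–Schwarz; hence (b - a)²A² ≤ 4r. Since H² = 2 - 2A, one has 1 - H² = 2A - 1 ≤ A². -/
theorem twoPoint_le_of_risk_le {Ω : Type*} [MeasurableSpace Ω] {μ₁ μ₂ ρ : Measure Ω} {f g : Ω → ℝ}
    [SigmaFinite ρ] [IsProbabilityMeasure μ₁] [IsProbabilityMeasure μ₂]
    (h₁ : HasRootDensity μ₁ ρ f) (h₂ : HasRootDensity μ₂ ρ g) {T : Ω → ℝ} (hT : Measurable T)
    {a b : ℝ} {r : ℝ≥0∞}
    (ha : ∫⁻ x, ENNReal.ofReal ((T x - a) ^ 2) ∂μ₁ ≤ r)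
    (hb : ∫⁻ x, ENNReal.ofReal ((T x - b) ^ 2) ∂μ₂ ≤ r) :
    (1 - hellingerSq μ₁ μ₂) / 4 * ENNReal.ofReal ((a - b) ^ 2) ≤ r := by
  by_cases hr : r = ⊤
  · simp [hr]
  lift r to NNReal using hr
  have key : ∀ {μ : Measure Ω} {f : Ω → ℝ} {a : ℝ} (h : HasRootDensity μ ρ f)
      (ha : ∫⁻ x, ENNReal.ofReal ((T x - a) ^ 2) ∂μ ≤ r),
      MemLp (fun x => (T x - a) * f x) 2 ρ ∧ ∫ x, ((T x - a) * f x) ^ 2 ∂ρ ≤ r := by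
    intro μ f a h ha
    rw [h.lintegral_eq _ (by fun_prop)] at ha
    have e : ∀ x, ENNReal.ofReal (f x ^ 2) * ENNReal.ofReal ((T x - a) ^ 2) =
        ENNReal.ofReal (((T x - a) * f x) ^ 2) := fun x => by
      rw [← ENNReal.ofReal_mul (sq_nonneg _), mul_pow, mul_comm]
    simp_rw [e] at ha
    have hm : Measurable fun x => (T x - a) * f x := (hT.sub_const a).mul h.measurable
    have hi : Integrable (fun x => ((T x - a) * f x) ^ 2) ρ := by
      refine ⟨(hm.pow_const 2).aestronglyMeasurable, ?_⟩
      rw [hasFiniteIntegral_iff_ofReal (Eventually.of_forall fun x => sq_nonneg _)]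
      exact ha.trans_lt ENNReal.coe_lt_top
    refine ⟨(memLp_two_iff_integrable_sq hm.aestronglyMeasurable).2 hi, ?_⟩
    rw [integral_eq_lintegral_of_nonneg_ae (Eventually.of_forall fun x => sq_nonneg _)
      hi.aestronglyMeasurable]
    exact ENNReal.toReal_mono ENNReal.coe_ne_top ha
  obtain ⟨m₁, r₁⟩ := key h₁ ha
  obtain ⟨m₂, r₂⟩ := key h₂ hb
  have c₁ := sq_integral_mul_le m₁ h₂.memLp
  have c₂ := sq_integral_mul_le m₂ h₁.memLp
  rw [h₂.integral_sq, mul_one] at c₁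
  rw [h₁.integral_sq, mul_one] at c₂
  have e : (b - a) * ∫ x, f x * g x ∂ρ =
      ∫ x, ((T x - a) * f x) * g x ∂ρ - ∫ x, ((T x - b) * g x) * f x ∂ρ := by
    have i₁ : Integrable (fun x => ((T x - a) * f x) * g x) ρ := m₁.integrable_mul h₂.memLp
    have i₂ : Integrable (fun x => ((T x - b) * g x) * f x) ρ := m₂.integrable_mul h₁.memLp
    rw [← integral_const_mul, ← integral_sub i₁ i₂]
    congr 1; ext x; ring
  have hH := hellingerSq_eq_ofReal_integral h₁ h₂
  have hA := integral_sub_sq_eq_affinity h₁ h₂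
  set H := ∫ x, (f x - g x) ^ 2 ∂ρ
  set A := ∫ x, f x * g x ∂ρ
  set u := ∫ x, ((T x - a) * f x) * g x ∂ρ
  set v := ∫ x, ((T x - b) * g x) * f x ∂ρ
  have hr0 : (0 : ℝ) ≤ r := r.2
  have hm : (1 - H) / 4 * (a - b) ^ 2 ≤ r := by
    have h1 : ((b - a) * A) ^ 2 ≤ 4 * r := by rw [e]; nlinarith [sq_nonneg (u + v)]
    have h2 : (1 - H) ≤ A ^ 2 := by rw [hA]; nlinarith [sq_nonneg (A - 1)]
    nlinarith [mul_le_mul_of_nonneg_right h2 (sq_nonneg (a - b))]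
  rw [hH, ← ENNReal.ofReal_one, ← ENNReal.ofReal_sub _ (integral_nonneg fun x => sq_nonneg _)]
  rcases le_total H 1 with h | h
  · rw [show (4 : ℝ≥0∞) = ENNReal.ofReal 4 by simp, ← ENNReal.ofReal_div_of_pos (by norm_num),
      ← ENNReal.ofReal_mul (by linarith)]
    exact ENNReal.ofReal_le_of_le_toReal (by simpa using hm)
  · rw [ENNReal.ofReal_of_nonpos (by linarith)]
    simp

/-! ### Mixtures -/

section Mixture

variable {Ω : Type*} [MeasurableSpace Ω] {κ : Par d → Measure Ω}

theorem measurable_prod_dirac (hκ : Measurable κ) [hκp : ∀ t, IsProbabilityMeasure (κ t)]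
    (h : Par d) : Measurable fun t => (κ (t + h)).prod (Measure.dirac t) := by
  let k : ProbabilityTheory.Kernel (Par d) Ω := ⟨fun t => κ (t + h), hκ.comp (by fun_prop)⟩
  have : ProbabilityTheory.IsMarkovKernel k := ⟨fun t => hκp (t + h)⟩
  have : (fun t => (κ (t + h)).prod (Measure.dirac t)) =
      fun t => (k.prod ProbabilityTheory.Kernel.id) t := by
    ext1 t
    rw [ProbabilityTheory.Kernel.prod_apply, ProbabilityTheory.Kernel.id_apply]
    rfl
  rw [this]
  exact ProbabilityTheory.Kernel.measurable _

theorem lintegral_mixture (hκ : Measurable κ) [hκp : ∀ t, IsProbabilityMeasure (κ t)]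
    (Q : Measure (Par d)) (h : Par d) {F : Ω × Par d → ℝ≥0∞} (hF : Measurable F) :
    ∫⁻ z, F z ∂(mixture κ Q h) = ∫⁻ t, ∫⁻ x, F (x, t - h) ∂(κ t) ∂Q := by
  have hm := measurable_prod_dirac hκ h
  unfold mixture
  rw [Measure.lintegral_bind hm.aemeasurable hF.aemeasurable,
    lintegral_map (f := fun a => ∫⁻ x, F x ∂(κ (a + h)).prod (Measure.dirac a))
      ((Measure.measurable_lintegral hF).comp hm) (by fun_prop)]
  refine lintegral_congr fun t => ?_
  rw [sub_add_cancel, lintegral_prod _ hF.aemeasurable]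
  refine lintegral_congr fun x => ?_
  exact lintegral_dirac' _ (hF.comp measurable_prodMk_left)

theorem isProbabilityMeasure_mixture (hκ : Measurable κ) [hκp : ∀ t, IsProbabilityMeasure (κ t)]
    (Q : Measure (Par d)) [IsProbabilityMeasure Q] (h : Par d) :
    IsProbabilityMeasure (mixture κ Q h) := by
  constructor
  have := lintegral_mixture hκ Q h (F := fun _ => 1) measurable_const
  simpa using this

/-- This turns every expectation under 𝙿_h into one under 𝙿_0 of a function translated in the
parameter; the data coordinate is untouched, so an estimator is not affected by the shift. -/
theorem mixture_eq_map (hκ : Measurable κ) [∀ t, IsProbabilityMeasure (κ t)]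
    (Q : Measure (Par d)) (h : Par d) :
    mixture κ Q h = (mixture κ Q 0).map fun z => (z.1, z.2 - h) := by
  have hm : Measurable fun z : Ω × Par d => (z.1, z.2 - h) := by fun_prop
  refine Measure.ext_of_lintegral _ fun F hF => ?_
  rw [lintegral_mixture hκ Q h hF, lintegral_map hF hm,
    lintegral_mixture hκ Q 0 (F := fun z => F (z.1, z.2 - h)) (hF.comp hm)]
  simp

theorem map_snd_mixture (hκ : Measurable κ) [∀ t, IsProbabilityMeasure (κ t)]
    (Q : Measure (Par d)) : (mixture κ Q 0).map Prod.snd = Q := by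
  refine Measure.ext_of_lintegral _ fun F hF => ?_
  rw [lintegral_map hF measurable_snd, lintegral_mixture hκ Q 0 (F := fun z => F z.2)
    (hF.comp measurable_snd)]
  simp

end Mixture

/-! ### Upper bounds for the mixture bounds -/

section ChiSq

variable {Ω : Type*} [MeasurableSpace Ω] {μ₁ μ₀ : Measure Ω}

/-- The Chapman–Robbins inequality: the difference of means is the `μ₀`-integral of Z against the
likelihood ratio minus one, and Cauchy–Schwarz applies. -/
theorem sq_integral_sub_le_chiSq [IsProbabilityMeasure μ₁] [IsProbabilityMeasure μ₀]
    (hχ : chiSq μ₁ μ₀ ≠ ⊤) {Z : Ω → ℝ} (hZ : Measurable Z) {C : ℝ} (hC : ∀ x, |Z x| ≤ C) :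
    (∫ x, Z x ∂μ₁ - ∫ x, Z x ∂μ₀) ^ 2 ≤ (chiSq μ₁ μ₀).toReal * ∫ x, Z x ^ 2 ∂μ₀ := by
  have hac : μ₁ ≪ μ₀ := by
    by_contra h
    exact hχ (by simp [chiSq, h])
  have hχe : chiSq μ₁ μ₀ =
      ∫⁻ x, ENNReal.ofReal (((μ₁.rnDeriv μ₀ x).toReal - 1) ^ 2) ∂μ₀ := by simp [chiSq, hac]
  have hm : Measurable fun x => (μ₁.rnDeriv μ₀ x).toReal - 1 := by fun_prop
  have hi : Integrable (fun x => ((μ₁.rnDeriv μ₀ x).toReal - 1) ^ 2) μ₀ := by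
    refine ⟨(hm.pow_const 2).aestronglyMeasurable, ?_⟩
    rw [hasFiniteIntegral_iff_ofReal (Eventually.of_forall fun x => sq_nonneg _), ← hχe]
    exact hχ.lt_top
  have hχr : (chiSq μ₁ μ₀).toReal = ∫ x, ((μ₁.rnDeriv μ₀ x).toReal - 1) ^ 2 ∂μ₀ := by
    rw [hχe, integral_eq_lintegral_of_nonneg_ae (Eventually.of_forall fun x => sq_nonneg _)
      hi.aestronglyMeasurable]
  have hml := (memLp_two_iff_integrable_sq hm.aestronglyMeasurable).2 hi
  have hZl : MemLp Z 2 μ₀ := MemLp.of_bound hZ.aestronglyMeasurable C (Eventually.of_forall hC)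
  have hZ1 : Integrable Z μ₁ := Integrable.of_bound hZ.aestronglyMeasurable C (Eventually.of_forall hC)
  have hZ0 : Integrable Z μ₀ := Integrable.of_bound hZ.aestronglyMeasurable C (Eventually.of_forall hC)
  have e : ∫ x, Z x ∂μ₁ - ∫ x, Z x ∂μ₀ = ∫ x, ((μ₁.rnDeriv μ₀ x).toReal - 1) * Z x ∂μ₀ := by
    rw [← integral_rnDeriv_smul hac, ← integral_sub ((integrable_rnDeriv_smul_iff hac).2 hZ1) hZ0]
    congr 1; ext x; simp only [smul_eq_mul]; ring
  rw [e, hχr]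
  exact sq_integral_mul_le hml hZl

/-- Let u², v² be the densities of μ₀, μ₁ with respect to their sum, so u² + v² = 1. Relative to the
midpoint the likelihood ratio minus one is v² - u² = (v - u)(v + u), and (v + u)² ≤ 2 cancels the
factor 1/2 of the midpoint. -/
theorem chiSq_half_le_hellingerSq [IsProbabilityMeasure μ₁] [IsProbabilityMeasure μ₀] :
    chiSq μ₁ ((2⁻¹ : ℝ≥0∞) • μ₁ + (2⁻¹ : ℝ≥0∞) • μ₀) ≤ hellingerSq μ₀ μ₁ := by
  set σ := μ₀ + μ₁ with hσ
  have e : (2⁻¹ : ℝ≥0∞) • μ₁ + (2⁻¹ : ℝ≥0∞) • μ₀ = (2⁻¹ : ℝ≥0∞) • σ := by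
    rw [← smul_add, add_comm]
  have a₁ : μ₁ ≪ σ := by
    rw [hσ, add_comm]; exact Measure.AbsolutelyContinuous.add_right .rfl _
  have a₂ : μ₁ ≪ (2⁻¹ : ℝ≥0∞) • σ := a₁.smul_right (by simp)
  rw [e, chiSq, if_pos a₂, lintegral_smul_measure, hellingerSq, ← hσ, smul_eq_mul,
    ← lintegral_const_mul _ (by fun_prop)]
  have hsum : μ₀.rnDeriv σ + μ₁.rnDeriv σ =ᵐ[σ] 1 :=
    (Measure.rnDeriv_add μ₀ μ₁ σ).symm.trans (Measure.rnDeriv_self σ)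
  refine lintegral_mono_ae ?_
  filter_upwards [hsum, Measure.rnDeriv_smul_right_of_ne_top (ν := μ₁) (μ := σ) (r := 2⁻¹) (by simp) (by simp),
    μ₀.rnDeriv_ne_top σ, μ₁.rnDeriv_ne_top σ] with x h1 h2 h3 h4
  rw [h2]
  have h5 := congrArg ENNReal.toReal h1
  simp only [Pi.add_apply, Pi.one_apply, ENNReal.toReal_one] at h5
  rw [ENNReal.toReal_add h3 h4] at h5
  simp only [inv_inv, Pi.smul_apply, smul_eq_mul, ENNReal.toReal_mul, ENNReal.toReal_ofNat]
  have ha : 0 ≤ (μ₀.rnDeriv σ x).toReal := ENNReal.toReal_nonneg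
  have hb : 0 ≤ (μ₁.rnDeriv σ x).toReal := ENNReal.toReal_nonneg
  have h2' : (2⁻¹ : ℝ≥0∞) = ENNReal.ofReal 2⁻¹ := by
    rw [ENNReal.ofReal_inv_of_pos (by norm_num)]; simp
  rw [h2', ← ENNReal.ofReal_mul (by norm_num)]
  refine ENNReal.ofReal_le_ofReal ?_
  set a := (μ₀.rnDeriv σ x).toReal
  set b := (μ₁.rnDeriv σ x).toReal
  obtain ⟨u, hu, hu'⟩ : ∃ u, 0 ≤ u ∧ u ^ 2 = a := ⟨√a, Real.sqrt_nonneg _, Real.sq_sqrt ha⟩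
  obtain ⟨v, hv, hv'⟩ : ∃ v, 0 ≤ v ∧ v ^ 2 = b := ⟨√b, Real.sqrt_nonneg _, Real.sq_sqrt hb⟩
  rw [← hv', ← hu'] at h5 ⊢
  rw [Real.sqrt_sq hu, Real.sqrt_sq hv]
  have e1 : 2 * v ^ 2 - 1 = (v - u) * (v + u) := by linear_combination h5
  rw [e1, mul_pow]
  nlinarith [mul_nonneg (sq_nonneg (v - u)) (sq_nonneg (v - u)), sq_nonneg (v - u)]

end ChiSq

section MixtureBounds

variable {Ω : Type*} [MeasurableSpace Ω] {κ : Par d → Measure Ω}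

/-- Take λ = 1/2: the factor (1 - λ)² accounts for the 4 in the Hellinger bound, the χ² divergence
to the midpoint is at most H², and the subtracted term only shrinks. -/
theorem hellingerMixtureBound_le_chiSqMixtureBound (hκ : Measurable κ)
    [∀ t, IsProbabilityMeasure (κ t)] (ψ : Par d → ℝ) :
    hellingerMixtureBound κ ψ ≤ chiSqMixtureBound κ ψ := by
  refine iSup₂_le fun Q h => ?_
  have := isProbabilityMeasure_mixture hκ (Q : Measure (Par d)) h
  have := isProbabilityMeasure_mixture hκ (Q : Measure (Par d)) 0
  refine le_trans ?_ (le_iSup_of_le Q (le_iSup₂_of_le (1 / 2 : ℝ) (by norm_num)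
    (le_iSup_of_le h le_rfl)))
  have h2 : ENNReal.ofReal (1 / 2) = 2⁻¹ := by
    rw [one_div, ENNReal.ofReal_inv_of_pos (by norm_num)]; simp
  have h4 : ENNReal.ofReal ((1 - 1 / 2) ^ 2) = 4⁻¹ := by
    rw [show ((1 : ℝ) - 1 / 2) ^ 2 = 4⁻¹ by norm_num, ENNReal.ofReal_inv_of_pos (by norm_num)]
    simp
  rw [h4, show (1 : ℝ) - 1 / 2 = 1 / 2 by norm_num, h2]
  gcongr
  · rw [ENNReal.div_eq_inv_mul, ENNReal.div_eq_inv_mul, ENNReal.mul_inv (by simp) (by simp),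
      mul_assoc]
    gcongr
    exact chiSq_half_le_hellingerSq
  · exact mul_le_of_le_one_left (by simp) (by simp)

/-- W is the second moment of the loss under the λ-mixture. It is at most (√r + √(λB))² because λ ≤
√λ on [0, 1] absorbs the cross term. -/
theorem mixture_risk_real_ineq {r B l χ D W : ℝ} (hr : 0 ≤ r) (hB : 0 ≤ B) (hl : 0 ≤ l) (hl1 : l ≤ 1)
    (hχ : 0 ≤ χ) (hW : W ≤ l * (r + 2 * √(r * B) + B) + (1 - l) * r)
    (hD : ((1 - l) * D) ^ 2 ≤ χ * W) : ((1 - l) * D) ^ 2 ≤ χ * (√r + √(l * B)) ^ 2 := by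
  refine hD.trans (mul_le_mul_of_nonneg_left (hW.trans ?_) hχ)
  rw [Real.sqrt_mul hr, Real.sqrt_mul hl]
  have h1 := Real.sq_sqrt hr
  have h2 := Real.sq_sqrt hB
  have h3 := Real.sq_sqrt hl
  have h4 : l ≤ √l := Real.le_sqrt_of_sq_le (by nlinarith)
  have h5 : 0 ≤ √r * √B := by positivity
  nlinarith [mul_le_mul_of_nonneg_right h4 h5]

/-- Chapman–Robbins for Z(x, t) = T(x) - ψ(t), comparing 𝙿_h with the λ-mixture. The difference of
means is (1 - λ) times the mean shift of ψ, whatever T is, and the second moment is controlled by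
the risk r and the shift term B. -/
theorem chiSqMixtureBound_le (hκ : Measurable κ) [∀ t, IsProbabilityMeasure (κ t)]
    {ψ : Par d → ℝ} (hψ : Measurable ψ) {K : ℝ} (hK : ∀ t, |ψ t| ≤ K) {T : Ω → ℝ}
    (hT : Measurable T) {K' : ℝ} (hK' : ∀ x, |T x| ≤ K') {r : ℝ≥0∞}
    (hr : ∀ t, ∫⁻ x, ENNReal.ofReal ((T x - ψ t) ^ 2) ∂(κ t) ≤ r) :
    chiSqMixtureBound κ ψ ≤ r := by
  by_cases hr' : r = ⊤
  · simp [hr']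
  lift r to NNReal using hr'
  refine iSup_le fun Q => iSup₂_le fun l hl => iSup_le fun h => ?_
  obtain ⟨hl0, hl1⟩ := hl
  have p1 := isProbabilityMeasure_mixture hκ (Q : Measure (Par d)) h
  have p0 := isProbabilityMeasure_mixture hκ (Q : Measure (Par d)) 0
  set μ₁ := mixture κ (Q : Measure (Par d)) h with hμ₁
  set μ₀ := mixture κ (Q : Measure (Par d)) 0 with hμ₀
  set μ := ENNReal.ofReal l • μ₁ + ENNReal.ofReal (1 - l) • μ₀ with hμ
  have pμ : IsProbabilityMeasure μ := ⟨by
    rw [hμ]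
    simp only [Measure.coe_add, Measure.coe_smul, Pi.add_apply, Pi.smul_apply, measure_univ,
      smul_eq_mul, mul_one]
    rw [← ENNReal.ofReal_add hl0 (by linarith)]; simp⟩
  -- With infinite divergence the quotient is 0, and so is the truncated difference.
  by_cases hχ : chiSq μ₁ μ = ⊤
  · rw [hχ]; simp
  -- the integrands
  let Z : Ω × Par d → ℝ := fun z => T z.1 - ψ z.2
  let Δ : Ω × Par d → ℝ := fun z => ψ z.2 - ψ (z.2 - h)
  have hZm : Measurable Z := (hT.comp measurable_fst).sub (hψ.comp measurable_snd)
  have hΔm : Measurable Δ := (hψ.comp measurable_snd).sub (hψ.comp (by fun_prop))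
  have hZb : ∀ z, |Z z| ≤ K' + K := fun z => (abs_sub _ _).trans (add_le_add (hK' _) (hK _))
  have hΔb : ∀ z, |Δ z| ≤ K + K := fun z => (abs_sub _ _).trans (add_le_add (hK _) (hK _))
  have hZL : ∀ m : Measure (Ω × Par d), IsFiniteMeasure m → MemLp Z 2 m := fun m _ =>
    MemLp.of_bound hZm.aestronglyMeasurable _ (Eventually.of_forall hZb)
  have hΔL : MemLp Δ 2 μ₀ := MemLp.of_bound hΔm.aestronglyMeasurable _ (Eventually.of_forall hΔb)
  have hZ0 := hZL μ₀ inferInstance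
  have hsh : Measurable fun z : Ω × Par d => (z.1, z.2 - h) := by fun_prop
  have hmap : ∀ F : Ω × Par d → ℝ, Measurable F → ∫ z, F z ∂μ₁ = ∫ z, F (z.1, z.2 - h) ∂μ₀ := by
    intro F hF
    rw [hμ₁, mixture_eq_map hκ, integral_map hsh.aemeasurable hF.aestronglyMeasurable]
  have hQ : ∀ F : Par d → ℝ, Measurable F → ∫ z, F z.2 ∂μ₀ = ∫ t, F t ∂(Q : Measure (Par d)) := by
    intro F hF
    conv_rhs => rw [← map_snd_mixture hκ (Q : Measure (Par d))]
    rw [integral_map measurable_snd.aemeasurable hF.aestronglyMeasurable]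
  -- Translating the parameter changes Z by an increment of ψ alone; this is what frees the mean
  -- shift from the estimator.
  have hZΔ : ∀ z : Ω × Par d, Z (z.1, z.2 - h) = Z z + Δ z := fun z => by simp [Z, Δ]
  set D := ∫ t, (ψ t - ψ (t - h)) ∂(Q : Measure (Par d)) with hD
  set B := ∫ t, (ψ t - ψ (t - h)) ^ 2 ∂(Q : Measure (Par d)) with hB
  have hψh : Measurable fun t => ψ t - ψ (t - h) := hψ.sub (hψ.comp (by fun_prop))
  have hD' : ∫ z, Z z ∂μ₁ - ∫ z, Z z ∂μ₀ = D := by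
    rw [hmap Z hZm]
    simp_rw [hZΔ]
    rw [integral_add (hZ0.integrable (by norm_num)) (hΔL.integrable (by norm_num)),
      add_sub_cancel_left, hD]
    exact hQ _ hψh
  have hB' : ∫ z, Δ z ^ 2 ∂μ₀ = B := hQ _ (hψh.pow_const 2)
  have hB0 : 0 ≤ B := integral_nonneg fun t => sq_nonneg _
  have hZr : ∫ z, Z z ^ 2 ∂μ₀ ≤ r := by
    rw [integral_eq_lintegral_of_nonneg_ae (Eventually.of_forall fun x => sq_nonneg _)
      (hZm.pow_const 2).aestronglyMeasurable]
    refine ENNReal.toReal_le_coe_of_le_coe ?_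
    rw [hμ₀, lintegral_mixture hκ _ _ (F := fun z => ENNReal.ofReal (Z z ^ 2))
      (hZm.pow_const 2).ennreal_ofReal]
    simp only [sub_zero]
    refine (lintegral_mono hr).trans ?_
    simp
  have hcs : ∫ z, Z z * Δ z ∂μ₀ ≤ √(r * B) := by
    refine Real.le_sqrt_of_sq_le ((sq_integral_mul_le hZ0 hΔL).trans ?_)
    rw [hB']
    exact mul_le_mul_of_nonneg_right hZr hB0
  have hZ1 : ∫ z, Z z ^ 2 ∂μ₁ ≤ r + 2 * √(r * B) + B := by
    rw [hmap _ (hZm.pow_const 2)]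
    have e : ∀ z : Ω × Par d, Z (z.1, z.2 - h) ^ 2 = Z z ^ 2 + 2 * (Z z * Δ z) + Δ z ^ 2 :=
      fun z => by rw [hZΔ]; ring
    have i1 : Integrable (fun z => Z z ^ 2) μ₀ := hZ0.integrable_sq
    have i2 : Integrable (fun z => 2 * (Z z * Δ z)) μ₀ := (hZ0.integrable_mul hΔL).const_mul 2
    have i3 : Integrable (fun z => Z z ^ 2 + 2 * (Z z * Δ z)) μ₀ := i1.add i2
    simp_rw [e]
    rw [integral_add i3 hΔL.integrable_sq, integral_add i1 i2, integral_const_mul, hB']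
    linarith
  have hmix : ∀ F : Ω × Par d → ℝ, Integrable F μ₁ → Integrable F μ₀ →
      ∫ z, F z ∂μ = l * ∫ z, F z ∂μ₁ + (1 - l) * ∫ z, F z ∂μ₀ := by
    intro F h1 h0
    rw [hμ, integral_add_measure (h1.smul_measure (by simp)) (h0.smul_measure (by simp)),
      integral_smul_measure, integral_smul_measure, ENNReal.toReal_ofReal hl0,
      ENNReal.toReal_ofReal (by linarith)]
    rfl
  have hW : ∫ z, Z z ^ 2 ∂μ ≤ l * (r + 2 * √(r * B) + B) + (1 - l) * r := by
    rw [hmix _ (hZL μ₁ inferInstance).integrable_sq hZ0.integrable_sq]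
    have : 0 ≤ 1 - l := by linarith
    gcongr
  have hmain := sq_integral_sub_le_chiSq hχ hZm hZb
  have hDl : ∫ z, Z z ∂μ₁ - ∫ z, Z z ∂μ = (1 - l) * D := by
    rw [hmix _ ((hZL μ₁ inferInstance).integrable (by norm_num)) (hZ0.integrable (by norm_num)),
      ← hD']
    ring
  rw [hDl] at hmain
  have hfin := mixture_risk_real_ineq r.2 hB0 hl0 hl1 ENNReal.toReal_nonneg hW hmain
  set c := (chiSq μ₁ μ).toReal with hc
  have hcE : chiSq μ₁ μ = ENNReal.ofReal c := (ENNReal.ofReal_toReal hχ).symm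
  have hshB : shiftB ψ (Q : Measure (Par d)) h = ENNReal.ofReal B := by
    rw [hB, ofReal_integral_eq_lintegral_ofReal _ (Eventually.of_forall fun x => sq_nonneg _)]
    · rfl
    · exact Integrable.of_bound (hψh.pow_const 2).aestronglyMeasurable ((K + K) ^ 2)
        (Eventually.of_forall fun t => by
          rw [Real.norm_eq_abs, abs_pow]
          exact pow_le_pow_left₀ (abs_nonneg _) ((abs_sub _ _).trans (add_le_add (hK _) (hK _))) 2)
  have hX : ENNReal.ofReal ((1 - l) ^ 2) * (meanShiftSq ψ (Q : Measure (Par d)) h / chiSq μ₁ μ) ≤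
      ENNReal.ofReal ((√r + √(l * B)) ^ 2) := by
    rw [hcE, meanShiftSq, ← hD, ← mul_div_assoc, ← ENNReal.ofReal_mul (sq_nonneg _), ← mul_pow]
    -- A zero divergence is covered as well: `hfin` then forces the numerator to be 0, and 0 / 0 =
    -- 0.
    refine ENNReal.div_le_of_le_mul ?_
    rw [← ENNReal.ofReal_mul (sq_nonneg _), mul_comm (_ ^ 2) c]
    exact ENNReal.ofReal_le_ofReal hfin
  have hs : 0 ≤ √(r : ℝ) + √(l * B) := by positivity
  have hX' := ENNReal.rpow_le_rpow hX (show (0 : ℝ) ≤ 1 / 2 by norm_num)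
  rw [ENNReal.ofReal_rpow_of_nonneg (sq_nonneg _) (by norm_num), ← Real.sqrt_eq_rpow,
    Real.sqrt_sq hs] at hX'
  rw [hshB, ← ENNReal.ofReal_mul hl0, ENNReal.ofReal_rpow_of_nonneg (mul_nonneg hl0 hB0)
    (by norm_num), ← Real.sqrt_eq_rpow]
  calc _ ≤ (ENNReal.ofReal (√r + √(l * B)) - ENNReal.ofReal √(l * B)) ^ 2 := by gcongr
    _ = ENNReal.ofReal √r ^ 2 := by
      rw [← ENNReal.ofReal_sub _ (Real.sqrt_nonneg _), add_sub_cancel_right]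
    _ = r := by
      rw [← ENNReal.ofReal_pow (Real.sqrt_nonneg _), Real.sq_sqrt (NNReal.coe_nonneg r)]; simp

end MixtureBounds

end LAM

namespace LAM

variable {d : ℕ} {𝒳 : Type*} [MeasurableSpace 𝒳]

/-! ### Hellinger differentiable models -/

/-- A dominated family of probability measures, Hellinger differentiable on `Θ`. -/
structure IsHellingerModel (ν : Measure 𝒳) (P : Par d → Measure 𝒳) (Θ : Set (Par d))
    (ξ : Par d → 𝒳 → Par d) : Prop where
  prob : ∀ θ ∈ Θ, IsProbabilityMeasure (P θ)
  ac : ∀ θ ∈ Θ, P θ ≪ ν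
  deriv : ∀ t ∈ Θ, HasHellingerDerivWithinAt ν P Θ t (ξ t)

/-- The squared Hellinger distance between `P θ` and `P θ'`, as a real number. -/
noncomputable def hsq (ν : Measure 𝒳) (P : Par d → Measure 𝒳) (θ θ' : Par d) : ℝ :=
  ∫ x, (rootDensity ν P θ x - rootDensity ν P θ' x) ^ 2 ∂ν

theorem hsq_nonneg (ν : Measure 𝒳) (P : Par d → Measure 𝒳) (θ θ' : Par d) : 0 ≤ hsq ν P θ θ' :=
  integral_nonneg fun _ => sq_nonneg _

theorem abs_integral_add_sq_sub_le {ν : Measure 𝒳} {u v : 𝒳 → ℝ} (hu : MemLp u 2 ν) (hv : MemLp v 2 ν) :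
    |∫ x, (u x + v x) ^ 2 ∂ν - ∫ x, u x ^ 2 ∂ν| ≤
      2 * √((∫ x, u x ^ 2 ∂ν) * ∫ x, v x ^ 2 ∂ν) + ∫ x, v x ^ 2 ∂ν := by
  have e : ∀ x, (u x + v x) ^ 2 = u x ^ 2 + 2 * (u x * v x) + v x ^ 2 := fun x => by ring
  have i1 : Integrable (fun x => 2 * (u x * v x)) ν := (hu.integrable_mul hv).const_mul 2
  have i2 : Integrable (fun x => u x ^ 2 + 2 * (u x * v x)) ν := hu.integrable_sq.add i1
  simp_rw [e]
  rw [integral_add i2 hv.integrable_sq, integral_add hu.integrable_sq i1, integral_const_mul]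
  have h1 : |∫ x, u x * v x ∂ν| ≤ √((∫ x, u x ^ 2 ∂ν) * ∫ x, v x ^ 2 ∂ν) :=
    Real.abs_le_sqrt (sq_integral_mul_le hu hv)
  have h2 : 0 ≤ ∫ x, v x ^ 2 ∂ν := integral_nonneg fun _ => sq_nonneg _
  have h3 := abs_le.1 h1
  rw [abs_le]
  constructor <;> linarith [h3.1, h3.2]

section Model

variable {ν : Measure 𝒳} [SigmaFinite ν] {P : Par d → Measure 𝒳} {Θ : Set (Par d)}
  {ξ : Par d → 𝒳 → Par d} (M : IsHellingerModel ν P Θ ξ)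
include M

theorem IsHellingerModel.root {θ : Par d} (hθ : θ ∈ Θ) :
    HasRootDensity (P θ) ν (rootDensity ν P θ) := by
  have := M.prob θ hθ
  exact hasRootDensity_sqrt_rnDeriv (M.ac θ hθ)

theorem IsHellingerModel.memLp {θ : Par d} (hθ : θ ∈ Θ) : MemLp (rootDensity ν P θ) 2 ν := by
  have := M.prob θ hθ
  exact (M.root hθ).memLp

theorem IsHellingerModel.isProbabilityMeasure_iidLaw {θ : Par d} (hθ : θ ∈ Θ) (n : ℕ) :
    IsProbabilityMeasure (iidLaw P n θ) := by
  have := M.prob θ hθ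
  unfold iidLaw
  infer_instance

theorem IsHellingerModel.root_iid {θ : Par d} (hθ : θ ∈ Θ) (n : ℕ) :
    HasRootDensity (iidLaw P n θ) (Measure.pi fun _ => ν)
      fun x => ∏ i, rootDensity ν P θ (x i) := by
  have := M.prob θ hθ
  exact (M.root hθ).pi n

theorem IsHellingerModel.hsq_le_two {θ θ' : Par d} (hθ : θ ∈ Θ) (hθ' : θ' ∈ Θ) :
    hsq ν P θ θ' ≤ 2 := by
  have := M.prob θ hθ
  have := M.prob θ' hθ'
  exact integral_sub_sq_le_two (M.root hθ) (M.root hθ')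

theorem IsHellingerModel.hellingerSq_iid {θ θ' : Par d} (hθ : θ ∈ Θ) (hθ' : θ' ∈ Θ) (n : ℕ) :
    hellingerSq (iidLaw P n θ) (iidLaw P n θ') =
      ENNReal.ofReal (2 - 2 * (1 - hsq ν P θ θ' / 2) ^ n) := by
  have := M.prob θ hθ
  have := M.prob θ' hθ'
  have := M.isProbabilityMeasure_iidLaw hθ n
  have := M.isProbabilityMeasure_iidLaw hθ' n
  rw [hellingerSq_eq_ofReal_integral (M.root_iid hθ n) (M.root_iid hθ' n),
    integral_pi_sub_sq (M.root hθ) (M.root hθ') n]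
  rfl

theorem IsHellingerModel.hellingerSq_iid_le {θ θ' : Par d} (hθ : θ ∈ Θ) (hθ' : θ' ∈ Θ) (n : ℕ) :
    hellingerSq (iidLaw P n θ) (iidLaw P n θ') ≤ ENNReal.ofReal (n * hsq ν P θ θ') := by
  have := M.prob θ hθ
  have := M.prob θ' hθ'
  have := M.isProbabilityMeasure_iidLaw hθ n
  have := M.isProbabilityMeasure_iidLaw hθ' n
  rw [hellingerSq_eq_ofReal_integral (M.root_iid hθ n) (M.root_iid hθ' n)]
  exact ENNReal.ofReal_le_ofReal (integral_pi_sub_sq_le (M.root hθ) (M.root hθ') n)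

theorem IsHellingerModel.twoPointBound_le {ψ : Par d → ℝ} {n : ℕ} {S : Set (Par d)} (hS : S ⊆ Θ) :
    twoPointBound P ψ n S ≤ minimaxRisk P ψ n S := by
  refine le_iInf₂ fun T hT => iSup₂_le fun θ₁ h₁ => iSup₂_le fun θ₂ h₂ => ?_
  have := M.isProbabilityMeasure_iidLaw (hS h₁) n
  have := M.isProbabilityMeasure_iidLaw (hS h₂) n
  refine twoPoint_le_of_risk_le (M.root_iid (hS h₁) n) (M.root_iid (hS h₂) n) hT ?_ ?_
  · exact le_iSup₂_of_le θ₁ h₁ le_rfl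
  · exact le_iSup₂_of_le θ₂ h₂ le_rfl

theorem IsHellingerModel.memLp_inner {t : Par d} (ht : t ∈ Θ) (a : Par d) :
    MemLp (fun x => inner ℝ a (ξ t x)) 2 ν :=
  (M.deriv t ht).1.const_inner a

theorem IsHellingerModel.fisherInfo_bilinear {t : Par d} (ht : t ∈ Θ) (a b : Par d) :
    (a : Fin d → ℝ) ⬝ᵥ (fisherInfo ν (ξ t) *ᵥ b) =
      4 * ∫ x, inner ℝ a (ξ t x) * inner ℝ b (ξ t x) ∂ν := by
  have hc : ∀ i, MemLp (fun x => ξ t x i) 2 ν := fun i => by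
    have := M.memLp_inner ht (EuclideanSpace.single i 1)
    simpa [EuclideanSpace.inner_single_left] using this
  have e : ∀ x, inner ℝ a (ξ t x) * inner ℝ b (ξ t x) =
      ∑ i, ∑ j, a i * b j * (ξ t x i * ξ t x j) := fun x => by
    rw [PiLp.inner_apply, PiLp.inner_apply, Finset.sum_mul_sum]
    refine Finset.sum_congr rfl fun i _ => Finset.sum_congr rfl fun j _ => ?_
    simp only [RCLike.inner_apply, conj_trivial]; ring
  simp_rw [e]
  have hi : ∀ i j, Integrable (fun x => a i * b j * (ξ t x i * ξ t x j)) ν := fun i j =>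
    ((hc i).integrable_mul (hc j)).const_mul _
  rw [integral_finsetSum _ fun i _ => integrable_finsetSum _ fun j _ => hi i j]
  simp_rw [integral_finsetSum _ fun j _ => hi _ j, integral_const_mul]
  simp only [dotProduct, Matrix.mulVec, fisherInfo, Matrix.of_apply, Finset.mul_sum]
  refine Finset.sum_congr rfl fun i _ => Finset.sum_congr rfl fun j _ => ?_
  ring

theorem IsHellingerModel.fisherInfo_quadratic {t : Par d} (ht : t ∈ Θ) (a : Par d) :
    (a : Fin d → ℝ) ⬝ᵥ (fisherInfo ν (ξ t) *ᵥ a) = 4 * ∫ x, inner ℝ a (ξ t x) ^ 2 ∂ν := by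
  rw [M.fisherInfo_bilinear ht]
  simp_rw [sq]

theorem IsHellingerModel.continuous_quadratic {t : Par d} (ht : t ∈ Θ) :
    Continuous fun a : Par d => ∫ x, inner ℝ a (ξ t x) ^ 2 ∂ν := by
  have : (fun a : Par d => ∫ x, inner ℝ a (ξ t x) ^ 2 ∂ν) =
      fun a : Par d => (1 / 4) * ((a : Fin d → ℝ) ⬝ᵥ (fisherInfo ν (ξ t) *ᵥ a)) := by
    ext a; rw [M.fisherInfo_quadratic ht]; ring
  rw [this]
  simp only [dotProduct, Matrix.mulVec]
  fun_prop

/-- At an interior point the constraint t + a ∈ Θ disappears from the filter. Square integrability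
of the remainder is kept in the statement, since otherwise the bound on its integral could hold by
the default value 0. -/
theorem IsHellingerModel.exists_remainder_le {t : Par d} (ht : t ∈ interior Θ) {η : ℝ} (hη : 0 < η) :
    ∃ δ > 0, ∀ a : Par d, ‖a‖ < δ → t + a ∈ Θ ∧
      MemLp (fun x => rootDensity ν P (t + a) x - rootDensity ν P t x - inner ℝ a (ξ t x)) 2 ν ∧
      ∫ x, (rootDensity ν P (t + a) x - rootDensity ν P t x - inner ℝ a (ξ t x)) ^ 2 ∂ν
        ≤ η * ‖a‖ ^ 2 := by
  have htΘ := interior_subset ht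
  have hev : ∀ᶠ a : Par d in 𝓝 0, t + a ∈ Θ := by
    have : Tendsto (fun a : Par d => t + a) (𝓝 0) (𝓝 t) := by
      simpa using (continuous_const_add t).tendsto (0 : Par d)
    exact this.eventually (mem_interior_iff_mem_nhds.1 ht)
  have h1 := (M.deriv t htΘ).2
  rw [nhdsWithin_eq_nhds.2 hev] at h1
  have h2 := h1.def hη
  obtain ⟨δ, hδ, h3⟩ := Metric.eventually_nhds_iff.1 (hev.and h2)
  refine ⟨δ, hδ, fun a ha => ?_⟩
  obtain ⟨h4, h5⟩ := h3 (by simpa using ha)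
  refine ⟨h4, ((M.memLp h4).sub (M.memLp htΘ)).sub (M.memLp_inner htΘ a), ?_⟩
  simpa [abs_of_nonneg, integral_nonneg, sq_nonneg] using (le_abs_self _).trans h5

/-- Both root densities are expanded around the same base point t, so their difference is the linear
term in a - b plus two small remainders. No regularity of the derivative in t is involved, and the
estimate is uniform in the pair. -/
theorem IsHellingerModel.hsq_local {t : Par d} (ht : t ∈ interior Θ) {ε : ℝ} (hε : 0 < ε) :
    ∃ δ > 0, ∀ a b : Par d, ‖a‖ < δ → ‖b‖ < δ → t + a ∈ Θ ∧ t + b ∈ Θ ∧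
      |hsq ν P (t + a) (t + b) - ∫ x, inner ℝ (a - b) (ξ t x) ^ 2 ∂ν| ≤ ε * (‖a‖ + ‖b‖) ^ 2 := by
  have htΘ := interior_subset ht
  set K := ∫ x, ‖ξ t x‖ ^ 2 ∂ν with hK
  have hK0 : 0 ≤ K := integral_nonneg fun _ => sq_nonneg _
  have hξ2 : Integrable (fun x => ‖ξ t x‖ ^ 2) ν := (M.deriv t htΘ).1.norm.integrable_sq
  -- With remainders of norm at most η‖a‖ and η‖b‖ and η ≤ 1, the total error is at most ηD(‖a‖ +
  -- ‖b‖)²: the first summand of D comes from the cross term, the second from the squared remainder.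
  set D := 2 * √(2 * K) + 2
  have hD : 0 < D := by positivity
  set η := min 1 (ε / D)
  have hη : 0 < η := lt_min one_pos (by positivity)
  obtain ⟨δ, hδ, hr⟩ := M.exists_remainder_le ht (η := η ^ 2) (by positivity)
  refine ⟨δ, hδ, fun a b ha hb => ?_⟩
  obtain ⟨ha1, ha2, ha3⟩ := hr a ha
  obtain ⟨hb1, hb2, hb3⟩ := hr b hb
  refine ⟨ha1, hb1, ?_⟩
  set ra := fun x => rootDensity ν P (t + a) x - rootDensity ν P t x - inner ℝ a (ξ t x) with hra
  set rb := fun x => rootDensity ν P (t + b) x - rootDensity ν P t x - inner ℝ b (ξ t x) with hrb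
  have hrm : MemLp (fun x => ra x - rb x) 2 ν := ha2.sub hb2
  have e : hsq ν P (t + a) (t + b) = ∫ x, (inner ℝ (a - b) (ξ t x) + (ra x - rb x)) ^ 2 ∂ν := by
    unfold hsq
    congr 1; ext x
    rw [inner_sub_left]; simp only [hra, hrb]; ring
  rw [e]
  refine (abs_integral_add_sq_sub_le (M.memLp_inner htΘ _) hrm).trans ?_
  set s := ‖a‖ + ‖b‖ with hs
  have hs0 : 0 ≤ s := by positivity
  have hu : ∫ x, inner ℝ (a - b) (ξ t x) ^ 2 ∂ν ≤ K * s ^ 2 := by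
    rw [hK, ← integral_mul_const]
    refine integral_mono (M.memLp_inner htΘ _).integrable_sq (hξ2.mul_const _) fun x => ?_
    have h1 : |inner ℝ (a - b) (ξ t x)| ≤ s * ‖ξ t x‖ :=
      (abs_real_inner_le_norm _ _).trans (mul_le_mul_of_nonneg_right (norm_sub_le _ _) (norm_nonneg _))
    have := pow_le_pow_left₀ (abs_nonneg _) h1 2
    rw [sq_abs] at this
    simp only; linarith
  have hv : ∫ x, (ra x - rb x) ^ 2 ∂ν ≤ 2 * η ^ 2 * s ^ 2 := by
    have h1 : ∫ x, (ra x - rb x) ^ 2 ∂ν ≤ ∫ x, (2 * ra x ^ 2 + 2 * rb x ^ 2) ∂ν := by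
      refine integral_mono hrm.integrable_sq
        ((ha2.integrable_sq.const_mul 2).add (hb2.integrable_sq.const_mul 2)) fun x => ?_
      simp only
      nlinarith [sq_nonneg (ra x + rb x)]
    rw [integral_add (ha2.integrable_sq.const_mul 2) (hb2.integrable_sq.const_mul 2),
      integral_const_mul, integral_const_mul] at h1
    have : ‖a‖ ^ 2 + ‖b‖ ^ 2 ≤ s ^ 2 := by rw [hs]; nlinarith [norm_nonneg a, norm_nonneg b]
    nlinarith [sq_nonneg η, mul_le_mul_of_nonneg_left this (sq_nonneg η)]
  have hv0 : 0 ≤ ∫ x, (ra x - rb x) ^ 2 ∂ν := integral_nonneg fun _ => sq_nonneg _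
  have hsq : √((∫ x, inner ℝ (a - b) (ξ t x) ^ 2 ∂ν) * ∫ x, (ra x - rb x) ^ 2 ∂ν) ≤
      √(2 * K) * η * s ^ 2 := by
    refine Real.sqrt_le_iff.2 ⟨by positivity, (mul_le_mul hu hv hv0 (by positivity)).trans ?_⟩
    rw [mul_pow, mul_pow, Real.sq_sqrt (by positivity)]
    exact le_of_eq (by ring)
  have hη1 : η ≤ 1 := min_le_left _ _
  have hη2 : η * D ≤ ε := by
    rw [← le_div_iff₀ hD]; exact min_le_right _ _
  have h3 : η ^ 2 ≤ η := by nlinarith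
  have h4 : η * D * s ^ 2 ≤ ε * s ^ 2 := mul_le_mul_of_nonneg_right hη2 (sq_nonneg _)
  have h5 : η ^ 2 * s ^ 2 ≤ η * s ^ 2 := mul_le_mul_of_nonneg_right h3 (sq_nonneg _)
  have h6 : η * D * s ^ 2 = 2 * (√(2 * K) * η * s ^ 2) + 2 * (η * s ^ 2) := by simp only [D]; ring
  linarith

theorem IsHellingerModel.hsq_scaled {θ₀ : Par d} (h₀ : θ₀ ∈ interior Θ) (c : ℝ) {ε : ℝ}
    (hε : 0 < ε) : ∀ᶠ n : ℕ in atTop, ∀ a b : Par d, ‖a‖ ≤ c → ‖b‖ ≤ c →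
      |n * hsq ν P (θ₀ + (√n)⁻¹ • a) (θ₀ + (√n)⁻¹ • b) -
        ∫ x, inner ℝ (a - b) (ξ θ₀ x) ^ 2 ∂ν| ≤ ε := by
  obtain ⟨δ, hδ, h⟩ := M.hsq_local h₀ (ε := ε / (4 * c ^ 2 + 1)) (by positivity)
  have hlim : Tendsto (fun n : ℕ => (√(n : ℝ))⁻¹ * |c|) atTop (𝓝 0) := by
    simpa using ((tendsto_inv_atTop_zero.comp
      (Real.tendsto_sqrt_atTop.comp tendsto_natCast_atTop_atTop)).mul_const |c|)
  filter_upwards [hlim.eventually (gt_mem_nhds hδ), eventually_gt_atTop 0] with n hn hn0 a b ha hb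
  have hn0' : (0 : ℝ) < n := by exact_mod_cast hn0
  have hsn : 0 < √(n : ℝ) := Real.sqrt_pos.2 hn0'
  have hnorm : ∀ a : Par d, ‖a‖ ≤ c → ‖(√(n : ℝ))⁻¹ • a‖ < δ := fun a ha => by
    rw [norm_smul, norm_inv, Real.norm_of_nonneg hsn.le]
    refine lt_of_le_of_lt ?_ hn
    gcongr
    exact ha.trans (le_abs_self c)
  obtain ⟨-, -, h1⟩ := h _ _ (hnorm a ha) (hnorm b hb)
  have e1 : ∀ x, inner ℝ ((√(n : ℝ))⁻¹ • a - (√(n : ℝ))⁻¹ • b) (ξ θ₀ x) ^ 2 =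
      (n : ℝ)⁻¹ * inner ℝ (a - b) (ξ θ₀ x) ^ 2 := fun x => by
    rw [← smul_sub, real_inner_smul_left, mul_pow, inv_pow, Real.sq_sqrt hn0'.le]
  simp_rw [e1] at h1
  rw [integral_const_mul, norm_smul, norm_smul, norm_inv, Real.norm_of_nonneg hsn.le, ← mul_add,
    mul_pow, inv_pow, Real.sq_sqrt hn0'.le] at h1
  have h2 := mul_le_mul_of_nonneg_left h1 hn0'.le
  rw [← abs_of_pos hn0', ← abs_mul, abs_of_pos hn0', mul_sub, ← mul_assoc,
    mul_inv_cancel₀ hn0'.ne', one_mul] at h2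
  refine h2.trans ?_
  have h3 : (‖a‖ + ‖b‖) ^ 2 ≤ 4 * c ^ 2 + 1 := by
    have : ‖a‖ + ‖b‖ ≤ 2 * c := by linarith
    nlinarith [norm_nonneg a, norm_nonneg b]
  calc n * (ε / (4 * c ^ 2 + 1) * ((n : ℝ)⁻¹ * (‖a‖ + ‖b‖) ^ 2))
      = ε / (4 * c ^ 2 + 1) * (‖a‖ + ‖b‖) ^ 2 := by field_simp
    _ ≤ ε / (4 * c ^ 2 + 1) * (4 * c ^ 2 + 1) := by gcongr
    _ = ε := by field_simp

/-! ### Local Hellinger bounds and continuity of n-sample expectations. -/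

theorem IsHellingerModel.exists_hsq_le {t : Par d} (ht : t ∈ interior Θ) :
    ∃ C ≥ 0, ∀ᶠ θ in 𝓝 t, θ ∈ Θ ∧ hsq ν P θ t ≤ C * ‖θ - t‖ ^ 2 := by
  have htΘ := interior_subset ht
  obtain ⟨δ, hδ, h⟩ := M.hsq_local ht one_pos
  have hξ2 : Integrable (fun x => ‖ξ t x‖ ^ 2) ν := (M.deriv t htΘ).1.norm.integrable_sq
  refine ⟨∫ x, ‖ξ t x‖ ^ 2 ∂ν + 1, by
    have : 0 ≤ ∫ x, ‖ξ t x‖ ^ 2 ∂ν := integral_nonneg fun _ => sq_nonneg _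
    linarith, ?_⟩
  filter_upwards [Metric.ball_mem_nhds t hδ] with θ hθ
  obtain ⟨h1, -, h3⟩ := h (θ - t) 0 (by simpa [dist_eq_norm] using hθ) (by simpa using hδ)
  simp only [add_sub_cancel, add_zero, sub_zero, norm_zero, one_mul] at h1 h3
  refine ⟨h1, ?_⟩
  have hu : ∫ x, inner ℝ (θ - t) (ξ t x) ^ 2 ∂ν ≤ (∫ x, ‖ξ t x‖ ^ 2 ∂ν) * ‖θ - t‖ ^ 2 := by
    rw [← integral_mul_const]
    refine integral_mono (M.memLp_inner htΘ _).integrable_sq (hξ2.mul_const _) fun x => ?_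
    have := pow_le_pow_left₀ (abs_nonneg _) (abs_real_inner_le_norm (θ - t) (ξ t x)) 2
    rw [sq_abs] at this
    simp only; linarith
  have := (abs_le.1 h3).2
  linarith

theorem IsHellingerModel.abs_integral_iid_sub_le {θ θ' : Par d} (hθ : θ ∈ Θ) (hθ' : θ' ∈ Θ) {n : ℕ}
    {T : (Fin n → 𝒳) → ℝ} (hT : Measurable T) {C : ℝ} (hC : ∀ x, |T x| ≤ C) :
    (∫ x, T x ∂(iidLaw P n θ) - ∫ x, T x ∂(iidLaw P n θ')) ^ 2 ≤ n * hsq ν P θ θ' *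
      (2 * ∫ x, T x ^ 2 ∂(iidLaw P n θ) + 2 * ∫ x, T x ^ 2 ∂(iidLaw P n θ')) := by
  have := M.prob θ hθ
  have := M.prob θ' hθ'
  have := M.isProbabilityMeasure_iidLaw hθ n
  have := M.isProbabilityMeasure_iidLaw hθ' n
  refine (sq_integral_sub_integral_le (M.root_iid hθ n) (M.root_iid hθ' n) hT
    (MemLp.of_bound hT.aestronglyMeasurable C (Eventually.of_forall hC))
    (MemLp.of_bound hT.aestronglyMeasurable C (Eventually.of_forall hC))).trans ?_
  refine mul_le_mul_of_nonneg_right (integral_pi_sub_sq_le (M.root hθ) (M.root hθ') n) ?_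
  have h1 : 0 ≤ ∫ x, T x ^ 2 ∂(iidLaw P n θ) := integral_nonneg fun _ => sq_nonneg _
  have h2 : 0 ≤ ∫ x, T x ^ 2 ∂(iidLaw P n θ') := integral_nonneg fun _ => sq_nonneg _
  linarith

theorem IsHellingerModel.continuousAt_integral_iid {t : Par d} (ht : t ∈ interior Θ) {n : ℕ}
    {T : (Fin n → 𝒳) → ℝ} (hT : Measurable T) {C : ℝ} (hC : ∀ x, |T x| ≤ C) :
    ContinuousAt (fun θ => ∫ x, T x ∂(iidLaw P n θ)) t := by
  obtain ⟨D, hD, h⟩ := M.exists_hsq_le ht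
  have hlim : Tendsto (fun θ : Par d => √(n * (D * ‖θ - t‖ ^ 2) * (4 * C ^ 2))) (𝓝 t) (𝓝 0) := by
    have : ContinuousAt (fun θ : Par d => √(n * (D * ‖θ - t‖ ^ 2) * (4 * C ^ 2))) t := by fun_prop
    simpa [ContinuousAt] using this
  rw [ContinuousAt, tendsto_iff_dist_tendsto_zero]
  refine squeeze_zero' (Eventually.of_forall fun _ => dist_nonneg) ?_ hlim
  filter_upwards [h] with θ hθ
  obtain ⟨h1, h2⟩ := hθ
  have htΘ := interior_subset ht
  have hsec : ∀ {θ : Par d}, θ ∈ Θ → ∫ x, T x ^ 2 ∂(iidLaw P n θ) ≤ C ^ 2 := fun {θ} hθ => by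
    have := M.isProbabilityMeasure_iidLaw hθ n
    have h3 : ∫ x, T x ^ 2 ∂(iidLaw P n θ) ≤ ∫ _x, C ^ 2 ∂(iidLaw P n θ) := by
      refine integral_mono_of_nonneg (Eventually.of_forall fun _ => sq_nonneg _)
        (integrable_const _) (Eventually.of_forall fun x => ?_)
      have := pow_le_pow_left₀ (abs_nonneg _) (hC x) 2
      rwa [sq_abs] at this
    simpa using h3
  rw [Real.dist_eq]
  refine Real.le_sqrt_of_sq_le ?_
  rw [sq_abs]
  refine (M.abs_integral_iid_sub_le h1 htΘ hT hC).trans ?_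
  have := hsec h1
  have := hsec htΘ
  have := hsq_nonneg ν P θ t
  gcongr
  linarith

/-- Along a continuous path in the interior of Θ the probability of every fixed event is continuous,
by the Hellinger estimate for bounded statistics. This provides the measurability that the mixture
measures need. -/
theorem IsHellingerModel.measurable_iidLaw_comp {α : Type*} [TopologicalSpace α] [MeasurableSpace α]
    [BorelSpace α] {φ : α → Par d} (hφ : Continuous φ) (hφΘ : ∀ s, φ s ∈ interior Θ) (n : ℕ) :
    Measurable fun s => iidLaw P n (φ s) := by
  have hp : ∀ s, IsProbabilityMeasure (iidLaw P n (φ s)) := fun s =>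
    M.isProbabilityMeasure_iidLaw (interior_subset (hφΘ s)) n
  refine Measure.measurable_of_measurable_coe _ fun A hA => ?_
  have hc : Continuous fun s => ∫ x, A.indicator (fun _ => (1 : ℝ)) x ∂(iidLaw P n (φ s)) := by
    rw [continuous_iff_continuousAt]
    intro s
    refine ContinuousAt.comp (f := φ) (g := fun θ => ∫ x, A.indicator (fun _ => (1 : ℝ)) x ∂(iidLaw P n θ))
      (M.continuousAt_integral_iid (hφΘ s)
      (measurable_const.indicator hA) (C := 1) fun x => ?_) hφ.continuousAt
    by_cases hx : x ∈ A <;> simp [hx]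
  have e : (fun s => iidLaw P n (φ s) A) =
      fun s => ENNReal.ofReal (∫ x, A.indicator (fun _ => (1 : ℝ)) x ∂(iidLaw P n (φ s))) := by
    ext s
    rw [integral_indicator_const _ hA]
    simp [measureReal_def]
  rw [e]
  exact hc.measurable.ennreal_ofReal

end Model

end LAM

namespace LAM

variable {d : ℕ} {𝒳 : Type*} [MeasurableSpace 𝒳]

/-! ### Radial maps and the arctangent diffeomorphisms -/

/-- The radial map `t ↦ f(‖t‖) t / ‖t‖`. -/
noncomputable def radial (f : ℝ → ℝ) (t : Par d) : Par d := f ‖t‖ • (‖t‖⁻¹ • t)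

theorem radial_zero (f : ℝ → ℝ) : radial f (0 : Par d) = 0 := by simp [radial]

theorem norm_radial {f : ℝ → ℝ} {t : Par d} (ht : t ≠ 0) : ‖radial f t‖ = |f ‖t‖| := by
  have : ‖t‖ ≠ 0 := norm_ne_zero_iff.2 ht
  rw [radial, norm_smul, norm_smul, norm_inv, norm_norm, inv_mul_cancel₀ this, mul_one,
    Real.norm_eq_abs]

theorem radial_radial {f g : ℝ → ℝ} {t : Par d} (hf : t ≠ 0 → 0 < f ‖t‖)
    (hg : t ≠ 0 → g (f ‖t‖) = ‖t‖) : radial g (radial f t) = t := by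
  rcases eq_or_ne t 0 with rfl | ht
  · simp [radial_zero]
  have h1 : ‖t‖ ≠ 0 := norm_ne_zero_iff.2 ht
  have h2 := hf ht
  have h3 := norm_radial (f := f) ht
  rw [abs_of_pos h2] at h3
  conv_lhs => rw [radial]
  rw [h3, hg ht, radial, smul_smul, smul_smul, smul_smul]
  rw [show ‖t‖ * (f ‖t‖)⁻¹ * f ‖t‖ * ‖t‖⁻¹ = 1 by field_simp, one_smul]

/-- Only the origin needs an argument, the norm being smooth elsewhere: if f(0) = 0, the radial map
deviates from f'(0) • id by a vector whose norm is the one-dimensional Taylor remainder at ‖t‖. -/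
theorem differentiableAt_radial {f : ℝ → ℝ} {t : Par d} (h0 : f 0 = 0)
    (hd0 : DifferentiableAt ℝ f 0) (hd : DifferentiableAt ℝ f ‖t‖) :
    DifferentiableAt ℝ (radial f : Par d → Par d) t := by
  rcases eq_or_ne t 0 with rfl | ht
  · refine HasFDerivAt.differentiableAt (f' := deriv f 0 • ContinuousLinearMap.id ℝ (Par d)) ?_
    rw [hasFDerivAt_iff_isLittleO_nhds_zero]
    have h1 := hasDerivAt_iff_isLittleO_nhds_zero.1 hd0.hasDerivAt
    have h2 : Tendsto (fun t : Par d => ‖t‖) (𝓝 0) (𝓝 0) := tendsto_norm_zero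
    refine IsLittleO.of_norm_right (IsLittleO.of_norm_left ?_)
    refine (h1.comp_tendsto h2).norm_left.congr_left fun t => ?_
    rcases eq_or_ne t 0 with rfl | ht
    · simp [radial_zero]
    · have h3 : ‖t‖ ≠ 0 := norm_ne_zero_iff.2 ht
      have : radial f t - deriv f 0 • t = (f ‖t‖ - ‖t‖ * deriv f 0) • (‖t‖⁻¹ • t) := by
        rw [sub_smul, radial, smul_smul (‖t‖ * deriv f 0)]
        congr 2
        field_simp
      simp only [zero_add, Function.comp_apply, h0, sub_zero, radial_zero, smul_eq_mul,
        smul_apply, ContinuousLinearMap.id_apply]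
      rw [this, norm_smul, norm_smul, norm_inv, norm_norm, inv_mul_cancel₀ h3, mul_one]
  · unfold radial
    have hn : DifferentiableAt ℝ (fun t : Par d => ‖t‖) t := differentiableAt_id.norm ℝ ht
    exact (hd.comp t hn).smul ((hn.inv (norm_ne_zero_iff.2 ht)).smul differentiableAt_id)

/-- The radial profile of the arctangent map. -/
noncomputable def arctanProfile (r γ x : ℝ) : ℝ := r * (2 / Real.pi * Real.arctan (x / γ))

theorem arctanMap_eq (θ₀ : Par d) (r γ : ℝ) (t : Par d) :
    arctanMap θ₀ r γ t = θ₀ + radial (arctanProfile r γ) t := rfl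

theorem abs_arctanProfile_lt {r : ℝ} (hr : 0 < r) (γ x : ℝ) : |arctanProfile r γ x| < r := by
  have h1 := Real.arctan_lt_pi_div_two (x / γ)
  have h2 := Real.neg_pi_div_two_lt_arctan (x / γ)
  have hpi := Real.pi_pos
  rw [arctanProfile, abs_mul, abs_of_pos hr, abs_mul, abs_of_pos (by positivity)]
  have h3 : |Real.arctan (x / γ)| < Real.pi / 2 := abs_lt.2 ⟨by linarith, h1⟩
  calc r * (2 / Real.pi * |Real.arctan (x / γ)|) < r * (2 / Real.pi * (Real.pi / 2)) := by gcongr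
    _ = r := by field_simp

theorem norm_radial_arctanProfile_lt {r : ℝ} (hr : 0 < r) (γ : ℝ) (t : Par d) :
    ‖radial (arctanProfile r γ) t‖ < r := by
  rcases eq_or_ne t 0 with rfl | ht
  · simpa [radial_zero] using hr
  · rw [norm_radial ht]; exact abs_arctanProfile_lt hr γ _

theorem isDiffeoOnto_arctanMap (θ₀ : Par d) {r γ : ℝ} (hr : 0 < r) (hγ : 0 < γ) :
    IsDiffeoOnto (arctanMap θ₀ r γ) (Metric.ball θ₀ r) := by
  have hpi := Real.pi_pos
  -- The radial profile of the inverse: solving s = r(2/π) arctan(x/γ) for x.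
  set F : ℝ → ℝ := fun s => γ * Real.tan (Real.pi / 2 * (s / r)) with hF
  have hfd : Differentiable ℝ (arctanProfile r γ) := by
    have h1 : Differentiable ℝ fun x : ℝ => x / γ := by fun_prop
    exact (h1.arctan.const_mul (2 / Real.pi)).const_mul r
  have hf0 : arctanProfile r γ 0 = 0 := by simp [arctanProfile]
  have hF0 : F 0 = 0 := by simp [hF]
  have hlt : ∀ s, 0 ≤ s → s < r → Real.pi / 2 * (s / r) < Real.pi / 2 := fun s _ hsr => by
    have : s / r < 1 := (div_lt_one hr).2 hsr
    nlinarith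
  have hFd : ∀ s, 0 ≤ s → s < r → DifferentiableAt ℝ F s := fun s hs hsr => by
    have hcos : Real.cos (Real.pi / 2 * (s / r)) ≠ 0 := by
      refine (Real.cos_pos_of_mem_Ioo ⟨?_, hlt s hs hsr⟩).ne'
      have : 0 ≤ Real.pi / 2 * (s / r) := by positivity
      linarith
    refine DifferentiableAt.const_mul ?_ γ
    exact DifferentiableAt.comp s (f := fun s => Real.pi / 2 * (s / r))
      (Real.differentiableAt_tan.2 hcos) (by fun_prop)
  have hFf : ∀ x, 0 ≤ x → F (arctanProfile r γ x) = x := fun x _ => by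
    simp only [hF, arctanProfile]
    rw [show Real.pi / 2 * (r * (2 / Real.pi * Real.arctan (x / γ)) / r) = Real.arctan (x / γ) by
      field_simp, Real.tan_arctan]
    field_simp
  have hfF : ∀ s, 0 ≤ s → s < r → arctanProfile r γ (F s) = s := fun s hs hsr => by
    simp only [hF, arctanProfile]
    rw [mul_div_cancel_left₀ _ hγ.ne', Real.arctan_tan _ (hlt s hs hsr)]
    · field_simp
    · have : 0 ≤ Real.pi / 2 * (s / r) := by positivity
      linarith
  have hfpos : ∀ t : Par d, t ≠ 0 → 0 < arctanProfile r γ ‖t‖ := fun t ht => by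
    have h1 : 0 < ‖t‖ / γ := div_pos (norm_pos_iff.2 ht) hγ
    have h2 : 0 < Real.arctan (‖t‖ / γ) := by
      rw [← Real.arctan_zero]; exact Real.arctan_strictMono h1
    unfold arctanProfile; positivity
  have hFpos : ∀ s, 0 < s → s < r → 0 < F s := fun s hs hsr =>
    mul_pos hγ (Real.tan_pos_of_pos_of_lt_pi_div_two (by positivity) (hlt s hs.le hsr))
  have hball : ∀ t : Par d, arctanMap θ₀ r γ t ∈ Metric.ball θ₀ r := fun t => by
    rw [arctanMap_eq, mem_ball_iff_norm, add_sub_cancel_left]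
    exact norm_radial_arctanProfile_lt hr γ t
  refine ⟨fun t => ?_, Set.Subset.antisymm (by rintro _ ⟨t, rfl⟩; exact hball t) fun y hy => ?_,
    fun y => radial F (y - θ₀), fun t => ?_, fun y hy => ?_⟩
  · exact (differentiableAt_const θ₀).add (differentiableAt_radial hf0 (hfd 0) (hfd _))
  · rw [mem_ball_iff_norm] at hy
    refine ⟨radial F (y - θ₀), ?_⟩
    rw [arctanMap_eq, radial_radial (fun h => hFpos _ (norm_pos_iff.2 h) hy)
      (fun _ => hfF _ (norm_nonneg _) hy), add_sub_cancel]
  · rw [arctanMap_eq]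
    simp only [add_sub_cancel_left]
    exact radial_radial (hfpos t) fun _ => hFf _ (norm_nonneg _)
  · rw [mem_ball_iff_norm] at hy
    refine (DifferentiableAt.comp y (g := radial F) (f := fun y => y - θ₀)
      (differentiableAt_radial hF0 (hFd 0 le_rfl hr) (hFd _ (norm_nonneg _) hy))
      (by fun_prop)).differentiableWithinAt

/-- The scale γ = 2c/π normalizes the slope of the profile at 0 to 1, so that the map approaches the
identity as the radius c grows. -/
theorem tendsto_arctanProfile (x : ℝ) :
    Tendsto (fun c : ℝ => arctanProfile c (2 * c / Real.pi) x) atTop (𝓝 x) := by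
  have hpi := Real.pi_pos
  have h1 : HasDerivAt (fun h : ℝ => 2 / Real.pi * Real.arctan (Real.pi / 2 * x * h)) x 0 := by
    have h2 : HasDerivAt (fun h : ℝ => Real.pi / 2 * x * h) (Real.pi / 2 * x) 0 := by
      simpa using (hasDerivAt_id (0 : ℝ)).const_mul (Real.pi / 2 * x)
    have h3 := (h2.arctan).const_mul (2 / Real.pi)
    convert! h3 using 1
    simp
    field_simp
  have h2 := h1.tendsto_slope_zero_right.comp tendsto_inv_atTop_nhdsGT_zero
  refine h2.congr' ?_
  filter_upwards [eventually_gt_atTop 0] with c hc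
  simp only [Function.comp_apply, inv_inv, zero_add, mul_zero, Real.arctan_zero, sub_zero,
    smul_eq_mul, arctanProfile]
  congr 3
  field_simp

theorem tendsto_radial_arctanProfile (t : Par d) :
    Tendsto (fun c : ℝ => radial (arctanProfile c (2 * c / Real.pi)) t) atTop (𝓝 t) := by
  rcases eq_or_ne t 0 with rfl | ht
  · simp [radial_zero]
  have h1 := (tendsto_arctanProfile ‖t‖).smul_const (‖t‖⁻¹ • t)
  rwa [smul_smul, mul_inv_cancel₀ (norm_ne_zero_iff.2 ht), one_smul] at h1

theorem arctanMap_scaled (θ₀ : Par d) (c s γ : ℝ) (t : Par d) :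
    arctanMap θ₀ (c / s) γ t = θ₀ + s⁻¹ • radial (arctanProfile c γ) t := by
  rw [arctanMap_eq, radial, radial, smul_smul s⁻¹]
  congr 2
  unfold arctanProfile
  ring

/-! ### The constant of the two-point bound -/

/-- The number 0.314923 approximates the maximizer y = ε²/8 of 4y exp(-y) - 2y, the solution of 2(1
- y) exp(-y) = 1. -/
theorem exp_twoPoint_argmax_bounds :
    (0.729845 : ℝ) ≤ Real.exp (-0.314923) ∧ Real.exp (-0.314923) ≤ 0.7298451 := by
  have h1 := Real.sum_le_exp_of_nonneg (x := 0.314923) (by norm_num) 9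
  have h2 := Real.exp_bound' (x := 0.314923) (by norm_num) (by norm_num) (n := 9) (by norm_num)
  simp only [Finset.sum_range_succ, Finset.sum_range_zero] at h1 h2
  norm_num [Nat.factorial] at h1 h2
  rw [Real.exp_neg]
  constructor
  · rw [le_inv_comm₀ (by norm_num) (Real.exp_pos _)]
    norm_num
    linarith
  · rw [inv_le_comm₀ (Real.exp_pos _) (by norm_num)]
    norm_num
    linarith

/-- After multiplication by exp(y - y₀), with y₀ = 0.314923, the tangent bound exp(y - y₀) ≥ y - y₀
+ 1 reduces the claim to a quadratic inequality that is almost an equality at y₀. -/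
theorem twoPoint_profile_le {y : ℝ} (hy : 0 ≤ y) :
    4 * y * Real.exp (-y) - 2 * y ≤ 0.289535 := by
  obtain ⟨-, hE⟩ := exp_twoPoint_argmax_bounds
  have h1 := Real.add_one_le_exp (y - 0.314923)
  have h2 : Real.exp (-y) * Real.exp (y - 0.314923) = Real.exp (-0.314923) := by
    rw [← Real.exp_add]; congr 1; ring
  have h3 : (2 * y + 0.289535) * (y - 0.314923 + 1) ≤
      (2 * y + 0.289535) * Real.exp (y - 0.314923) := by
    gcongr
  have h4 : 4 * y * Real.exp (-0.314923) ≤ 4 * y * 0.7298451 := by gcongr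
  have h5 : 4 * y * 0.7298451 ≤ (2 * y + 0.289535) * (y - 0.314923 + 1) := by
    nlinarith [sq_nonneg (y - 0.314923)]
  have h6 : 4 * y * Real.exp (-y) * Real.exp (y - 0.314923) ≤
      (2 * y + 0.289535) * Real.exp (y - 0.314923) := by
    rw [mul_assoc, h2]; linarith
  have := le_of_mul_le_mul_right h6 (Real.exp_pos _)
  linarith

theorem twoPoint_profile_eq (ε : ℝ) : (-(1 / 4) + 1 / 2 * Real.exp (-ε ^ 2 / 8)) * ε ^ 2 =
    4 * (ε ^ 2 / 8) * Real.exp (-(ε ^ 2 / 8)) - 2 * (ε ^ 2 / 8) := by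
  rw [neg_div]; ring

theorem bddAbove_twoPoint_profile : BddAbove
    ((fun ε : ℝ => (-(1 / 4) + 1 / 2 * Real.exp (-ε ^ 2 / 8)) * ε ^ 2) '' Set.Ici 0) := by
  refine ⟨0.289535, ?_⟩
  rintro _ ⟨ε, -, rfl⟩
  simp only
  rw [twoPoint_profile_eq]
  exact twoPoint_profile_le (by positivity)

theorem le_twoPointConst (ε : ℝ) :
    (-(1 / 4) + 1 / 2 * Real.exp (-ε ^ 2 / 8)) * ε ^ 2 ≤ twoPointConst := by
  refine le_csSup bddAbove_twoPoint_profile ⟨|ε|, abs_nonneg ε, ?_⟩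
  simp

theorem twoPointConst_nonneg : 0 ≤ twoPointConst := by
  simpa using le_twoPointConst 0

theorem exists_lt_of_lt_twoPointConst {x : ℝ} (hx : x < twoPointConst) :
    ∃ ε, 0 ≤ ε ∧ x < (-(1 / 4) + 1 / 2 * Real.exp (-ε ^ 2 / 8)) * ε ^ 2 := by
  obtain ⟨_, ⟨ε, hε, rfl⟩, h⟩ := exists_lt_of_lt_csSup (Set.Nonempty.image _ Set.nonempty_Ici) hx
  exact ⟨ε, hε, h⟩

theorem abs_twoPointConst_sub_le : |twoPointConst - 0.28953| ≤ 5 * (10 : ℝ)⁻¹ ^ 6 := by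
  have h1 : twoPointConst ≤ 0.289535 := by
    refine csSup_le (Set.Nonempty.image _ Set.nonempty_Ici) ?_
    rintro _ ⟨ε, -, rfl⟩
    simp only
    rw [twoPoint_profile_eq]
    exact twoPoint_profile_le (by positivity)
  have h2 := le_twoPointConst √(8 * 0.314923)
  rw [twoPoint_profile_eq, Real.sq_sqrt (by norm_num), mul_div_cancel_left₀ _ (by norm_num)] at h2
  obtain ⟨hE, -⟩ := exp_twoPoint_argmax_bounds
  rw [abs_le]
  constructor <;> norm_num at * <;> linarith

/-! ### Local lower limits -/

theorem le_localLiminf {b : ℝ → ℕ → ℝ≥0∞} {V : ℝ}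
    (h : ∀ v, 0 ≤ v → v < V → ∀ᶠ c : ℝ in atTop, ∀ᶠ n : ℕ in atTop,
      ENNReal.ofReal v ≤ n * b c n) : ENNReal.ofReal V ≤ localLiminf b := by
  refine le_of_forall_lt fun x hx => ?_
  have hxt : x ≠ ⊤ := (hx.trans_le le_top).ne
  lift x to NNReal using hxt
  have hxV : (x : ℝ) < V := by
    by_contra hh
    push Not at hh
    have := ENNReal.ofReal_le_ofReal hh
    rw [ENNReal.ofReal_coe_nnreal] at this
    exact absurd hx (not_lt.2 this)
  obtain ⟨v, hv1, hv2⟩ := exists_between hxV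
  have hxv : (x : ℝ≥0∞) < ENNReal.ofReal v := by
    rw [← ENNReal.ofReal_coe_nnreal]
    exact (ENNReal.ofReal_lt_ofReal_iff (x.2.trans_lt hv1)).2 hv1
  refine hxv.trans_le (le_liminf_of_le (by isBoundedDefault) ?_)
  filter_upwards [h v (x.2.trans hv1.le) hv2] with c hc
  exact le_liminf_of_le (by isBoundedDefault) hc

theorem localLiminf_mono {b b' : ℝ → ℕ → ℝ≥0∞} (h : ∀ c > 0, ∀ᶠ n in atTop, b c n ≤ b' c n) :
    localLiminf b ≤ localLiminf b' := by
  refine liminf_le_liminf ?_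
  filter_upwards [eventually_gt_atTop 0] with c hc
  refine liminf_le_liminf ?_
  filter_upwards [h c hc] with n hn
  gcongr

theorem localLiminf_le {b : ℝ → ℕ → ℝ≥0∞} {V : ℝ}
    (h : ∀ c > 0, ∀ v > V, ∀ᶠ n : ℕ in atTop, n * b c n ≤ ENNReal.ofReal v) :
    localLiminf b ≤ ENNReal.ofReal V := by
  have h1 : ∀ c > 0, liminf (fun n : ℕ => (n : ℝ≥0∞) * b c n) atTop ≤ ENNReal.ofReal V := by
    intro c hc
    have h2 : ∀ v > V, liminf (fun n : ℕ => (n : ℝ≥0∞) * b c n) atTop ≤ ENNReal.ofReal v :=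
      fun v hv => (liminf_le_liminf (h c hc v hv)).trans (by simp)
    have h3 : Tendsto ENNReal.ofReal (𝓝[>] V) (𝓝 (ENNReal.ofReal V)) :=
      (ENNReal.continuous_ofReal.tendsto V).mono_left nhdsWithin_le_nhds
    exact ge_of_tendsto h3 (eventually_nhdsWithin_of_forall fun v hv => h2 v hv)
  refine (liminf_le_liminf (v := fun _ => ENNReal.ofReal V) ?_).trans (by simp)
  filter_upwards [eventually_gt_atTop 0] with c hc
  exact h1 c hc

end LAM

namespace LAM

variable {d : ℕ} {𝒳 : Type*} [MeasurableSpace 𝒳]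

/-! ### The efficient direction -/

/-- The vector `I₀⁻¹ ∇ψ(θ₀)`. -/
noncomputable def effDir (ψ : Par d → ℝ) (θ₀ : Par d) (I₀ : Matrix (Fin d) (Fin d) ℝ) : Par d :=
  WithLp.toLp 2 (I₀⁻¹ *ᵥ (gradient ψ θ₀).ofLp)

theorem inner_gradient_effDir (ψ : Par d → ℝ) (θ₀ : Par d) (I₀ : Matrix (Fin d) (Fin d) ℝ) :
    inner ℝ (gradient ψ θ₀) (effDir ψ θ₀ I₀) = lamConst ψ θ₀ I₀ := by
  simp only [PiLp.inner_apply, RCLike.inner_apply, conj_trivial, effDir, lamConst, dotProduct]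
  exact Finset.sum_congr rfl fun i _ => mul_comm _ _

theorem dotProduct_fisher_effDir {ψ : Par d → ℝ} {θ₀ : Par d} {I₀ : Matrix (Fin d) (Fin d) ℝ}
    (h : I₀.PosDef) (x : Par d) :
    (x : Fin d → ℝ) ⬝ᵥ (I₀ *ᵥ (effDir ψ θ₀ I₀).ofLp) = inner ℝ (gradient ψ θ₀) x := by
  have : I₀ *ᵥ (effDir ψ θ₀ I₀).ofLp = (gradient ψ θ₀).ofLp := by
    simp only [effDir]
    rw [Matrix.mulVec_mulVec, Matrix.mul_nonsing_inv _ ((Matrix.isUnit_iff_isUnit_det _).1 h.isUnit),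
      Matrix.one_mulVec]
  rw [this]
  simp only [PiLp.inner_apply, RCLike.inner_apply, conj_trivial, dotProduct]

theorem lamConst_nonneg {ψ : Par d → ℝ} {θ₀ : Par d} {I₀ : Matrix (Fin d) (Fin d) ℝ}
    (h : I₀.PosDef) : 0 ≤ lamConst ψ θ₀ I₀ := by
  rw [← inner_gradient_effDir, ← dotProduct_fisher_effDir h]
  simpa using h.posSemidef.dotProduct_mulVec_nonneg (effDir ψ θ₀ I₀).ofLp

section Model

variable {ν : Measure 𝒳} [SigmaFinite ν] {P : Par d → Measure 𝒳} {Θ : Set (Par d)}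
  {ξ : Par d → 𝒳 → Par d} (M : IsHellingerModel ν P Θ ξ) {ψ : Par d → ℝ} {θ₀ : Par d}
include M

theorem IsHellingerModel.quadratic_effDir (h₀ : θ₀ ∈ Θ) (hI : (fisherInfo ν (ξ θ₀)).PosDef) :
    4 * ∫ x, inner ℝ (effDir ψ θ₀ (fisherInfo ν (ξ θ₀))) (ξ θ₀ x) ^ 2 ∂ν =
      lamConst ψ θ₀ (fisherInfo ν (ξ θ₀)) := by
  rw [← M.fisherInfo_quadratic h₀, dotProduct_fisher_effDir hI, inner_gradient_effDir]

/-- The gradient pairs with x through the Fisher information form evaluated at x and the efficient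
direction, so this is Cauchy–Schwarz in L²(ν), V being the squared length of the efficient
direction. -/
theorem IsHellingerModel.sq_inner_gradient_le (h₀ : θ₀ ∈ Θ) (hI : (fisherInfo ν (ξ θ₀)).PosDef)
    (x : Par d) : inner ℝ (gradient ψ θ₀) x ^ 2 ≤
      lamConst ψ θ₀ (fisherInfo ν (ξ θ₀)) * (4 * ∫ y, inner ℝ x (ξ θ₀ y) ^ 2 ∂ν) := by
  rw [← dotProduct_fisher_effDir hI, M.fisherInfo_bilinear h₀, ← M.quadratic_effDir h₀ hI]
  have := sq_integral_mul_le (M.memLp_inner h₀ x)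
    (M.memLp_inner h₀ (effDir ψ θ₀ (fisherInfo ν (ξ θ₀))))
  nlinarith

theorem IsHellingerModel.tendsto_hsq_scaled (h₀ : θ₀ ∈ interior Θ) (a b : Par d) :
    Tendsto (fun n : ℕ => n * hsq ν P (θ₀ + (√n)⁻¹ • a) (θ₀ + (√n)⁻¹ • b)) atTop
      (𝓝 (∫ x, inner ℝ (a - b) (ξ θ₀ x) ^ 2 ∂ν)) := by
  rw [Metric.tendsto_nhds]
  intro ε hε
  filter_upwards [M.hsq_scaled h₀ (max ‖a‖ ‖b‖) (half_pos hε)] with n hn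
  rw [Real.dist_eq]
  exact (hn a b (le_max_left _ _) (le_max_right _ _)).trans_lt (half_lt_self hε)

end Model

theorem gradient_scaled {ψ : Par d → ℝ} {θ₀ : Par d} (hψ : DifferentiableAt ℝ ψ θ₀) (c : ℝ) {ε : ℝ}
    (hε : 0 < ε) : ∀ᶠ n : ℕ in atTop, ∀ a b : Par d, ‖a‖ ≤ c → ‖b‖ ≤ c →
      |√n * (ψ (θ₀ + (√n)⁻¹ • a) - ψ (θ₀ + (√n)⁻¹ • b)) - inner ℝ (gradient ψ θ₀) (a - b)| ≤ ε := by
  have h1 := hψ.hasGradientAt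
  rw [hasGradientAt_iff_isLittleO_nhds_zero] at h1
  -- Each of the two endpoints costs at most |c| times this tolerance, so the total stays below ε;
  -- the 1 keeps the denominator positive.
  obtain ⟨δ, hδ, h2⟩ := Metric.eventually_nhds_iff.1
    (h1.def (c := ε / (2 * |c| + 1)) (by positivity))
  have hlim : Tendsto (fun n : ℕ => (√(n : ℝ))⁻¹ * |c|) atTop (𝓝 0) := by
    simpa using ((tendsto_inv_atTop_zero.comp
      (Real.tendsto_sqrt_atTop.comp tendsto_natCast_atTop_atTop)).mul_const |c|)
  filter_upwards [hlim.eventually (gt_mem_nhds hδ), eventually_gt_atTop 0] with n hn hn0 a b ha hb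
  have hn0' : (0 : ℝ) < n := by exact_mod_cast hn0
  have hsn : 0 < √(n : ℝ) := Real.sqrt_pos.2 hn0'
  have key : ∀ a : Par d, ‖a‖ ≤ c →
      |√n * (ψ (θ₀ + (√n)⁻¹ • a) - ψ θ₀) - inner ℝ (gradient ψ θ₀) a| ≤
        ε / (2 * |c| + 1) * |c| := fun a ha => by
    have hca : ‖a‖ ≤ |c| := ha.trans (le_abs_self c)
    have hnorm : ‖(√(n : ℝ))⁻¹ • a‖ = (√(n : ℝ))⁻¹ * ‖a‖ := by
      rw [norm_smul, norm_inv, Real.norm_of_nonneg hsn.le]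
    have h3 := h2 (y := (√(n : ℝ))⁻¹ • a) (by
      rw [dist_zero_right, hnorm]
      refine lt_of_le_of_lt ?_ hn
      gcongr)
    rw [hnorm, Real.norm_eq_abs, real_inner_smul_right] at h3
    have h4 := mul_le_mul_of_nonneg_left h3 hsn.le
    rw [← abs_of_pos hsn, ← abs_mul, abs_of_pos hsn] at h4
    have e : √n * (ψ (θ₀ + (√n)⁻¹ • a) - ψ θ₀ - (√n)⁻¹ * inner ℝ (gradient ψ θ₀) a) =
        √n * (ψ (θ₀ + (√n)⁻¹ • a) - ψ θ₀) - inner ℝ (gradient ψ θ₀) a := by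
      field_simp
    rw [e] at h4
    refine h4.trans ?_
    calc √n * (ε / (2 * |c| + 1) * ((√n)⁻¹ * ‖a‖)) = ε / (2 * |c| + 1) * ‖a‖ := by field_simp
      _ ≤ _ := by gcongr
  have e : √n * (ψ (θ₀ + (√n)⁻¹ • a) - ψ (θ₀ + (√n)⁻¹ • b)) - inner ℝ (gradient ψ θ₀) (a - b) =
      (√n * (ψ (θ₀ + (√n)⁻¹ • a) - ψ θ₀) - inner ℝ (gradient ψ θ₀) a) -
      (√n * (ψ (θ₀ + (√n)⁻¹ • b) - ψ θ₀) - inner ℝ (gradient ψ θ₀) b) := by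
    rw [inner_sub_right]; ring
  rw [e]
  refine (abs_sub _ _).trans ((add_le_add (key a ha) (key b hb)).trans ?_)
  rw [← mul_add, div_mul_eq_mul_div, div_le_iff₀ (by positivity)]
  nlinarith [abs_nonneg c]

theorem tendsto_gradient_scaled {ψ : Par d → ℝ} {θ₀ : Par d} (hψ : DifferentiableAt ℝ ψ θ₀)
    (a b : Par d) :
    Tendsto (fun n : ℕ => √n * (ψ (θ₀ + (√n)⁻¹ • a) - ψ (θ₀ + (√n)⁻¹ • b))) atTop
      (𝓝 (inner ℝ (gradient ψ θ₀) (a - b))) := by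
  rw [Metric.tendsto_nhds]
  intro ε hε
  filter_upwards [gradient_scaled hψ (max ‖a‖ ‖b‖) (half_pos hε)] with n hn
  rw [Real.dist_eq]
  exact (hn a b (le_max_left _ _) (le_max_right _ _)).trans_lt (half_lt_self hε)

/-! ### Asymptotics of the two-point bound -/

/-- Bookkeeping for passing from a finite n to the limit: q is the limiting affinity and G the
limiting increment of ψ, r is the multiplicative error of the affinity and δ the additive error of
the increment. The last hypothesis is the inequality for the limits, required only where its weight
is nonnegative. -/
theorem twoPoint_upper_ineq {C V E E₀ p G G₀ q δ r s : ℝ} (hV : 0 ≤ V) (hG0 : 0 ≤ G) (hG : G ≤ G₀)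
    (hC : 0 ≤ C) (hδ : 0 ≤ δ) (hs : |s| ≤ G + δ) (hp : p = s ^ 2) (hr : 1 ≤ r)
    (hE : E ≤ 2 * q * r - 1) (hq : q ≤ 1) (hE0 : E₀ = 2 * q - 1)
    (hmain : 0 ≤ E₀ → E₀ / 4 * G ^ 2 ≤ C * V) :
    E / 4 * p ≤ C * V + (2 * (r - 1) * G₀ ^ 2 + 2 * r * (δ * (2 * G₀ + δ))) / 4 := by
  have hp1 : p ≤ G ^ 2 + δ * (2 * G₀ + δ) := by
    have h1 := pow_le_pow_left₀ (abs_nonneg s) hs 2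
    rw [sq_abs, ← hp] at h1
    nlinarith
  have hG2 : G ^ 2 ≤ G₀ ^ 2 := pow_le_pow_left₀ hG0 hG 2
  have hK : 0 ≤ δ * (2 * G₀ + δ) := mul_nonneg hδ (by linarith)
  have hCV := mul_nonneg hC hV
  have hp0 : 0 ≤ p := hp ▸ sq_nonneg s
  have hrest : 0 ≤ (2 * (r - 1) * G₀ ^ 2 + 2 * r * (δ * (2 * G₀ + δ))) / 4 := by
    have : 0 ≤ r - 1 := by linarith
    positivity
  rcases le_total E 0 with h | h
  · nlinarith
  have h1 : E / 4 * p ≤ E / 4 * (G ^ 2 + δ * (2 * G₀ + δ)) := by gcongr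
  have h2 : E / 4 * (δ * (2 * G₀ + δ)) ≤ 2 * r / 4 * (δ * (2 * G₀ + δ)) := by
    gcongr
    nlinarith
  have h3 : E / 4 * G ^ 2 ≤ (E₀ + 2 * (r - 1)) / 4 * G ^ 2 := by
    gcongr
    rw [hE0]; nlinarith
  have h4 : 2 * (r - 1) / 4 * G ^ 2 ≤ 2 * (r - 1) / 4 * G₀ ^ 2 := by
    have : 0 ≤ r - 1 := by linarith
    gcongr
  have h5 : E₀ / 4 * G ^ 2 ≤ C * V := by
    rcases le_total 0 E₀ with h6 | h6
    · exact hmain h6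
    · nlinarith [sq_nonneg G]
  linarith

section TwoPoint

variable {ν : Measure 𝒳} [SigmaFinite ν] {P : Par d → Measure 𝒳} {Θ : Set (Par d)}
  {ξ : Par d → 𝒳 → Par d} (M : IsHellingerModel ν P Θ ξ) {ψ : Par d → ℝ} {θ₀ : Par d}
include M

theorem IsHellingerModel.mul_twoPoint_eq {θ₁ θ₂ : Par d} (h₁ : θ₁ ∈ Θ) (h₂ : θ₂ ∈ Θ) (n : ℕ) :
    (n : ℝ≥0∞) * ((1 - hellingerSq (iidLaw P n θ₁) (iidLaw P n θ₂)) / 4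
      * ENNReal.ofReal ((ψ θ₁ - ψ θ₂) ^ 2)) =
    ENNReal.ofReal ((2 * (1 - hsq ν P θ₁ θ₂ / 2) ^ n - 1) / 4 * (√n * (ψ θ₁ - ψ θ₂)) ^ 2) := by
  have h0 : (0 : ℝ) ≤ 2 - 2 * (1 - hsq ν P θ₁ θ₂ / 2) ^ n := by
    have := pow_le_one₀ (n := n) (a := 1 - hsq ν P θ₁ θ₂ / 2)
      (by linarith [M.hsq_le_two h₁ h₂]) (by linarith [hsq_nonneg ν P θ₁ θ₂])
    linarith
  rw [M.hellingerSq_iid h₁ h₂, ← ENNReal.ofReal_one, ← ENNReal.ofReal_sub _ h0,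
    show (4 : ℝ≥0∞) = ENNReal.ofReal 4 by simp, ← ENNReal.ofReal_div_of_pos (by norm_num),
    ← ENNReal.ofReal_mul' (sq_nonneg _), ← ENNReal.ofReal_natCast,
    ← ENNReal.ofReal_mul (Nat.cast_nonneg n), mul_pow, Real.sq_sqrt (Nat.cast_nonneg n)]
  congr 1; ring

/-- The one-sample affinity is 1 - H²/2 with n H² convergent, so its n-th power has the usual
exponential limit. -/
theorem IsHellingerModel.tendsto_affinity_scaled (h₀ : θ₀ ∈ interior Θ) (a b : Par d) :
    Tendsto (fun n : ℕ => (1 - hsq ν P (θ₀ + (√n)⁻¹ • a) (θ₀ + (√n)⁻¹ • b) / 2) ^ n) atTop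
      (𝓝 (Real.exp (-((∫ x, inner ℝ (a - b) (ξ θ₀ x) ^ 2 ∂ν) / 2)))) := by
  have h1 := ((M.tendsto_hsq_scaled h₀ a b).div_const 2).neg
  have h2 := Real.tendsto_one_add_pow_exp_of_tendsto
    (g := fun n => -(hsq ν P (θ₀ + (√n)⁻¹ • a) (θ₀ + (√n)⁻¹ • b) / 2))
    (h1.congr fun n => by ring)
  exact h2.congr fun n => by rw [← sub_eq_add_neg]

theorem IsHellingerModel.le_localLiminf_twoPointBound (h₀ : θ₀ ∈ interior Θ)
    (hI : (fisherInfo ν (ξ θ₀)).PosDef) (hψ : DifferentiableAt ℝ ψ θ₀) :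
    ENNReal.ofReal (twoPointConst * lamConst ψ θ₀ (fisherInfo ν (ξ θ₀))) ≤
      localLiminf fun c n => twoPointBound P ψ n (localBall θ₀ c n) := by
  have h₀Θ := interior_subset h₀
  set V := lamConst ψ θ₀ (fisherInfo ν (ξ θ₀)) with hV
  refine le_localLiminf fun v hv hvV => ?_
  -- If V = 0, no level v ≥ 0 lies below the target.
  have hV0 : 0 < V := by
    rcases (lamConst_nonneg (ψ := ψ) (θ₀ := θ₀) hI).lt_or_eq with h | h
    · exact h
    · rw [← hV] at h; rw [← h, mul_zero] at hvV; linarith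
  obtain ⟨ε, hε, hlt⟩ := exists_lt_of_lt_twoPointConst ((div_lt_iff₀ hV0).2 hvV)
  rw [div_lt_iff₀ hV0] at hlt
  -- Normalized so that the Fisher information form of x equals ε² and the increment of ψ equals
  -- ε√V.
  set x : Par d := (ε / √V) • effDir ψ θ₀ (fisherInfo ν (ξ θ₀)) with hx
  have hsV := Real.sqrt_pos.2 hV0
  have hgx : inner ℝ (gradient ψ θ₀) (x - 0) = ε * √V := by
    rw [sub_zero, hx, real_inner_smul_right, inner_gradient_effDir, ← hV]
    field_simp
    rw [Real.sq_sqrt hV0.le]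
  have hqx : ∫ y, inner ℝ (x - 0) (ξ θ₀ y) ^ 2 ∂ν = ε ^ 2 / 4 := by
    have h1 := M.quadratic_effDir (ψ := ψ) h₀Θ hI
    rw [← hV] at h1
    simp_rw [sub_zero, hx, real_inner_smul_left, mul_pow]
    rw [integral_const_mul, div_pow, Real.sq_sqrt hV0.le]
    have h2 : ∫ y, inner ℝ (effDir ψ θ₀ (fisherInfo ν (ξ θ₀))) (ξ θ₀ y) ^ 2 ∂ν = V / 4 := by
      linarith
    rw [h2]
    field_simp
  have hlim := (((M.tendsto_affinity_scaled h₀ x 0).const_mul 2).sub_const 1).div_const 4 |>.mul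
    ((tendsto_gradient_scaled hψ x 0).pow 2)
  rw [hgx, hqx] at hlim
  have hval : (2 * Real.exp (-(ε ^ 2 / 4 / 2)) - 1) / 4 * (ε * √V) ^ 2 =
      (-(1 / 4) + 1 / 2 * Real.exp (-ε ^ 2 / 8)) * ε ^ 2 * V := by
    rw [mul_pow, Real.sq_sqrt hV0.le, show -(ε ^ 2 / 4 / 2) = -ε ^ 2 / 8 by ring]; ring
  rw [hval] at hlim
  have hΘ : ∀ᶠ n : ℕ in atTop, θ₀ + (√(n : ℝ))⁻¹ • x ∈ Θ := by
    have h1 : Tendsto (fun n : ℕ => θ₀ + (√(n : ℝ))⁻¹ • x) atTop (𝓝 (θ₀ + (0 : ℝ) • x)) :=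
      tendsto_const_nhds.add ((tendsto_inv_atTop_zero.comp
        (Real.tendsto_sqrt_atTop.comp tendsto_natCast_atTop_atTop)).smul_const x)
    rw [zero_smul, add_zero] at h1
    exact h1.eventually (mem_interior_iff_mem_nhds.1 h₀)
  filter_upwards [eventually_gt_atTop ‖x‖] with c hc
  filter_upwards [hlim.eventually (lt_mem_nhds hlt), hΘ, eventually_gt_atTop 0] with n hn hnΘ hn0
  have hsn : 0 < √(n : ℝ) := Real.sqrt_pos.2 (by exact_mod_cast hn0)
  simp only [smul_zero, add_zero] at hn
  have h1 : θ₀ + (√(n : ℝ))⁻¹ • x ∈ localBall θ₀ c n := by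
    rw [localBall, mem_ball_iff_norm, add_sub_cancel_left, norm_smul, norm_inv,
      Real.norm_of_nonneg hsn.le, inv_mul_eq_div]
    gcongr
  have h2 : θ₀ ∈ localBall θ₀ c n :=
    Metric.mem_ball_self (div_pos ((norm_nonneg x).trans_lt hc) hsn)
  calc ENNReal.ofReal v ≤ _ := ENNReal.ofReal_le_ofReal hn.le
    _ = _ := (M.mul_twoPoint_eq hnΘ h₀Θ n).symm
    _ ≤ _ := by
      gcongr
      exact le_iSup₂_of_le _ h1 (le_iSup₂_of_le _ h2 le_rfl)

/-- For fixed c the estimates of affinities and increments are uniform over pairs in the ball, so it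
suffices to bound the limit expression for every pair of directions; that is Cauchy–Schwarz followed
by the definition of the constant. -/
theorem IsHellingerModel.localLiminf_twoPointBound_le (h₀ : θ₀ ∈ interior Θ)
    (hI : (fisherInfo ν (ξ θ₀)).PosDef) (hψ : DifferentiableAt ℝ ψ θ₀) :
    localLiminf (fun c n => twoPointBound P ψ n (localBall θ₀ c n)) ≤
      ENNReal.ofReal (twoPointConst * lamConst ψ θ₀ (fisherInfo ν (ξ θ₀))) := by
  have h₀Θ := interior_subset h₀
  set V := lamConst ψ θ₀ (fisherInfo ν (ξ θ₀)) with hV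
  have hV0 : 0 ≤ V := lamConst_nonneg hI
  refine localLiminf_le fun c hc v hv => ?_
  set G₀ := ‖gradient ψ θ₀‖ * (2 * c) with hG₀
  -- The right-hand side of `twoPoint_upper_ineq` with r = exp(δ/2), where δ serves both uniform
  -- approximations; it tends to the claimed limit as δ → 0.
  let Φ : ℝ → ℝ := fun δ => twoPointConst * V +
    (2 * (Real.exp (δ / 2) - 1) * G₀ ^ 2 + 2 * Real.exp (δ / 2) * (δ * (2 * G₀ + δ))) / 4
  have hΦ : Tendsto Φ (𝓝[>] 0) (𝓝 (twoPointConst * V)) := by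
    have h1 : Continuous Φ := by fun_prop
    have h2 := h1.tendsto 0
    simp only [Φ, zero_div, Real.exp_zero, sub_self, mul_zero, zero_mul, add_zero] at h2
    exact h2.mono_left nhdsWithin_le_nhds
  obtain ⟨δ, hδv, hδ⟩ := ((hΦ.eventually (gt_mem_nhds hv)).and
    (eventually_mem_nhdsWithin (a := (0 : ℝ)) (s := Set.Ioi 0))).exists
  have hδ0 : 0 < δ := hδ
  have hsub : ∀ᶠ n : ℕ in atTop, localBall θ₀ c n ⊆ Θ := by
    obtain ⟨r, hr, hrΘ⟩ := Metric.mem_nhds_iff.1 (mem_interior_iff_mem_nhds.1 h₀)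
    have hlim : Tendsto (fun n : ℕ => c / √(n : ℝ)) atTop (𝓝 0) :=
      (Real.tendsto_sqrt_atTop.comp tendsto_natCast_atTop_atTop).const_div_atTop c
    filter_upwards [hlim.eventually (gt_mem_nhds hr)] with n hn
    exact (Metric.ball_subset_ball hn.le).trans hrΘ
  filter_upwards [M.hsq_scaled h₀ c hδ0, gradient_scaled hψ c hδ0, hsub, eventually_gt_atTop 0]
    with n hn1 hn2 hnΘ hn0
  have hsn : 0 < √(n : ℝ) := Real.sqrt_pos.2 (by exact_mod_cast hn0)
  unfold twoPointBound
  simp only [ENNReal.mul_iSup]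
  refine iSup₂_le fun θ₁ h₁ => iSup₂_le fun θ₂ h₂ => ?_
  rw [M.mul_twoPoint_eq (hnΘ h₁) (hnΘ h₂)]
  refine ENNReal.ofReal_le_ofReal (le_trans ?_ hδv.le)
  have hpar : ∀ θ ∈ localBall θ₀ c n, ∃ a : Par d, ‖a‖ ≤ c ∧ θ = θ₀ + (√(n : ℝ))⁻¹ • a :=
    fun θ hθ => by
      rw [localBall, mem_ball_iff_norm, lt_div_iff₀ hsn] at hθ
      refine ⟨√(n : ℝ) • (θ - θ₀), ?_, ?_⟩
      · rw [norm_smul, Real.norm_of_nonneg hsn.le, mul_comm]; exact hθ.le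
      · rw [smul_smul, inv_mul_cancel₀ hsn.ne', one_smul, add_sub_cancel]
  obtain ⟨a, ha, rfl⟩ := hpar θ₁ h₁
  obtain ⟨b, hb, rfl⟩ := hpar θ₂ h₂
  have k1 := abs_le.1 (hn1 a b ha hb)
  have k2 := hn2 a b ha hb
  have hH2 := M.hsq_le_two (hnΘ h₁) (hnΘ h₂)
  have hab : ‖a - b‖ ≤ 2 * c := (norm_sub_le a b).trans (by linarith)
  have hexp : (1 - hsq ν P (θ₀ + (√n)⁻¹ • a) (θ₀ + (√n)⁻¹ • b) / 2) ^ n ≤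
      Real.exp (-((∫ x, inner ℝ (a - b) (ξ θ₀ x) ^ 2 ∂ν) / 2)) * Real.exp (δ / 2) := by
    refine (pow_le_pow_left₀ (by linarith) (Real.one_sub_le_exp_neg _) n).trans ?_
    rw [← Real.exp_nat_mul, ← Real.exp_add]
    refine Real.exp_le_exp.2 ?_
    linarith
  refine twoPoint_upper_ineq (G := |inner ℝ (gradient ψ θ₀) (a - b)|) hV0 (abs_nonneg _) ?_
    twoPointConst_nonneg hδ0.le ?_ rfl (Real.one_le_exp (by linarith))
    (q := Real.exp (-((∫ x, inner ℝ (a - b) (ξ θ₀ x) ^ 2 ∂ν) / 2))) ?_ ?_ rfl ?_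
  · exact (abs_real_inner_le_norm _ _).trans (mul_le_mul_of_nonneg_left hab (norm_nonneg _))
  · have := abs_sub_abs_le_abs_sub (√(n : ℝ) * (ψ (θ₀ + (√n)⁻¹ • a) - ψ (θ₀ + (√n)⁻¹ • b)))
      (inner ℝ (gradient ψ θ₀) (a - b))
    linarith
  · linarith
  · refine Real.exp_le_one_iff.2 ?_
    have : 0 ≤ ∫ x, inner ℝ (a - b) (ξ θ₀ x) ^ 2 ∂ν := integral_nonneg fun _ => sq_nonneg _
    linarith
  · intro hE0
    set Q := ∫ x, inner ℝ (a - b) (ξ θ₀ x) ^ 2 ∂ν with hQ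
    have hQ0 : 0 ≤ Q := integral_nonneg fun _ => sq_nonneg _
    have h1 := M.sq_inner_gradient_le (ψ := ψ) h₀Θ hI (a - b)
    rw [← hQ, ← hV] at h1
    -- The parameter ε is the Fisher length of a - b, whose square is 4Q.
    have h2 := le_twoPointConst √(4 * Q)
    rw [Real.sq_sqrt (by positivity), show -(4 * Q) / 8 = -(Q / 2) by ring] at h2
    rw [sq_abs]
    calc (2 * Real.exp (-(Q / 2)) - 1) / 4 * inner ℝ (gradient ψ θ₀) (a - b) ^ 2
        ≤ (2 * Real.exp (-(Q / 2)) - 1) / 4 * (V * (4 * Q)) := by gcongr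
      _ = (-(1 / 4) + 1 / 2 * Real.exp (-(Q / 2))) * (4 * Q) * V := by ring
      _ ≤ twoPointConst * V := by gcongr

end TwoPoint

end LAM

namespace LAM

variable {d : ℕ} {𝒳 : Type*} [MeasurableSpace 𝒳]

/-! ### Subadditivity of the squared Hellinger distance -/

section Subadditive

variable {Ω : Type*} [MeasurableSpace Ω]

/-- The reverse triangle inequality in ℓ². -/
theorem sq_sqrt_sum_sub_sqrt_sum_le {ι : Type*} (s : Finset ι) (f g : ι → ℝ) :
    (√(∑ i ∈ s, f i ^ 2) - √(∑ i ∈ s, g i ^ 2)) ^ 2 ≤ ∑ i ∈ s, (f i - g i) ^ 2 := by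
  have h1 : 0 ≤ ∑ i ∈ s, f i ^ 2 := Finset.sum_nonneg fun _ _ => sq_nonneg _
  have h2 : 0 ≤ ∑ i ∈ s, g i ^ 2 := Finset.sum_nonneg fun _ _ => sq_nonneg _
  have h3 : ∑ i ∈ s, f i * g i ≤ √(∑ i ∈ s, f i ^ 2) * √(∑ i ∈ s, g i ^ 2) := by
    rw [← Real.sqrt_mul h1]
    exact Real.le_sqrt_of_sq_le (Finset.sum_mul_sq_le_sq_mul_sq s f g)
  have h4 : ∑ i ∈ s, (f i - g i) ^ 2 =
      ∑ i ∈ s, f i ^ 2 - 2 * ∑ i ∈ s, f i * g i + ∑ i ∈ s, g i ^ 2 := by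
    rw [Finset.mul_sum, ← Finset.sum_sub_distrib, ← Finset.sum_add_distrib]
    exact Finset.sum_congr rfl fun i _ => by ring
  rw [h4, sub_sq, Real.sq_sqrt h1, Real.sq_sqrt h2]
  linarith

theorem HasRootDensity.sum {ι : Type*} (s : Finset ι) {μ : ι → Measure Ω} {ρ : Measure Ω}
    {f : ι → Ω → ℝ} (h : ∀ i, HasRootDensity (μ i) ρ (f i)) :
    HasRootDensity (∑ i ∈ s, μ i) ρ fun x => √(∑ i ∈ s, f i x ^ 2) where
  measurable := (Finset.measurable_sum s fun i _ => (h i).measurable.pow_const 2).sqrt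
  nonneg x := Real.sqrt_nonneg _
  eq := by
    have e : ∀ x, ENNReal.ofReal (√(∑ i ∈ s, f i x ^ 2) ^ 2) =
        ∑ i ∈ s, ENNReal.ofReal (f i x ^ 2) := fun x => by
      rw [Real.sq_sqrt (Finset.sum_nonneg fun _ _ => sq_nonneg _),
        ENNReal.ofReal_sum_of_nonneg fun _ _ => sq_nonneg _]
    refine Measure.ext fun A hA => ?_
    simp_rw [e]
    rw [withDensity_apply _ hA, lintegral_finsetSum _ fun i _ =>
      ((h i).measurable.pow_const 2).ennreal_ofReal, Measure.finsetSum_apply]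
    refine Finset.sum_congr rfl fun i _ => ?_
    rw [← withDensity_apply _ hA, ← (h i).eq]

/-- With respect to a common dominating measure the root density of a sum is the ℓ² norm of the root
densities, so the reverse triangle inequality holds pointwise under the integral. -/
theorem hellingerSq_sum_le (N : ℕ) (μ μ' : ℕ → Measure Ω) [∀ i, IsFiniteMeasure (μ i)]
    [∀ i, IsFiniteMeasure (μ' i)] :
    hellingerSq (∑ i ∈ Finset.range N, μ i) (∑ i ∈ Finset.range N, μ' i) ≤
      ∑ i ∈ Finset.range N, hellingerSq (μ i) (μ' i) := by
  set ρ : Measure Ω := ∑ i ∈ Finset.range N, (μ i + μ' i) with hρ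
  -- Extension by zero beyond N makes every index, not only those in the sum, absolutely continuous
  -- with respect to ρ.
  let ν : ℕ → Measure Ω := fun i => if i < N then μ i else 0
  let ν' : ℕ → Measure Ω := fun i => if i < N then μ' i else 0
  have hν : ∀ i ∈ Finset.range N, ν i = μ i := fun i hi => by simp [ν, Finset.mem_range.1 hi]
  have hν' : ∀ i ∈ Finset.range N, ν' i = μ' i := fun i hi => by simp [ν', Finset.mem_range.1 hi]
  have f1 : ∀ i, IsFiniteMeasure (ν i) := fun i => by
    by_cases h : i < N <;> simp only [ν, h, if_true, if_false] <;> infer_instance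
  have f2 : ∀ i, IsFiniteMeasure (ν' i) := fun i => by
    by_cases h : i < N <;> simp only [ν', h, if_true, if_false] <;> infer_instance
  have hle : ∀ i ∈ Finset.range N, μ i + μ' i ≤ ρ := fun i hi => by
    rw [hρ]
    exact Finset.single_le_sum (f := fun i => μ i + μ' i) (fun j _ => Measure.zero_le _) hi
  have a1 : ∀ i, ν i ≪ ρ := fun i => by
    by_cases h : i < N
    · simp only [ν, h, if_true]
      exact Measure.absolutelyContinuous_of_le
        ((Measure.le_add_right le_rfl).trans (hle i (Finset.mem_range.2 h)))
    · simp only [ν, h, if_false]; exact Measure.AbsolutelyContinuous.zero _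
  have a2 : ∀ i, ν' i ≪ ρ := fun i => by
    by_cases h : i < N
    · simp only [ν', h, if_true]
      exact Measure.absolutelyContinuous_of_le
        ((Measure.le_add_left le_rfl).trans (hle i (Finset.mem_range.2 h)))
    · simp only [ν', h, if_false]; exact Measure.AbsolutelyContinuous.zero _
  have r1 := fun i => hasRootDensity_sqrt_rnDeriv (a1 i)
  have r2 := fun i => hasRootDensity_sqrt_rnDeriv (a2 i)
  rw [← Finset.sum_congr rfl hν, ← Finset.sum_congr rfl hν',
    hellingerSq_eq_lintegral (HasRootDensity.sum _ r1) (HasRootDensity.sum _ r2)]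
  have e : ∀ i ∈ Finset.range N, hellingerSq (ν i) (ν' i) =
      ∫⁻ x, ENNReal.ofReal ((√((ν i).rnDeriv ρ x).toReal - √((ν' i).rnDeriv ρ x).toReal) ^ 2) ∂ρ :=
    fun i _ => hellingerSq_eq_lintegral (r1 i) (r2 i)
  have e' : ∀ i ∈ Finset.range N, hellingerSq (μ i) (μ' i) = hellingerSq (ν i) (ν' i) :=
    fun i hi => by rw [hν i hi, hν' i hi]
  rw [Finset.sum_congr rfl e', Finset.sum_congr rfl e, ← lintegral_finsetSum]
  · refine lintegral_mono fun x => ?_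
    rw [← ENNReal.ofReal_sum_of_nonneg fun _ _ => sq_nonneg _]
    exact ENNReal.ofReal_le_ofReal (sq_sqrt_sum_sub_sqrt_sum_le _ _ _)
  · intro i _
    exact (((r1 i).measurable.sub (r2 i).measurable).pow_const 2).ennreal_ofReal

/-- The crude bound (√a - √b)² ≤ a + b, which serves for the two end atoms of the chain that have no
partner. -/
theorem hellingerSq_le_add (μ μ' : Measure Ω) [IsFiniteMeasure μ] [IsFiniteMeasure μ'] :
    hellingerSq μ μ' ≤ μ Set.univ + μ' Set.univ := by
  have a1 : μ ≪ μ + μ' := Measure.AbsolutelyContinuous.add_right .rfl _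
  have a2 : μ' ≪ μ + μ' := by rw [add_comm]; exact Measure.AbsolutelyContinuous.add_right .rfl _
  have r1 := hasRootDensity_sqrt_rnDeriv a1
  have r2 := hasRootDensity_sqrt_rnDeriv a2
  have e1 := r1.lintegral_eq (fun _ => 1) measurable_const
  have e2 := r2.lintegral_eq (fun _ => 1) measurable_const
  simp only [lintegral_one, mul_one] at e1 e2
  rw [hellingerSq_eq_lintegral r1 r2, e1, e2, ← lintegral_add_left
    (r1.measurable.pow_const 2).ennreal_ofReal]
  refine lintegral_mono fun x => ?_
  rw [← ENNReal.ofReal_add (sq_nonneg _) (sq_nonneg _)]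
  refine ENNReal.ofReal_le_ofReal ?_
  nlinarith [mul_nonneg (r1.nonneg x) (r2.nonneg x)]

theorem HasRootDensity.smul_prod_dirac {μ ρ : Measure Ω} [SigmaFinite ρ] [IsFiniteMeasure μ]
    {f : Ω → ℝ} (h : HasRootDensity μ ρ f) {w : ℝ} (hw : 0 ≤ w) (t : Par d) :
    HasRootDensity (ENNReal.ofReal w • μ.prod (Measure.dirac t)) (ρ.prod (Measure.dirac t))
      fun z => √w * f z.1 where
  measurable := (h.measurable.comp measurable_fst).const_mul _
  nonneg z := mul_nonneg (Real.sqrt_nonneg _) (h.nonneg _)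
  eq := by
    have hm := (h.measurable.pow_const 2).ennreal_ofReal
    have hs : SFinite (ρ.withDensity fun x => ENNReal.ofReal (f x ^ 2)) := by
      rw [← h.eq]; infer_instance
    conv_lhs => rw [h.eq]
    have hm' : Measurable fun z : Ω × Par d => ENNReal.ofReal (f z.1 ^ 2) := hm.comp measurable_fst
    rw [prod_withDensity_left hm, ← withDensity_smul _ hm']
    congr 1
    ext z
    simp only [Pi.smul_apply, smul_eq_mul]
    rw [mul_pow, Real.sq_sqrt hw, ENNReal.ofReal_mul hw]

theorem hellingerSq_smul_prod_dirac (μ μ' : Measure Ω) [IsFiniteMeasure μ] [IsFiniteMeasure μ']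
    {w : ℝ} (hw : 0 ≤ w) (t : Par d) :
    hellingerSq (ENNReal.ofReal w • μ.prod (Measure.dirac t))
      (ENNReal.ofReal w • μ'.prod (Measure.dirac t)) = ENNReal.ofReal w * hellingerSq μ μ' := by
  have a1 : μ ≪ μ + μ' := Measure.AbsolutelyContinuous.add_right .rfl _
  have a2 : μ' ≪ μ + μ' := by rw [add_comm]; exact Measure.AbsolutelyContinuous.add_right .rfl _
  have r1 := hasRootDensity_sqrt_rnDeriv a1
  have r2 := hasRootDensity_sqrt_rnDeriv a2
  have i1 : IsFiniteMeasure (ENNReal.ofReal w • μ.prod (Measure.dirac t)) :=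
    Measure.smul_finite _ (by simp)
  have i2 : IsFiniteMeasure (ENNReal.ofReal w • μ'.prod (Measure.dirac t)) :=
    Measure.smul_finite _ (by simp)
  have hm : Measurable fun x => ENNReal.ofReal
      ((√(μ.rnDeriv (μ + μ') x).toReal - √(μ'.rnDeriv (μ + μ') x).toReal) ^ 2) :=
    ((r1.measurable.sub r2.measurable).pow_const 2).ennreal_ofReal
  rw [hellingerSq_eq_lintegral (r1.smul_prod_dirac hw t) (r2.smul_prod_dirac hw t),
    hellingerSq_eq_lintegral r1 r2, ← lintegral_const_mul _ hm]
  have e : ∀ z : Ω × Par d, ENNReal.ofReal ((√w * √(μ.rnDeriv (μ + μ') z.1).toReal -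
      √w * √(μ'.rnDeriv (μ + μ') z.1).toReal) ^ 2) = ENNReal.ofReal w * ENNReal.ofReal
      ((√(μ.rnDeriv (μ + μ') z.1).toReal - √(μ'.rnDeriv (μ + μ') z.1).toReal) ^ 2) := fun z => by
    rw [← mul_sub, mul_pow, Real.sq_sqrt hw, ENNReal.ofReal_mul hw]
  simp_rw [e]
  have hm' : Measurable fun z : Ω × Par d => ENNReal.ofReal w * ENNReal.ofReal
      ((√(μ.rnDeriv (μ + μ') z.1).toReal - √(μ'.rnDeriv (μ + μ') z.1).toReal) ^ 2) :=
    (hm.comp measurable_fst).const_mul _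
  rw [lintegral_prod _ hm'.aemeasurable]
  simp

end Subadditive

/-! ### A lower estimate of the mixture Hellinger bound along a chain of points -/

section Chain

variable {Ω : Type*} [MeasurableSpace Ω] {κ : Par d → Measure Ω}

/-- The uniform distribution on `p 1, …, p N`. -/
noncomputable def chainPrior (p : ℕ → Par d) (N : ℕ) : Measure (Par d) :=
  ∑ j ∈ Finset.range N, ENNReal.ofReal (N : ℝ)⁻¹ • Measure.dirac (p (j + 1))

theorem isProbabilityMeasure_chainPrior (p : ℕ → Par d) {N : ℕ} (hN : 0 < N) :
    IsProbabilityMeasure (chainPrior p N) := by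
  constructor
  have h0 : (0 : ℝ) < N := by exact_mod_cast hN
  simp only [chainPrior, Measure.finsetSum_apply, Measure.smul_apply, measure_univ, smul_eq_mul,
    mul_one, Finset.sum_const, Finset.card_range, nsmul_eq_mul]
  rw [← ENNReal.ofReal_natCast, ← ENNReal.ofReal_mul h0.le, mul_inv_cancel₀ h0.ne',
    ENNReal.ofReal_one]

theorem lintegral_chainPrior (p : ℕ → Par d) (N : ℕ) {F : Par d → ℝ≥0∞} (hF : Measurable F) :
    ∫⁻ t, F t ∂(chainPrior p N) =
      ∑ j ∈ Finset.range N, ENNReal.ofReal (N : ℝ)⁻¹ * F (p (j + 1)) := by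
  rw [chainPrior, lintegral_finsetSum_measure]
  refine Finset.sum_congr rfl fun j _ => ?_
  rw [lintegral_smul_measure, lintegral_dirac' _ hF, smul_eq_mul]

theorem integral_chainPrior (p : ℕ → Par d) (N : ℕ) {F : Par d → ℝ} :
    ∫ t, F t ∂(chainPrior p N) = ∑ j ∈ Finset.range N, (N : ℝ)⁻¹ * F (p (j + 1)) := by
  rw [chainPrior, integral_finsetSum_measure]
  · refine Finset.sum_congr rfl fun j _ => ?_
    rw [integral_smul_measure, integral_dirac, ENNReal.toReal_ofReal (by positivity), smul_eq_mul]
  · intro j _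
    exact (integrable_dirac (by simp)).smul_measure (by simp)

theorem mixture_chainPrior (hκ : Measurable κ) [∀ t, IsProbabilityMeasure (κ t)]
    (p : ℕ → Par d) (N : ℕ) (h : Par d) :
    mixture κ (chainPrior p N) h = ∑ j ∈ Finset.range N,
      ENNReal.ofReal (N : ℝ)⁻¹ • (κ (p (j + 1))).prod (Measure.dirac (p (j + 1) - h)) := by
  refine Measure.ext_of_lintegral _ fun F hF => ?_
  have hm : Measurable fun t => ∫⁻ x, F (x, t - h) ∂(κ t) := by
    let k : ProbabilityTheory.Kernel (Par d) Ω := ⟨κ, hκ⟩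
    have : ProbabilityTheory.IsMarkovKernel k := ⟨fun t => inferInstanceAs (IsProbabilityMeasure (κ t))⟩
    exact Measurable.lintegral_kernel_prod_right (κ := k) (f := fun t x => F (x, t - h))
      (hF.comp (measurable_snd.prodMk (measurable_fst.sub_const h)))
  rw [lintegral_mixture hκ _ h hF, lintegral_chainPrior _ _ hm, lintegral_finsetSum_measure]
  refine Finset.sum_congr rfl fun j _ => ?_
  rw [lintegral_smul_measure, smul_eq_mul, lintegral_prod _ hF.aemeasurable]
  congr 1
  refine lintegral_congr fun x => ?_
  exact (lintegral_dirac' _ (hF.comp measurable_prodMk_left)).symm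

/-- Both mixtures are sums of atoms in the parameter coordinate, at p 1, …, p (m+1) for 𝙿_0 and at p
0, …, p m for 𝙿_h. At each of the m common atoms the data laws belong to neighbouring points of the
chain; the two remaining atoms contribute their total mass. -/
theorem hellingerSq_mixture_chainPrior_le (hκ : Measurable κ) [∀ t, IsProbabilityMeasure (κ t)]
    (p : ℕ → Par d) (h : Par d) (hp : ∀ j, p (j + 1) - h = p j) (m : ℕ) {H : ℕ → ℝ}
    (hH0 : ∀ j, 0 ≤ H j)
    (hH : ∀ j, hellingerSq (κ (p (j + 1))) (κ (p (j + 2))) ≤ ENNReal.ofReal (H j)) :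
    hellingerSq (mixture κ (chainPrior p (m + 1)) 0) (mixture κ (chainPrior p (m + 1)) h) ≤
      ENNReal.ofReal (((m + 1 : ℕ) : ℝ)⁻¹ * (∑ j ∈ Finset.range m, H j + 2)) := by
  set w : ℝ := ((m + 1 : ℕ) : ℝ)⁻¹ with hw
  have hw0 : 0 ≤ w := by positivity
  let A : ℕ → Measure (Ω × Par d) := fun j =>
    ENNReal.ofReal w • (κ (p (j + 1))).prod (Measure.dirac (p (j + 1)))
  -- The atoms of the shifted mixture are rotated by one place so that, for j < m, `A j` and `B j`
  -- sit over the same point p (j+1). The last index pairs the unmatched atoms over p (m+1) and p 0.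
  let B : ℕ → Measure (Ω × Par d) := fun j => if j < m then
    ENNReal.ofReal w • (κ (p (j + 2))).prod (Measure.dirac (p (j + 1))) else
    ENNReal.ofReal w • (κ (p 1)).prod (Measure.dirac (p 0))
  have hA : ∀ j, IsFiniteMeasure (A j) := fun j => Measure.smul_finite _ (by simp)
  have hB : ∀ j, IsFiniteMeasure (B j) := fun j => by
    by_cases hj : j < m <;> simp only [B, hj, if_true, if_false] <;>
      exact Measure.smul_finite _ (by simp)
  have e0 : mixture κ (chainPrior p (m + 1)) 0 = ∑ j ∈ Finset.range (m + 1), A j := by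
    rw [mixture_chainPrior hκ]
    simp only [sub_zero]; rfl
  have e1 : mixture κ (chainPrior p (m + 1)) h = ∑ j ∈ Finset.range (m + 1), B j := by
    rw [mixture_chainPrior hκ, Finset.sum_range_succ', Finset.sum_range_succ B]
    congr 1
    · refine Finset.sum_congr rfl fun j hj => ?_
      simp only [B, Finset.mem_range.1 hj, if_true, hp]; rfl
    · simp only [B, lt_irrefl, if_false, zero_add, hp]; rfl
  rw [e0, e1]
  refine (hellingerSq_sum_le (m + 1) A B).trans ?_
  rw [Finset.sum_range_succ, mul_add, ENNReal.ofReal_add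
    (mul_nonneg hw0 (Finset.sum_nonneg fun _ _ => hH0 _)) (by positivity)]
  refine add_le_add ?_ ?_
  · rw [Finset.mul_sum, ENNReal.ofReal_sum_of_nonneg fun j _ => mul_nonneg hw0 (hH0 j)]
    refine Finset.sum_le_sum fun j hj => ?_
    simp only [A, B, Finset.mem_range.1 hj, if_true]
    rw [hellingerSq_smul_prod_dirac _ _ hw0, ENNReal.ofReal_mul hw0]
    gcongr
    exact hH j
  · refine (hellingerSq_le_add _ _).trans ?_
    simp only [A, B, lt_irrefl, if_false, Measure.smul_apply, measure_univ, smul_eq_mul, mul_one]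
    rw [← ENNReal.ofReal_add hw0 hw0, mul_two]

/-- The mean shift of ψ telescopes along the chain, whereas the subtracted term keeps the average of
the squared one-step increments. -/
theorem le_hellingerMixtureBound_chain (hκ : Measurable κ) [∀ t, IsProbabilityMeasure (κ t)]
    {ψ : Par d → ℝ} (hψ : Measurable ψ)
    (p : ℕ → Par d) (h : Par d) (hp : ∀ j, p (j + 1) - h = p j) (m : ℕ) {H : ℕ → ℝ}
    (hH0 : ∀ j, 0 ≤ H j)
    (hH : ∀ j, hellingerSq (κ (p (j + 1))) (κ (p (j + 2))) ≤ ENNReal.ofReal (H j)) :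
    ENNReal.ofReal (√((((m + 1 : ℕ) : ℝ)⁻¹ * (ψ (p (m + 1)) - ψ (p 0))) ^ 2 /
        (4 * (((m + 1 : ℕ) : ℝ)⁻¹ * (∑ j ∈ Finset.range m, H j + 2)))) -
      √(((m + 1 : ℕ) : ℝ)⁻¹ * ∑ j ∈ Finset.range (m + 1), (ψ (p (j + 1)) - ψ (p j)) ^ 2)) ^ 2 ≤
      hellingerMixtureBound κ ψ := by
  set w : ℝ := ((m + 1 : ℕ) : ℝ)⁻¹ with hw
  have hw0 : 0 < w := by positivity
  have hQ := isProbabilityMeasure_chainPrior p (Nat.succ_pos m)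
  refine le_trans ?_ (le_iSup₂_of_le (⟨chainPrior p (m + 1), hQ⟩ : ProbabilityMeasure (Par d)) h
    le_rfl)
  simp only [ProbabilityMeasure.coe_mk]
  have hHH := hellingerSq_mixture_chainPrior_le hκ p h hp m hH0 hH
  rw [← hw] at hHH
  set S := w * (∑ j ∈ Finset.range m, H j + 2) with hS
  have hS0 : 0 < S := by
    have := Finset.sum_nonneg fun j (_ : j ∈ Finset.range m) => hH0 j
    positivity
  have e1 : meanShiftSq ψ (chainPrior p (m + 1)) h =
      ENNReal.ofReal ((w * (ψ (p (m + 1)) - ψ (p 0))) ^ 2) := by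
    rw [meanShiftSq, integral_chainPrior, ← Finset.mul_sum]
    simp only [hp]
    rw [Finset.sum_range_sub fun j => ψ (p j)]
  have e2 : shiftB ψ (chainPrior p (m + 1)) h =
      ENNReal.ofReal (w * ∑ j ∈ Finset.range (m + 1), (ψ (p (j + 1)) - ψ (p j)) ^ 2) := by
    have hm : Measurable fun t => ENNReal.ofReal ((ψ t - ψ (t - h)) ^ 2) :=
      ((hψ.sub (hψ.comp (measurable_id.sub_const h))).pow_const 2).ennreal_ofReal
    rw [shiftB, lintegral_chainPrior _ _ hm, Finset.mul_sum,
      ENNReal.ofReal_sum_of_nonneg fun j _ => mul_nonneg hw0.le (sq_nonneg _)]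
    refine Finset.sum_congr rfl fun j _ => ?_
    rw [hp, ENNReal.ofReal_mul hw0.le]
  rw [e1, e2]
  gcongr
  rw [ENNReal.ofReal_sub _ (Real.sqrt_nonneg _), Real.sqrt_eq_rpow, Real.sqrt_eq_rpow,
    ← ENNReal.ofReal_rpow_of_nonneg (by positivity) (by norm_num),
    ← ENNReal.ofReal_rpow_of_nonneg
      (mul_nonneg hw0.le (Finset.sum_nonneg fun _ _ => sq_nonneg _)) (by norm_num),
    ENNReal.ofReal_div_of_pos (by positivity), ENNReal.ofReal_mul (by norm_num)]
  gcongr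
  simp

end Chain

end LAM

namespace LAM

variable {d : ℕ} {𝒳 : Type*} [MeasurableSpace 𝒳]

/-! ### Asymptotics of the mixture bounds -/

theorem tendsto_localRadius (c : ℝ) : Tendsto (fun n : ℕ => c / √(n : ℝ)) atTop (𝓝 0) :=
  (Real.tendsto_sqrt_atTop.comp tendsto_natCast_atTop_atTop).const_div_atTop c

theorem eventually_localBall_subset {θ₀ : Par d} {U : Set (Par d)} (hU : U ∈ 𝓝 θ₀) (c : ℝ) :
    ∀ᶠ n : ℕ in atTop, localBall θ₀ c n ⊆ U := by
  obtain ⟨r, hr, hrU⟩ := Metric.mem_nhds_iff.1 hU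
  filter_upwards [(tendsto_localRadius c).eventually (gt_mem_nhds hr)] with n hn
  exact (Metric.ball_subset_ball hn.le).trans hrU

theorem measurable_comp_of_continuousOn {ψ : Par d → ℝ} {S : Set (Par d)} (hψ : ContinuousOn ψ S)
    {φ : Par d → Par d} (hφ : Continuous φ) (hφS : ∀ t, φ t ∈ S) : Measurable fun t => ψ (φ t) :=
  (hψ.comp_continuous hφ hφS).measurable

theorem arctanHellingerBound_le (P : Par d → Measure 𝒳) (ψ : Par d → ℝ) (n : ℕ) (θ₀ : Par d)
    {r : ℝ} (hr : 0 < r) :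
    arctanHellingerBound P ψ n θ₀ r ≤ hellingerBound P ψ n (Metric.ball θ₀ r) :=
  iSup₂_le fun _ hγ => le_iSup₂_of_le _ (isDiffeoOnto_arctanMap θ₀ hr hγ) le_rfl

/-- The value of the Hellinger mixture bound along a chain of `m + 2` points. -/
noncomputable def chainValue (m : ℕ) (A : ℝ) (H D : ℕ → ℝ) : ℝ :=
  √((((m + 1 : ℕ) : ℝ)⁻¹ * A) ^ 2 / (4 * (((m + 1 : ℕ) : ℝ)⁻¹ * (∑ j ∈ Finset.range m, H j + 2)))) -
    √(((m + 1 : ℕ) : ℝ)⁻¹ * ∑ j ∈ Finset.range (m + 1), D j ^ 2)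

/-- The contribution 2 of the unmatched atoms keeps the denominator away from 0, so the value is
continuous in its data. -/
theorem tendsto_chainValue {ι : Type*} {l : Filter ι} (m : ℕ) {A : ι → ℝ} {H D : ι → ℕ → ℝ}
    {A' : ℝ} {H' D' : ℕ → ℝ} (hA : Tendsto A l (𝓝 A'))
    (hH : ∀ j, Tendsto (fun i => H i j) l (𝓝 (H' j)))
    (hD : ∀ j, Tendsto (fun i => D i j) l (𝓝 (D' j))) (hH' : ∀ j, 0 ≤ H' j) :
    Tendsto (fun i => chainValue m (A i) (H i) (D i)) l (𝓝 (chainValue m A' H' D')) := by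
  have hden : 4 * (((m + 1 : ℕ) : ℝ)⁻¹ * (∑ j ∈ Finset.range m, H' j + 2)) ≠ 0 := by
    have := Finset.sum_nonneg fun j (_ : j ∈ Finset.range m) => hH' j
    positivity
  have h1 : Tendsto (fun i => ∑ j ∈ Finset.range m, H i j) l (𝓝 (∑ j ∈ Finset.range m, H' j)) :=
    tendsto_finsetSum _ fun j _ => hH j
  have h2 : Tendsto (fun i => ∑ j ∈ Finset.range (m + 1), D i j ^ 2) l
      (𝓝 (∑ j ∈ Finset.range (m + 1), D' j ^ 2)) :=
    tendsto_finsetSum _ fun j _ => (hD j).pow 2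
  have h3 := (((h1.add_const 2).const_mul ((m + 1 : ℕ) : ℝ)⁻¹).const_mul 4)
  exact (((hA.const_mul _).pow 2).div h3 hden).sqrt.sub (h2.const_mul _).sqrt

section Model

variable {ν : Measure 𝒳} [SigmaFinite ν] {P : Par d → Measure 𝒳} {Θ : Set (Par d)}
  {ξ : Par d → 𝒳 → Par d} (M : IsHellingerModel ν P Θ ξ) {ψ : Par d → ℝ} {θ₀ : Par d}
include M

theorem IsHellingerModel.chiSqBound_le {n : ℕ} {S : Set (Par d)} (hS : S ⊆ interior Θ)
    (hψ : ContinuousOn ψ S) {K : ℝ} (hK : ∀ θ ∈ S, |ψ θ| ≤ K) :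
    chiSqBound P ψ n S ≤ minimaxRisk P ψ n S := by
  refine le_minimaxRisk_of_bounded hK fun T hT hTK => iSup₂_le fun φ hφ => ?_
  obtain ⟨hd, hr, -⟩ := hφ
  have hφS : ∀ t, φ t ∈ S := fun t => hr ▸ Set.mem_range_self t
  have hp : ∀ t, IsProbabilityMeasure (iidLaw P n (φ t)) := fun t =>
    M.isProbabilityMeasure_iidLaw (interior_subset (hS (hφS t))) n
  refine chiSqMixtureBound_le (M.measurable_iidLaw_comp hd.continuous (fun t => hS (hφS t)) n)
    (measurable_comp_of_continuousOn hψ hd.continuous hφS) (fun t => hK _ (hφS t)) hT hTK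
    fun t => ?_
  exact le_iSup₂_of_le (φ t) (hφS t) le_rfl

theorem IsHellingerModel.hellingerBound_le {n : ℕ} {S : Set (Par d)} (hS : S ⊆ interior Θ) :
    hellingerBound P ψ n S ≤ chiSqBound P ψ n S := by
  refine iSup₂_mono fun φ hφ => ?_
  obtain ⟨hd, hr, -⟩ := hφ
  have hφS : ∀ t, φ t ∈ S := fun t => hr ▸ Set.mem_range_self t
  have hp : ∀ t, IsProbabilityMeasure (iidLaw P n (φ t)) := fun t =>
    M.isProbabilityMeasure_iidLaw (interior_subset (hS (hφS t))) n
  exact hellingerMixtureBound_le_chiSqMixtureBound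
    (M.measurable_iidLaw_comp hd.continuous (fun t => hS (hφS t)) n) _

/-- The finite sample value of the Hellinger mixture bound along a chain of localized points. -/
theorem IsHellingerModel.le_arctanHellingerBound {n : ℕ} (hn : 0 < n) {c : ℝ} (hc : 0 < c)
    (hS : localBall θ₀ c n ⊆ interior Θ) (hψ : ContinuousOn ψ (localBall θ₀ c n))
    (h : Par d) (m : ℕ) (τ : ℕ → Par d)
    (hτ : ∀ j : ℕ, τ j = radial (arctanProfile c (2 * c / Real.pi)) (((j : ℝ) - 1) • h)) :
    ENNReal.ofReal (chainValue m (√n * (ψ (θ₀ + (√n)⁻¹ • τ (m + 1)) - ψ (θ₀ + (√n)⁻¹ • τ 0)))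
      (fun j => n * hsq ν P (θ₀ + (√n)⁻¹ • τ (j + 1)) (θ₀ + (√n)⁻¹ • τ (j + 2)))
      fun j => √n * (ψ (θ₀ + (√n)⁻¹ • τ (j + 1)) - ψ (θ₀ + (√n)⁻¹ • τ j))) ^ 2 ≤
      n * arctanHellingerBound P ψ n θ₀ (c / √n) := by
  have hn0 : (0 : ℝ) < n := by exact_mod_cast hn
  have hsn : 0 < √(n : ℝ) := Real.sqrt_pos.2 hn0
  set γ := 2 * c / Real.pi with hγ
  have hγ0 : 0 < γ := by have := Real.pi_pos; positivity
  set φ : Par d → Par d := arctanMap θ₀ (c / √n) γ with hφ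
  obtain ⟨hd, hr, -⟩ := isDiffeoOnto_arctanMap θ₀ (div_pos hc hsn) hγ0
  have hφS : ∀ t, φ t ∈ localBall θ₀ c n := fun t => by
    rw [localBall, ← hr]; exact Set.mem_range_self t
  have hp : ∀ t, IsProbabilityMeasure (iidLaw P n (φ t)) := fun t =>
    M.isProbabilityMeasure_iidLaw (interior_subset (hS (hφS t))) n
  -- Offset by one so that the prior is carried by 0, h, …, m h and the extra point p 0 is -h.
  set p : ℕ → Par d := fun j => ((j : ℝ) - 1) • h with hpdef
  have hφp : ∀ j, φ (p j) = θ₀ + (√(n : ℝ))⁻¹ • τ j := fun j => by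
    rw [hφ, arctanMap_scaled, hτ]
  have key := le_hellingerMixtureBound_chain (κ := fun t => iidLaw P n (φ t))
    (ψ := fun t => ψ (φ t))
    (M.measurable_iidLaw_comp hd.continuous (fun t => hS (hφS t)) n)
    (measurable_comp_of_continuousOn hψ hd.continuous hφS) p h
    (fun j => by
      simp only [hpdef]
      push_cast
      rw [sub_eq_iff_eq_add, show (j : ℝ) + 1 - 1 = (j - 1) + 1 by ring, add_smul, one_smul]) m
    (H := fun j => n * hsq ν P (φ (p (j + 1))) (φ (p (j + 2))))
    (fun j => mul_nonneg hn0.le (hsq_nonneg _ _ _ _))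
    (fun j => M.hellingerSq_iid_le (interior_subset (hS (hφS _))) (interior_subset (hS (hφS _))) n)
  simp only [hφp] at key
  refine le_trans (le_of_eq ?_) (mul_le_mul_right (key.trans
    (le_iSup₂_of_le (f := fun γ (_ : γ ∈ Set.Ioi (0 : ℝ)) => hellingerMixtureBound
      (fun t => iidLaw P n (arctanMap θ₀ (c / √n) γ t)) (fun t => ψ (arctanMap θ₀ (c / √n) γ t)))
      γ hγ0 le_rfl)) (n : ℝ≥0∞))
  -- The factor n enters both square roots, where it localizes the increments of ψ; the remaining
  -- powers of √n have been moved into the one-sample Hellinger distances.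
  have e1 : ∀ x : ℝ, (n : ℝ≥0∞) * ENNReal.ofReal x ^ 2 = ENNReal.ofReal (√n * x) ^ 2 := fun x => by
    rw [ENNReal.ofReal_mul hsn.le, mul_pow, ← ENNReal.ofReal_pow hsn.le, Real.sq_sqrt hn0.le,
      ENNReal.ofReal_natCast]
  rw [e1, chainValue, mul_sub (√(n : ℝ)) (√_) (√_), ← Real.sqrt_mul hn0.le, ← Real.sqrt_mul hn0.le]
  congr 4
  · rw [← mul_div_assoc]
    congr 2
    rw [mul_left_comm, mul_pow (√(n : ℝ)), Real.sq_sqrt hn0.le]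
  · rw [mul_left_comm (n : ℝ)]
    congr 2
    rw [Finset.mul_sum _ _ (n : ℝ)]
    refine Finset.sum_congr rfl fun j _ => ?_
    rw [mul_pow, Real.sq_sqrt hn0.le]

/-- The parameters are chosen from the outside inwards: first the step s, with √V - sV > √v, then
the chain length, then c, for which the arctangent map is nearly the identity on the finitely many
chain points, and finally n. -/
theorem IsHellingerModel.le_localLiminf_arctan (h₀ : θ₀ ∈ interior Θ)
    (hI : (fisherInfo ν (ξ θ₀)).PosDef) (hψ : ∀ᶠ t in 𝓝 θ₀, DifferentiableAt ℝ ψ t) :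
    ENNReal.ofReal (lamConst ψ θ₀ (fisherInfo ν (ξ θ₀))) ≤
      localLiminf fun c n => arctanHellingerBound P ψ n θ₀ (c / √(n : ℝ)) := by
  have h₀Θ := interior_subset h₀
  set V := lamConst ψ θ₀ (fisherInfo ν (ξ θ₀)) with hV
  refine le_localLiminf fun v hv hvV => ?_
  have hV0 : 0 < V := hv.trans_lt hvV
  have hsV := Real.sqrt_pos.2 hV0
  have hvV' : √v < √V := Real.sqrt_lt_sqrt hv hvV
  -- the step size
  obtain ⟨s, hs0, hs⟩ : ∃ s, 0 < s ∧ √v < √V - s * V := by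
    refine ⟨(√V - √v) / (2 * V), by
      have : 0 < √V - √v := by linarith
      positivity, ?_⟩
    rw [div_mul_eq_mul_div, mul_div_mul_right _ _ hV0.ne']
    linarith
  set h : Par d := s • effDir ψ θ₀ (fisherInfo ν (ξ θ₀)) with hh
  set g := gradient ψ θ₀ with hg
  let q : Par d → ℝ := fun x => ∫ y, inner ℝ x (ξ θ₀ y) ^ 2 ∂ν
  have hqc : Continuous q := M.continuous_quadratic h₀Θ
  have hgh : inner ℝ g h = s * V := by rw [hh, real_inner_smul_right, inner_gradient_effDir]
  have hqh : q h = s ^ 2 * V / 4 := by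
    have h1 := M.quadratic_effDir (ψ := ψ) h₀Θ hI
    rw [← hV] at h1
    simp only [q, hh, real_inner_smul_left, mul_pow]
    have h2 : ∫ y, inner ℝ (effDir ψ θ₀ (fisherInfo ν (ξ θ₀))) (ξ θ₀ y) ^ 2 ∂ν = V / 4 := by
      linarith
    rw [integral_const_mul, h2]; ring
  have hqneg : q (-h) = q h := by simp [q]
  -- the limit in `n`, as a function of the localized points
  let Λ : ℕ → (ℕ → Par d) → ℝ := fun m τ => chainValue m (inner ℝ g (τ (m + 1) - τ 0))
    (fun j => q (τ (j + 1) - τ (j + 2))) fun j => inner ℝ g (τ (j + 1) - τ j)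
  let p : ℕ → Par d := fun j => ((j : ℝ) - 1) • h
  have hpj : ∀ j, p (j + 1) - p j = h := fun j => by
    simp only [p]; push_cast; rw [← sub_smul]; simp
  have hΛp : ∀ m, Λ m p = √((s * V) ^ 2 / (4 * (((m + 1 : ℕ) : ℝ)⁻¹ * (m * q h + 2)))) - s * V := by
    intro m
    have h1 : p (m + 1) - p 0 = ((m + 1 : ℕ) : ℝ) • h := by
      simp only [p]; push_cast; rw [← sub_smul]; congr 1; ring
    have h2 : ∀ j, p (j + 1) - p (j + 2) = -h := fun j => by rw [← hpj (j + 1)]; abel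
    have h3 : ((m + 1 : ℕ) : ℝ) ≠ 0 := by positivity
    simp only [Λ, chainValue]
    rw [h1, real_inner_smul_right, hgh]
    simp only [h2, hpj, hqneg, hgh, Finset.sum_const, Finset.card_range, nsmul_eq_mul]
    rw [inv_mul_cancel_left₀ h3, inv_mul_cancel_left₀ h3, Real.sqrt_sq (by positivity)]
  -- As m → ∞ the end atoms become negligible and the average distance tends to q(h) = s²V/4, so the
  -- leading term is sV / (s√V) = √V. The loss sV is the size of a single increment.
  have hlim1 : Tendsto (fun m => Λ m p) atTop (𝓝 (√V - s * V)) := by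
    have h1 : Tendsto (fun m : ℕ => 1 / ((m : ℝ) + 1)) atTop (𝓝 0) :=
      tendsto_one_div_add_atTop_nhds_zero_nat
    have h2 : Tendsto (fun m : ℕ => ((m + 1 : ℕ) : ℝ)⁻¹ * (m * q h + 2)) atTop (𝓝 (q h)) := by
      have h3 := (h1.mul_const (2 - q h)).const_add (q h)
      rw [zero_mul, add_zero] at h3
      refine h3.congr fun m => ?_
      push_cast
      field_simp
      ring
    have hq0 : 4 * q h ≠ 0 := by rw [hqh]; positivity
    have h4 := (((h2.const_mul 4).inv₀ hq0).const_mul ((s * V) ^ 2)).sqrt.sub_const (s * V)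
    have e : √((s * V) ^ 2 * (4 * q h)⁻¹) = √V := by
      rw [hqh]; congr 1; field_simp
    rw [e] at h4
    refine h4.congr fun m => ?_
    rw [hΛp, div_eq_mul_inv]
  obtain ⟨m, hm⟩ := (hlim1.eventually (lt_mem_nhds hs)).exists
  -- the limit in `c`
  let τ : ℝ → ℕ → Par d := fun c j => radial (arctanProfile c (2 * c / Real.pi)) (p j)
  have hτ : ∀ j, Tendsto (fun c => τ c j) atTop (𝓝 (p j)) := fun j =>
    tendsto_radial_arctanProfile _
  have hq0 : ∀ x, 0 ≤ q x := fun x => integral_nonneg fun _ => sq_nonneg _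
  have hlim2 : Tendsto (fun c => Λ m (τ c)) atTop (𝓝 (Λ m p)) := by
    have hin : ∀ i j, Tendsto (fun c => inner ℝ g (τ c i - τ c j)) atTop
        (𝓝 (inner ℝ g (p i - p j))) := fun i j =>
      tendsto_const_nhds.inner ((hτ i).sub (hτ j))
    exact tendsto_chainValue m (hin _ _)
      (fun j => (hqc.tendsto _).comp ((hτ (j + 1)).sub (hτ (j + 2)))) (fun j => hin _ _)
      fun j => hq0 _
  filter_upwards [hlim2.eventually (lt_mem_nhds hm), eventually_gt_atTop 0] with c hcv hc
  -- the limit in `n`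
  have hψ0 := hψ.self_of_nhds
  have hlim3 := tendsto_chainValue m (tendsto_gradient_scaled hψ0 (τ c (m + 1)) (τ c 0))
    (fun j => M.tendsto_hsq_scaled h₀ (τ c (j + 1)) (τ c (j + 2)))
    (fun j => tendsto_gradient_scaled hψ0 (τ c (j + 1)) (τ c j)) fun j => hq0 _
  have hcont : ∀ᶠ n : ℕ in atTop, ContinuousOn ψ (localBall θ₀ c n) := by
    filter_upwards [eventually_localBall_subset hψ c] with n hn t ht
    exact (hn ht : DifferentiableAt ℝ ψ t).continuousAt.continuousWithinAt
  filter_upwards [hlim3.eventually (lt_mem_nhds hcv), hcont, eventually_gt_atTop 0,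
    eventually_localBall_subset (isOpen_interior.mem_nhds h₀) c] with n hn hnψ hn0 hnΘ
  refine le_trans ?_ (M.le_arctanHellingerBound hn0 hc hnΘ hnψ h m (τ c) fun j => rfl)
  have h1 := ENNReal.ofReal_le_ofReal hn.le
  calc ENNReal.ofReal v = ENNReal.ofReal √v ^ 2 := by
        rw [← ENNReal.ofReal_pow (Real.sqrt_nonneg _), Real.sq_sqrt hv]
    _ ≤ _ := by gcongr

end Model

end LAM

namespace LAM

/-! ### Absolutely continuous functions of one variable -/

theorem AbsolutelyContinuousOnInterval.comp_lipschitzWith {f g : ℝ → ℝ} {a b : ℝ} {K : NNReal}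
    (hf : AbsolutelyContinuousOnInterval f a b) (hg : LipschitzWith K g) :
    AbsolutelyContinuousOnInterval (fun s => g (f s)) a b := by
  refine squeeze_zero (fun t => Finset.sum_nonneg fun i _ => dist_nonneg) (fun t => ?_)
    (by simpa using Tendsto.const_mul (K : ℝ) hf)
  rw [Finset.mul_sum]
  exact Finset.sum_le_sum fun i _ => hg.dist_le_mul _ _

theorem AbsolutelyContinuousOnInterval.comp_affine {f : ℝ → ℝ} {k l a b : ℝ} (hk : 0 < k)
    (hf : AbsolutelyContinuousOnInterval f (k * a + l) (k * b + l)) :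
    AbsolutelyContinuousOnInterval (fun s => f (k * s + l)) a b := by
  rw [absolutelyContinuousOnInterval_iff] at hf ⊢
  intro ε hε
  obtain ⟨δ, hδ, h⟩ := hf ε hε
  refine ⟨δ / k, by positivity, fun E hE hEδ => ?_⟩
  have hmem : ∀ {s x y : ℝ}, s ∈ Set.uIcc x y → k * s + l ∈ Set.uIcc (k * x + l) (k * y + l) := by
    intro s x y hs
    rcases Set.mem_uIcc.1 hs with h | h
    · exact Set.mem_uIcc.2 (Or.inl ⟨by nlinarith [h.1], by nlinarith [h.2]⟩)
    · exact Set.mem_uIcc.2 (Or.inr ⟨by nlinarith [h.1], by nlinarith [h.2]⟩)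
  have hmem' : ∀ {z x y : ℝ}, z ∈ Set.uIoc (k * x + l) (k * y + l) → (z - l) / k ∈ Set.uIoc x y := by
    intro z x y hz
    rcases Set.mem_uIoc.1 hz with h | h
    · exact Set.mem_uIoc.2 (Or.inl ⟨by rw [lt_div_iff₀ hk]; linarith [h.1],
        by rw [div_le_iff₀ hk]; linarith [h.2]⟩)
    · exact Set.mem_uIoc.2 (Or.inr ⟨by rw [lt_div_iff₀ hk]; linarith [h.1],
        by rw [div_le_iff₀ hk]; linarith [h.2]⟩)
  refine h (E.1, fun i => (k * (E.2 i).1 + l, k * (E.2 i).2 + l))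
    ⟨fun i hi => ⟨hmem (hE.1 i hi).1, hmem (hE.1 i hi).2⟩, fun i hi j hj hij => ?_⟩ ?_
  · refine Set.disjoint_left.2 fun z hz hz' => ?_
    exact Set.disjoint_left.1 (hE.2 hi hj hij) (hmem' hz) (hmem' hz')
  · have e : ∀ i, dist (k * (E.2 i).1 + l) (k * (E.2 i).2 + l) = k * dist (E.2 i).1 (E.2 i).2 := by
      intro i
      rw [dist_add_right, Real.dist_eq, Real.dist_eq, ← mul_sub, abs_mul, abs_of_pos hk]
    simp only [e, ← Finset.mul_sum]
    rwa [lt_div_iff₀' hk] at hEδ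

/-- A continuously differentiable approximation of `x ↦ x` on `(0, ∞)` that vanishes up to `ε`. -/
noncomputable def softThreshold (ε x : ℝ) : ℝ := if ε < x then (x - ε) ^ 2 / x else 0

/-- The derivative of `softThreshold ε`. -/
noncomputable def softThresholdDeriv (ε x : ℝ) : ℝ := if ε < x then 1 - (ε / x) ^ 2 else 0

/-- The function meets 0 quadratically at x = ε, so the two pieces join differentiably. -/
theorem hasDerivAt_softThreshold {ε : ℝ} (hε : 0 < ε) (x : ℝ) :
    HasDerivAt (softThreshold ε) (softThresholdDeriv ε x) x := by
  rcases lt_trichotomy x ε with h | h | h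
  · rw [softThresholdDeriv, if_neg h.le.not_gt]
    refine (hasDerivAt_const x (0 : ℝ)).congr_of_eventuallyEq ?_
    filter_upwards [gt_mem_nhds h] with y hy
    rw [softThreshold, if_neg (not_lt.2 (le_of_lt hy))]
  · subst h
    rw [softThresholdDeriv, if_neg (lt_irrefl _), hasDerivAt_iff_isLittleO]
    have h1 : (fun y => softThreshold x y - softThreshold x x - (y - x) • (0 : ℝ)) =O[𝓝 x]
        fun y => (y - x) ^ 2 := by
      refine IsBigO.of_bound (1 / x) (Eventually.of_forall fun y => ?_)
      simp only [softThreshold, lt_irrefl, if_false, smul_zero, sub_zero, norm_pow]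
      split_ifs with hy
      · have hy0 : 0 < y := hε.trans hy
        rw [norm_div, norm_pow, Real.norm_of_nonneg hy0.le, div_eq_mul_inv, mul_comm, one_div]
        gcongr
      · simp; positivity
    refine h1.trans_isLittleO ?_
    have h2 : Tendsto (fun y : ℝ => y - x) (𝓝 x) (𝓝 0) := by
      have : Continuous fun y : ℝ => y - x := by fun_prop
      simpa using this.tendsto x
    exact ((isLittleO_pow_id (𝕜 := ℝ) one_lt_two).comp_tendsto h2)
  · rw [softThresholdDeriv, if_pos h]
    have hx : x ≠ 0 := (hε.trans h).ne'
    have h1 : HasDerivAt (fun y : ℝ => (y - ε) ^ 2 / y) (1 - (ε / x) ^ 2) x := by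
      convert! ((((hasDerivAt_id x).sub_const ε).pow 2).div (hasDerivAt_id x) hx) using 1
      simp only [id, Pi.pow_apply]
      field_simp
      push_cast
      ring
    refine h1.congr_of_eventuallyEq ?_
    filter_upwards [lt_mem_nhds h] with y hy
    rw [softThreshold, if_pos hy]

theorem softThresholdDeriv_nonneg {ε : ℝ} (hε : 0 < ε) (x : ℝ) : 0 ≤ softThresholdDeriv ε x := by
  unfold softThresholdDeriv
  split_ifs with h
  · have hx := hε.trans h
    have : (ε / x) ^ 2 ≤ 1 := pow_le_one₀ (by positivity) ((div_le_one hx).2 h.le)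
    linarith
  · exact le_rfl

theorem softThresholdDeriv_le_one (ε x : ℝ) : softThresholdDeriv ε x ≤ 1 := by
  unfold softThresholdDeriv
  split_ifs with h
  · nlinarith [sq_nonneg (ε / x)]
  · exact zero_le_one

theorem softThreshold_nonneg {ε : ℝ} (hε : 0 < ε) (x : ℝ) : 0 ≤ softThreshold ε x := by
  unfold softThreshold
  split_ifs with h
  · have hx := hε.trans h
    positivity
  · exact le_rfl

theorem softThreshold_le {ε x : ℝ} (hε : 0 < ε) (hx : 0 ≤ x) : softThreshold ε x ≤ x := by
  unfold softThreshold
  split_ifs with h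
  · rw [div_le_iff₀ (hε.trans h)]
    nlinarith
  · exact hx

theorem lipschitzWith_softThreshold {ε : ℝ} (hε : 0 < ε) : LipschitzWith 1 (softThreshold ε) := by
  refine lipschitzWith_of_nnnorm_deriv_le
    (fun x => (hasDerivAt_softThreshold hε x).differentiableAt) fun x => ?_
  rw [(hasDerivAt_softThreshold hε x).deriv, ← NNReal.coe_le_coe, coe_nnnorm,
    Real.norm_of_nonneg (softThresholdDeriv_nonneg hε x)]
  exact softThresholdDeriv_le_one ε x

theorem tendsto_softThreshold {x : ℝ} (hx : 0 ≤ x) {u : ℕ → ℝ} (hu : Tendsto u atTop (𝓝 0))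
    (hu0 : ∀ k, 0 < u k) : Tendsto (fun k => softThreshold (u k) x) atTop (𝓝 x) := by
  rcases hx.eq_or_lt with rfl | hx
  · refine tendsto_const_nhds.congr fun k => ?_
    rw [softThreshold, if_neg (hu0 k).le.not_gt]
  · have : Tendsto (fun k => (x - u k) ^ 2 / x) atTop (𝓝 ((x - 0) ^ 2 / x)) :=
      ((tendsto_const_nhds.sub hu).pow 2).div_const x
    have e : (x - 0) ^ 2 / x = x := by field_simp; ring
    rw [e] at this
    refine this.congr' ?_
    filter_upwards [hu.eventually (gt_mem_nhds hx)] with k hk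
    rw [softThreshold, if_pos hk]

theorem tendsto_softThresholdDeriv {x : ℝ} (hx : 0 < x) {u : ℕ → ℝ} (hu : Tendsto u atTop (𝓝 0)) :
    Tendsto (fun k => softThresholdDeriv (u k) x) atTop (𝓝 1) := by
  have : Tendsto (fun k => 1 - (u k / x) ^ 2) atTop (𝓝 (1 - (0 / x) ^ 2)) :=
    tendsto_const_nhds.sub ((hu.div_const x).pow 2)
  have e : 1 - (0 / x) ^ 2 = 1 := by simp
  rw [e] at this
  refine this.congr' ?_
  filter_upwards [hu.eventually (gt_mem_nhds hx)] with k hk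
  rw [softThresholdDeriv, if_pos hk]

theorem measurable_softThreshold {ε : ℝ} (hε : 0 < ε) : Measurable (softThreshold ε) :=
  (lipschitzWith_softThreshold hε).continuous.measurable

theorem measurable_softThresholdDeriv (ε : ℝ) : Measurable (softThresholdDeriv ε) :=
  Measurable.ite measurableSet_Ioi (by fun_prop) measurable_const

/-- The derivative of `(M - φ) · softThreshold ε ∘ Q`. -/
noncomputable def softProductDeriv (ε M φ Q M' φ' Q' : ℝ) : ℝ :=
  (M' - φ') * softThreshold ε Q + (M - φ) * (softThresholdDeriv ε Q * Q')

/-- M and φ are controlled only where Q > 0. Thresholding Q makes the product vanish identically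
near every point with Q < ε, so the fundamental theorem of calculus holds locally around every real
number and can be globalized. -/
theorem integral_softProductDeriv {M φ Q : ℝ → ℝ} (hQ : Continuous Q)
    (hloc : ∀ s, 0 < Q s → ∃ δ > 0, AbsolutelyContinuousOnInterval M (s - δ) (s + δ) ∧
      AbsolutelyContinuousOnInterval φ (s - δ) (s + δ) ∧
      AbsolutelyContinuousOnInterval Q (s - δ) (s + δ)) {ε : ℝ} (hε : 0 < ε) :
    (M 1 - φ 1) * softThreshold ε (Q 1) - (M 0 - φ 0) * softThreshold ε (Q 0) =
      ∫ s in (0 : ℝ)..1, softProductDeriv ε (M s) (φ s) (Q s) (deriv M s) (deriv φ s) (deriv Q s) := by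
  set w : ℝ → ℝ := fun s =>
    softProductDeriv ε (M s) (φ s) (Q s) (deriv M s) (deriv φ s) (deriv Q s) with hw
  set F : ℝ → ℝ := fun s => (M s - φ s) * softThreshold ε (Q s) with hF
  have key : ∀ s₀, ∃ δ > 0, IntervalIntegrable w volume (s₀ - δ) (s₀ + δ) ∧
      ∀ x ∈ Set.uIcc (s₀ - δ) (s₀ + δ), ∀ y ∈ Set.uIcc (s₀ - δ) (s₀ + δ),
        ∫ s in x..y, w s = F y - F x := by
    intro s₀
    -- Below level ε everything is zero nearby, by continuity of Q. At or above it Q is positive,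
    -- and local absolute continuity applies.
    rcases lt_or_ge (Q s₀) ε with h | h
    · obtain ⟨δ, hδ, hball⟩ := Metric.mem_nhds_iff.1 (hQ.continuousAt.eventually (gt_mem_nhds h))
      have hz : ∀ s ∈ Set.uIcc (s₀ - δ / 2) (s₀ + δ / 2), w s = 0 ∧ F s = 0 := by
        intro s hs
        rw [Set.uIcc_of_le (by linarith), ← Real.closedBall_eq_Icc] at hs
        have : Q s < ε := hball (Metric.closedBall_subset_ball (half_lt_self hδ) hs)
        simp [hw, hF, softProductDeriv, softThreshold, softThresholdDeriv, this.le.not_gt]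
      refine ⟨δ / 2, by positivity, ?_, fun x hx y hy => ?_⟩
      · refine (intervalIntegrable_const (c := (0 : ℝ))).congr fun s hs => ?_
        exact (hz s (Set.uIoc_subset_uIcc hs)).1.symm
      · rw [(hz x hx).2, (hz y hy).2, sub_zero]
        exact intervalIntegral.integral_zero_ae (Eventually.of_forall fun s hs =>
          (hz s (Set.uIcc_subset_uIcc hx hy (Set.uIoc_subset_uIcc hs))).1)
    · obtain ⟨δ, hδ, hM, hφ, hQa⟩ := hloc s₀ (hε.trans_le h)
      have hFa : AbsolutelyContinuousOnInterval F (s₀ - δ) (s₀ + δ) :=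
        (hM.fun_sub hφ).fun_mul (AbsolutelyContinuousOnInterval.comp_lipschitzWith hQa (lipschitzWith_softThreshold hε))
      have hFw : ∀ᵐ s, s ∈ Set.uIcc (s₀ - δ) (s₀ + δ) → deriv F s = w s := by
        filter_upwards [hM.ae_differentiableAt, hφ.ae_differentiableAt, hQa.ae_differentiableAt]
          with s h1 h2 h3 hs
        have := ((h1 hs).hasDerivAt.sub (h2 hs).hasDerivAt).mul
          ((hasDerivAt_softThreshold hε (Q s)).comp s (h3 hs).hasDerivAt)
        exact this.deriv
      refine ⟨δ, hδ, ?_, fun x hx y hy => ?_⟩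
      · refine hFa.intervalIntegrable_deriv.congr_ae ?_
        rw [EventuallyEq, ae_restrict_iff' measurableSet_uIoc]
        filter_upwards [hFw] with s hs hs' using hs (Set.uIoc_subset_uIcc hs')
      · rw [← (hFa.mono (Set.uIcc_subset_uIcc hx hy)).integral_deriv_eq_sub]
        refine intervalIntegral.integral_congr_ae ?_
        filter_upwards [hFw] with s hs hs'
        exact (hs (Set.uIcc_subset_uIcc hx hy (Set.uIoc_subset_uIcc hs'))).symm
  have hli : LocallyIntegrable w volume := fun s₀ => by
    obtain ⟨δ, hδ, hi, -⟩ := key s₀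
    refine ⟨Set.Ioc (s₀ - δ) (s₀ + δ), Ioc_mem_nhds (by linarith) (by linarith), ?_⟩
    exact (intervalIntegrable_iff_integrableOn_Ioc_of_le (by linarith)).1 hi
  have hii : ∀ x y, IntervalIntegrable w volume x y := fun x y =>
    (hli.integrableOn_isCompact isCompact_uIcc).intervalIntegrable
  -- The difference between F and the primitive of w is locally constant, hence constant.
  have hd : ∀ s₀, HasDerivAt (fun s => F s - ∫ u in (0 : ℝ)..s, w u) 0 s₀ := by
    intro s₀
    obtain ⟨δ, hδ, -, hft⟩ := key s₀
    refine (hasDerivAt_const s₀ (F s₀ - ∫ u in (0 : ℝ)..s₀, w u)).congr_of_eventuallyEq ?_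
    filter_upwards [Icc_mem_nhds (show s₀ - δ < s₀ by linarith) (show s₀ < s₀ + δ by linarith)]
      with s hs
    rw [← Set.uIcc_of_le (by linarith)] at hs
    have h1 := hft s₀ (by rw [Set.uIcc_of_le (by linarith)]; constructor <;> linarith) s hs
    rw [← intervalIntegral.integral_add_adjacent_intervals (hii 0 s₀) (hii s₀ s), h1]
    ring
  have := is_const_of_deriv_eq_zero (fun s => (hd s).differentiableAt) (fun s => (hd s).deriv) 1 0
  simp only [intervalIntegral.integral_same, sub_zero] at this
  linarith

theorem absolutelyContinuousOnInterval_of_hasDerivAt {f f' : ℝ → ℝ} {a b : ℝ} (hab : a ≤ b)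
    (hf : ∀ x ∈ Set.Icc a b, HasDerivAt f (f' x) x) (hi : IntervalIntegrable f' volume a b) :
    AbsolutelyContinuousOnInterval f a b := by
  have h1 := hi.absolutelyContinuousOnInterval_intervalIntegral (c := a) Set.left_mem_uIcc
  have h2 : LipschitzWith 0 fun _ : ℝ => f a := LipschitzWith.const _
  have h3 := h1.fun_add (h2.lipschitzOnWith.absolutelyContinuousOnInterval)
  rw [absolutelyContinuousOnInterval_iff] at h3 ⊢
  intro ε hε
  obtain ⟨δ, hδ, h⟩ := h3 ε hε
  refine ⟨δ, hδ, fun E hE hEδ => ?_⟩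
  convert h E hE hEδ using 1
  have e : ∀ x ∈ Set.uIcc a b, f x = (∫ v in a..x, f' v) + f a := by
    intro x hx
    have hsub : Set.uIcc a x ⊆ Set.Icc a b := by
      rw [← Set.uIcc_of_le hab]
      exact Set.uIcc_subset_uIcc Set.left_mem_uIcc hx
    rw [intervalIntegral.integral_eq_sub_of_hasDerivAt (fun y hy => hf y (hsub hy))
      (hi.mono_set (by rw [Set.uIcc_of_le hab]; exact hsub))]
    ring
  exact Finset.sum_congr rfl fun i hi => by rw [e _ (hE.1 i hi).1, e _ (hE.1 i hi).2]

end LAM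

namespace LAM

variable {d : ℕ} {𝒳 : Type*} [MeasurableSpace 𝒳]

/-! ### Differentiability of expectations and the Cramér–Rao inequality -/

theorem abs_integral_le_of_abs_le {Ω : Type*} [MeasurableSpace Ω] {μ : Measure Ω}
    [IsProbabilityMeasure μ] {Z : Ω → ℝ} {C : ℝ} (hC : ∀ x, |Z x| ≤ C) : |∫ x, Z x ∂μ| ≤ C := by
  have := norm_integral_le_of_norm_le_const (μ := μ) (f := Z) (Eventually.of_forall hC)
  simpa using this

theorem integrable_of_abs_le {Ω : Type*} [MeasurableSpace Ω] {μ : Measure Ω}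
    [IsFiniteMeasure μ] {Z : Ω → ℝ} (hZ : Measurable Z) {C : ℝ} (hC : ∀ x, |Z x| ≤ C) :
    Integrable Z μ :=
  Integrable.of_bound hZ.aestronglyMeasurable C (Eventually.of_forall hC)

theorem measurable_fin_cons {n : ℕ} :
    Measurable fun p : 𝒳 × (Fin n → 𝒳) => (Fin.cons p.1 p.2 : Fin (n + 1) → 𝒳) := by
  refine measurable_pi_iff.2 fun i => ?_
  refine Fin.cases ?_ (fun j => ?_) i
  · simpa using measurable_fst
  · simpa [Function.comp_def] using (measurable_pi_apply j).comp measurable_snd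

theorem integral_pi_succ {μ : Measure 𝒳} [IsProbabilityMeasure μ] {n : ℕ}
    {T : (Fin (n + 1) → 𝒳) → ℝ} (hT : Measurable T) {C : ℝ} (hC : ∀ x, |T x| ≤ C) :
    ∫ x, T x ∂(Measure.pi fun _ => μ) =
      ∫ x, ∫ y, T (Fin.cons x y) ∂(Measure.pi fun _ => μ) ∂μ := by
  rw [← ((measurePreserving_piFinSuccAbove (fun _ : Fin (n + 1) => μ) 0).symm).integral_comp']
  have e : ∀ p : 𝒳 × (Fin n → 𝒳),
      (MeasurableEquiv.piFinSuccAbove (fun _ : Fin (n + 1) => 𝒳) 0).symm p = Fin.cons p.1 p.2 := by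
    intro p
    simp [MeasurableEquiv.piFinSuccAbove_symm_apply, Fin.insertNthEquiv]
  simp_rw [e]
  exact integral_prod _ (integrable_of_abs_le (hT.comp measurable_fin_cons) fun p => hC _)

theorem hasFDerivAt_zero_of_abs_le {R : Par d → ℝ} {t : Par d} {c : ℝ} (h0 : R t = 0)
    (hR : ∀ᶠ θ in 𝓝 t, |R θ| ≤ c * ‖θ - t‖ ^ 2) : HasFDerivAt R (0 : Par d →L[ℝ] ℝ) t := by
  rw [hasFDerivAt_iff_isLittleO]
  have h1 : (fun θ => R θ - R t - (0 : Par d →L[ℝ] ℝ) (θ - t)) =O[𝓝 t] fun θ => ‖θ - t‖ ^ 2 := by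
    refine IsBigO.of_bound c (hR.mono fun θ h => ?_)
    simpa [h0] using h
  refine h1.trans_isLittleO ?_
  have h2 : Tendsto (fun θ : Par d => θ - t) (𝓝 t) (𝓝 0) := by
    have : Continuous fun θ : Par d => θ - t := by fun_prop
    simpa using this.tendsto t
  exact (isLittleO_norm_pow_id one_lt_two).comp_tendsto h2

section Model

variable {ν : Measure 𝒳} [SigmaFinite ν] {P : Par d → Measure 𝒳} {Θ : Set (Par d)}
  {ξ : Par d → 𝒳 → Par d} (M : IsHellingerModel ν P Θ ξ)
include M

/-- A local Lipschitz bound in total variation, uniform over all bounded statistics. The factor n +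
1 lets one constant serve the one-sample and the n-sample laws together. -/
theorem IsHellingerModel.exists_lipschitz {t : Par d} (ht : t ∈ interior Θ) (n : ℕ) :
    ∃ L ≥ 0, ∀ᶠ θ in 𝓝 t, θ ∈ Θ ∧
      (∀ (Z : 𝒳 → ℝ) (C : ℝ), Measurable Z → (∀ x, |Z x| ≤ C) →
        |∫ x, Z x ∂(P θ) - ∫ x, Z x ∂(P t)| ≤ L * C * ‖θ - t‖) ∧
      ∀ (Z : (Fin n → 𝒳) → ℝ) (C : ℝ), Measurable Z → (∀ x, |Z x| ≤ C) →
        |∫ x, Z x ∂(iidLaw P n θ) - ∫ x, Z x ∂(iidLaw P n t)| ≤ L * C * ‖θ - t‖ := by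
  obtain ⟨D, hD, h⟩ := M.exists_hsq_le ht
  have htΘ := interior_subset ht
  refine ⟨2 * √((n + 1) * D), by positivity, h.mono fun θ hθ => ⟨hθ.1, ?_, ?_⟩⟩
  all_goals
    intro Z C hZ hC
    have hp := M.prob θ hθ.1
    have hp' := M.prob t htΘ
    have hq := M.isProbabilityMeasure_iidLaw hθ.1 n
    have hq' := M.isProbabilityMeasure_iidLaw htΘ n
    have hnn := hsq_nonneg ν P θ t
    have hsq2 : ∀ x, Z x ^ 2 ≤ C ^ 2 := fun x => by
      rw [← sq_abs (Z x)]
      exact pow_le_pow_left₀ (abs_nonneg _) (hC x) 2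
    have hsqa : ∀ x, |Z x ^ 2| ≤ C ^ 2 := fun x => by rw [abs_of_nonneg (sq_nonneg _)]; exact hsq2 x
  · have hC0 : 0 ≤ C := by
      obtain ⟨x⟩ := (P t).nonempty_of_neZero
      exact (abs_nonneg _).trans (hC x)
    have h1 := sq_integral_sub_integral_le (M.root hθ.1) (M.root htΘ) hZ
      (MemLp.of_bound hZ.aestronglyMeasurable C (Eventually.of_forall hC))
      (MemLp.of_bound hZ.aestronglyMeasurable C (Eventually.of_forall hC))
    have h2 := (abs_le.1 (abs_integral_le_of_abs_le (μ := P θ) hsqa)).2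
    have h3 := (abs_le.1 (abs_integral_le_of_abs_le (μ := P t) hsqa)).2
    refine abs_le_of_sq_le_sq (h1.trans ?_) (by positivity)
    have h4 : hsq ν P θ t * (2 * ∫ x, Z x ^ 2 ∂(P θ) + 2 * ∫ x, Z x ^ 2 ∂(P t)) ≤
        (D * ‖θ - t‖ ^ 2) * (2 * C ^ 2 + 2 * C ^ 2) := by
      have := hθ.2
      gcongr
    refine h4.trans ?_
    rw [mul_pow, mul_pow, mul_pow, Real.sq_sqrt (by positivity)]
    have : 0 ≤ n * D * C ^ 2 * ‖θ - t‖ ^ 2 := by positivity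
    nlinarith
  · have hC0 : 0 ≤ C := by
      obtain ⟨x⟩ := (iidLaw P n t).nonempty_of_neZero
      exact (abs_nonneg _).trans (hC x)
    have h1 := M.abs_integral_iid_sub_le hθ.1 htΘ hZ hC
    have h2 := (abs_le.1 (abs_integral_le_of_abs_le (μ := iidLaw P n θ) hsqa)).2
    have h3 := (abs_le.1 (abs_integral_le_of_abs_le (μ := iidLaw P n t) hsqa)).2
    refine abs_le_of_sq_le_sq (h1.trans ?_) (by positivity)
    have h4 : n * hsq ν P θ t * (2 * ∫ x, Z x ^ 2 ∂(iidLaw P n θ) + 2 * ∫ x, Z x ^ 2 ∂(iidLaw P n t))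
        ≤ n * (D * ‖θ - t‖ ^ 2) * (2 * C ^ 2 + 2 * C ^ 2) := by
      have := hθ.2
      gcongr
    refine h4.trans ?_
    rw [mul_pow, mul_pow, mul_pow, Real.sq_sqrt (by positivity)]
    have : 0 ≤ D * C ^ 2 * ‖θ - t‖ ^ 2 := by positivity
    nlinarith

/-- The density at t + a expands as f² + 2f(f_{t+a} - f) + (f_{t+a} - f)². The middle term is linear
up to a remainder that is small in L²(ν), and the last is O(‖a‖²); the derivative is the pairing
with 2 ∫ T f ξ dν. -/
theorem IsHellingerModel.differentiableAt_integral {t : Par d} (ht : t ∈ interior Θ) {T : 𝒳 → ℝ}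
    (hT : Measurable T) {C : ℝ} (hC : ∀ x, |T x| ≤ C) :
    DifferentiableAt ℝ (fun θ => ∫ x, T x ∂(P θ)) t := by
  have htΘ := interior_subset ht
  have hp := M.prob t htΘ
  have hC0 : 0 ≤ C := by
    obtain ⟨x⟩ := (P t).nonempty_of_neZero
    exact (abs_nonneg _).trans (hC x)
  obtain ⟨D, hD, hloc⟩ := M.exists_hsq_le ht
  set f := rootDensity ν P t with hf
  have hfm := (M.root htΘ).measurable
  have hTL : ∀ {u : 𝒳 → ℝ}, MemLp u 2 ν → MemLp (fun x => T x * u x) 2 ν := fun {u} hu =>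
    MemLp.of_le_mul hu (hT.aestronglyMeasurable.mul hu.aestronglyMeasurable)
      (Eventually.of_forall fun x => by
        rw [norm_mul]
        exact mul_le_mul_of_nonneg_right (hC x) (norm_nonneg _)) (c := C)
  have hTf := hTL (M.memLp htΘ)
  have hTfsq : ∫ x, (T x * f x) ^ 2 ∂ν ≤ C ^ 2 := by
    have h1 : ∫ x, (T x * f x) ^ 2 ∂ν ≤ ∫ x, C ^ 2 * f x ^ 2 ∂ν := by
      refine integral_mono hTf.integrable_sq ((M.memLp htΘ).integrable_sq.const_mul _) fun x => ?_
      simp only [mul_pow]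
      refine mul_le_mul_of_nonneg_right ?_ (sq_nonneg _)
      rw [← sq_abs]
      exact pow_le_pow_left₀ (abs_nonneg _) (hC x) 2
    rwa [integral_const_mul, (M.root htΘ).integral_sq, mul_one] at h1
  have hvi : Integrable (fun x => (2 * (T x * f x)) • ξ t x) ν := by
    have h2 : MemLp (fun x => 2 * (T x * f x)) 2 ν := hTf.const_mul 2
    exact memLp_one_iff_integrable.1 ((M.deriv t htΘ).1.smul h2)
  set v : Par d := ∫ x, (2 * (T x * f x)) • ξ t x ∂ν with hv
  have hva : ∀ a : Par d, inner ℝ v a = 2 * ∫ x, T x * f x * inner ℝ a (ξ t x) ∂ν := by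
    intro a
    rw [real_inner_comm, hv, ← integral_inner hvi, ← integral_const_mul]
    refine integral_congr_ae (Eventually.of_forall fun x => ?_)
    simp only [inner_smul_right]
    ring
  suffices H : HasFDerivAt (fun θ => ∫ x, T x ∂(P θ)) (innerSL ℝ v) t from H.differentiableAt
  rw [hasFDerivAt_iff_isLittleO_nhds_zero, isLittleO_iff]
  intro c hc
  have hηpos : 0 < (c / (4 * (C + 1))) ^ 2 := by positivity
  obtain ⟨δ, hδ, hrem⟩ := M.exists_remainder_le ht hηpos
  have h0 : Tendsto (fun a : Par d => t + a) (𝓝 0) (𝓝 t) := by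
    have : Continuous fun a : Par d => t + a := by fun_prop
    simpa using this.tendsto 0
  filter_upwards [h0.eventually hloc, Metric.ball_mem_nhds (0 : Par d) hδ,
    Metric.ball_mem_nhds (0 : Par d) (show 0 < c / (2 * (C * D + 1)) by positivity)] with a h1 h2 h3
  rw [mem_ball_zero_iff] at h2 h3
  obtain ⟨hΘ, hr, hri⟩ := hrem a h2
  have hpa := M.prob _ hΘ
  rw [add_sub_cancel_left] at h1
  set r := fun x => rootDensity ν P (t + a) x - rootDensity ν P t x - inner ℝ a (ξ t x) with hrdef
  set g := fun x => rootDensity ν P (t + a) x - rootDensity ν P t x with hgdef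
  have hg : MemLp g 2 ν := (M.memLp hΘ).sub (M.memLp htΘ)
  have i1 : Integrable (fun x => T x * f x * inner ℝ a (ξ t x)) ν :=
    hTf.integrable_mul (M.memLp_inner htΘ a)
  have i2 : Integrable (fun x => T x * f x * r x) ν := hTf.integrable_mul hr
  have i3 : Integrable (fun x => T x * g x * g x) ν := (hTL hg).integrable_mul hg
  have i4 : Integrable (fun x => T x * f x * f x) ν := hTf.integrable_mul (M.memLp htΘ)
  have hexp : ∫ x, T x ∂(P (t + a)) = ∫ x, T x ∂(P t) + inner ℝ v a +
      2 * ∫ x, T x * f x * r x ∂ν + ∫ x, T x * g x * g x ∂ν := by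
    rw [(M.root hΘ).integral_eq, (M.root htΘ).integral_eq, hva, ← integral_const_mul,
      ← integral_const_mul, ← integral_add, ← integral_add, ← integral_add]
    · refine integral_congr_ae (Eventually.of_forall fun x => ?_)
      simp only [hrdef, hgdef, hf]
      ring
    · refine (Integrable.add ?_ (i1.const_mul 2)).add (i2.const_mul 2)
      exact i4.congr (Eventually.of_forall fun x => by simp only [hf]; ring)
    · exact i3
    · refine Integrable.add ?_ (i1.const_mul 2)
      exact i4.congr (Eventually.of_forall fun x => by simp only [hf]; ring)
    · exact i2.const_mul 2
    · exact i4.congr (Eventually.of_forall fun x => by simp only [hf]; ring)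
    · exact i1.const_mul 2
  have hb1 : |∫ x, T x * f x * r x ∂ν| ≤ c / 4 * ‖a‖ := by
    refine abs_le_of_sq_le_sq ((sq_integral_mul_le hTf hr).trans ?_) (by positivity)
    have h5 : (∫ x, (T x * f x) ^ 2 ∂ν) * ∫ x, r x ^ 2 ∂ν ≤
        C ^ 2 * ((c / (4 * (C + 1))) ^ 2 * ‖a‖ ^ 2) := by
      gcongr
    refine h5.trans ?_
    rw [← mul_pow, ← mul_pow]
    refine pow_le_pow_left₀ (by positivity) ?_ 2
    rw [← mul_assoc]
    refine mul_le_mul_of_nonneg_right ?_ (norm_nonneg _)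
    rw [mul_div_assoc', div_le_div_iff₀ (by positivity) (by positivity)]
    nlinarith
  have hb2 : |∫ x, T x * g x * g x ∂ν| ≤ c / 2 * ‖a‖ := by
    have h5 : |∫ x, T x * g x * g x ∂ν| ≤ C * hsq ν P (t + a) t := by
      have h6 : ‖∫ x, T x * g x * g x ∂ν‖ ≤ ∫ x, C * g x ^ 2 ∂ν := by
        refine norm_integral_le_of_norm_le (hg.integrable_sq.const_mul C)
          (Eventually.of_forall fun x => ?_)
        rw [mul_assoc, norm_mul, ← sq, Real.norm_of_nonneg (sq_nonneg (g x))]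
        exact mul_le_mul_of_nonneg_right (hC x) (sq_nonneg _)
      rwa [integral_const_mul] at h6
    refine h5.trans ((mul_le_mul_of_nonneg_left h1.2 hC0).trans ?_)
    rw [lt_div_iff₀ (by positivity)] at h3
    have : ‖a‖ * (2 * (C * D)) ≤ c := by nlinarith [norm_nonneg a]
    nlinarith [norm_nonneg a]
  rw [hexp, innerSL_apply_apply, Real.norm_eq_abs]
  have e : ∫ x, T x ∂(P t) + inner ℝ v a + 2 * ∫ x, T x * f x * r x ∂ν + ∫ x, T x * g x * g x ∂ν -
      ∫ x, T x ∂(P t) - inner ℝ v a = 2 * ∫ x, T x * f x * r x ∂ν + ∫ x, T x * g x * g x ∂ν := by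
    ring
  rw [e, abs_le]
  rw [abs_le] at hb1 hb2
  constructor <;> linarith [hb1.1, hb1.2, hb2.1, hb2.2]

/-- Induction on the sample size. When one observation is split off, the expectation is the sum of
two terms in which only one factor of the product law varies, up to a constant and a mixed second
difference. -/
theorem IsHellingerModel.differentiableAt_integral_iid {t : Par d} (ht : t ∈ interior Θ) {n : ℕ}
    {T : (Fin n → 𝒳) → ℝ} (hT : Measurable T) {C : ℝ} (hC : ∀ x, |T x| ≤ C) :
    DifferentiableAt ℝ (fun θ => ∫ x, T x ∂(iidLaw P n θ)) t := by
  have htΘ := interior_subset ht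
  have hp := M.prob t htΘ
  induction n with
  | zero =>
    have : (fun θ => ∫ x, T x ∂(iidLaw P 0 θ)) = fun _ => T finZeroElim := by
      ext θ
      rw [iidLaw, Measure.pi_of_empty _ finZeroElim, integral_dirac]
    rw [this]
    exact differentiableAt_const _
  | succ n ih =>
    have hTc : Measurable fun p : 𝒳 × (Fin n → 𝒳) => T (Fin.cons p.1 p.2) :=
      hT.comp measurable_fin_cons
    have hq := M.isProbabilityMeasure_iidLaw htΘ n
    obtain ⟨L, hL, hlip⟩ := M.exists_lipschitz ht n
    set N : Par d → 𝒳 → ℝ := fun θ x => ∫ y, T (Fin.cons x y) ∂(iidLaw P n θ) with hN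
    have hNm : ∀ θ ∈ Θ, Measurable (N θ) := fun θ hθ => by
      have := M.isProbabilityMeasure_iidLaw hθ n
      exact hTc.stronglyMeasurable.integral_prod_right'.measurable
    have hNC : ∀ θ ∈ Θ, ∀ x, |N θ x| ≤ C := fun θ hθ x => by
      have := M.isProbabilityMeasure_iidLaw hθ n
      exact abs_integral_le_of_abs_le fun y => hC _
    have hA := M.differentiableAt_integral ht (hNm t htΘ) (hNC t htΘ)
    have hB := ih (T := fun y => ∫ x, T (Fin.cons x y) ∂(P t))
      hTc.stronglyMeasurable.integral_prod_left'.measurable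
      fun y => abs_integral_le_of_abs_le fun x => hC _
    -- The mixed second difference: the increment of the one-sample law acts on a function that is
    -- itself O(‖θ - t‖) uniformly, so R is quadratic in θ - t.
    set R : Par d → ℝ := fun θ => (∫ x, (N θ x - N t x) ∂(P θ)) - ∫ x, (N θ x - N t x) ∂(P t) with hR
    have hRd : HasFDerivAt R (0 : Par d →L[ℝ] ℝ) t := by
      refine hasFDerivAt_zero_of_abs_le (c := L * (L * C)) (by simp [hR]) ?_
      filter_upwards [hlip] with θ hθ
      have h1 : ∀ x, |N θ x - N t x| ≤ L * C * ‖θ - t‖ := fun x =>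
        hθ.2.2 (fun y => T (Fin.cons x y)) C (hTc.comp measurable_prodMk_left) fun y => hC _
      refine (hθ.2.1 _ _ ((hNm θ hθ.1).sub (hNm t htΘ)) h1).trans (le_of_eq (by ring))
    refine ((((hA.add hB).sub_const (∫ x, N t x ∂(P t))).add hRd.differentiableAt)
      ).congr_of_eventuallyEq ?_
    filter_upwards [hlip] with θ hθ
    have hpθ := M.prob θ hθ.1
    have hqθ := M.isProbabilityMeasure_iidLaw hθ.1 n
    have e1 : ∫ x, T x ∂(iidLaw P (n + 1) θ) = ∫ x, N θ x ∂(P θ) := integral_pi_succ hT hC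
    have e2 : ∫ y, ∫ x, T (Fin.cons x y) ∂(P t) ∂(iidLaw P n θ) = ∫ x, N θ x ∂(P t) :=
      (integral_integral_swap (integrable_of_abs_le hTc fun p => hC _)).symm
    have j : ∀ (μ : Measure 𝒳) [IsProbabilityMeasure μ], ∀ s ∈ Θ, Integrable (N s) μ :=
      fun μ _ s hs => integrable_of_abs_le (hNm s hs) (hNC s hs)
    simp only [Pi.add_apply, hR]
    rw [e1, e2, integral_sub (j _ _ hθ.1) (j _ _ htΘ), integral_sub (j _ _ hθ.1) (j _ _ htΘ)]
    ring

end Model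

end LAM

namespace LAM

variable {d : ℕ} {𝒳 : Type*} [MeasurableSpace 𝒳]

/-! ### The Cramér–Rao inequality and measurability of the Fisher information. -/

theorem measurable_indicator_of_continuousOn {f : Par d → ℝ} {U : Set (Par d)} (hU : IsOpen U)
    (hf : ContinuousOn f U) : Measurable (U.indicator f) := by
  classical
  rw [← Set.piecewise_eq_indicator]
  exact hf.measurable_piecewise continuousOn_const hU.measurableSet

section Model

variable {ν : Measure 𝒳} [SigmaFinite ν] {P : Par d → Measure 𝒳} {Θ : Set (Par d)}
  {ξ : Par d → 𝒳 → Par d} (M : IsHellingerModel ν P Θ ξ)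
include M

theorem IsHellingerModel.tendsto_hsq_div {t : Par d} (ht : t ∈ interior Θ) (a : Par d) :
    Tendsto (fun s : ℝ => hsq ν P (t + s • a) t / s ^ 2) (𝓝[≠] 0)
      (𝓝 (∫ x, inner ℝ a (ξ t x) ^ 2 ∂ν)) := by
  rw [Metric.tendsto_nhds]
  intro ε hε
  obtain ⟨δ, hδ, h⟩ := M.hsq_local ht (ε := ε / (2 * (‖a‖ ^ 2 + 1))) (by positivity)
  have h0 : Tendsto (fun s : ℝ => ‖s • a‖) (𝓝 0) (𝓝 0) := by
    have : Continuous fun s : ℝ => ‖s • a‖ := by fun_prop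
    simpa using this.tendsto 0
  filter_upwards [(h0.mono_left nhdsWithin_le_nhds).eventually (gt_mem_nhds hδ),
    self_mem_nhdsWithin] with s hs hs0
  have hs0' : s ≠ 0 := hs0
  have hs2 : 0 < s ^ 2 := by positivity
  have h1 := (h (s • a) 0 hs (by simpa using hδ)).2.2
  simp only [add_zero, sub_zero, norm_zero, inner_smul_left, mul_pow, norm_smul, Real.norm_eq_abs,
    sq_abs, RCLike.conj_to_real] at h1
  rw [integral_const_mul] at h1
  have e : hsq ν P (t + s • a) t / s ^ 2 - ∫ x, inner ℝ a (ξ t x) ^ 2 ∂ν =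
      (hsq ν P (t + s • a) t - s ^ 2 * ∫ x, inner ℝ a (ξ t x) ^ 2 ∂ν) / s ^ 2 := by
    field_simp
  rw [Real.dist_eq, e, abs_div, abs_of_pos hs2, div_lt_iff₀ hs2]
  refine h1.trans_lt ?_
  have h2 : ε / (2 * (‖a‖ ^ 2 + 1)) * (s ^ 2 * ‖a‖ ^ 2) ≤ ε / 2 * s ^ 2 := by
    rw [div_mul_eq_mul_div, div_le_iff₀ (by positivity)]
    have : 0 ≤ ε * s ^ 2 := by positivity
    nlinarith
  refine h2.trans_lt ?_
  nlinarith [mul_pos hε hs2]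

/-- The limit of the Hellinger inequality between t + s a and t for the centred statistic, divided
by s². By continuity the two second moments merge into 4 Var, and 4 ∫ ⟨a, ξ⟩² is the Fisher
information form. -/
theorem IsHellingerModel.cramerRao {t : Par d} (ht : t ∈ interior Θ) {n : ℕ}
    {T : (Fin n → 𝒳) → ℝ} (hT : Measurable T) {C : ℝ} (hC : ∀ x, |T x| ≤ C) (a : Par d) :
    fderiv ℝ (fun θ => ∫ x, T x ∂(iidLaw P n θ)) t a ^ 2 ≤
      (∫ x, (T x - ∫ y, T y ∂(iidLaw P n t)) ^ 2 ∂(iidLaw P n t)) *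
        (n * ((a : Fin d → ℝ) ⬝ᵥ (fisherInfo ν (ξ t) *ᵥ a))) := by
  have htΘ := interior_subset ht
  set m : Par d → ℝ := fun θ => ∫ x, T x ∂(iidLaw P n θ) with hm
  set Z : (Fin n → 𝒳) → ℝ := fun x => T x - m t with hZ
  have hZm : Measurable Z := hT.sub_const _
  have hZC : ∀ x, |Z x| ≤ C + |m t| := fun x => (abs_sub _ _).trans (by gcongr; exact hC x)
  have hc := M.continuousAt_integral_iid ht (hZm.pow_const 2) (C := (C + |m t|) ^ 2) fun x => by
    rw [abs_of_nonneg (sq_nonneg _), ← sq_abs]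
    exact pow_le_pow_left₀ (abs_nonneg _) (hZC x) 2
  have h0 : Tendsto (fun s : ℝ => t + s • a) (𝓝[≠] 0) (𝓝 t) := by
    have : Continuous fun s : ℝ => t + s • a := by fun_prop
    have := this.tendsto 0
    simp only [zero_smul, add_zero] at this
    exact this.mono_left nhdsWithin_le_nhds
  have hd : HasDerivAt (fun s : ℝ => m (t + s • a)) (fderiv ℝ m t a) 0 :=
    (M.differentiableAt_integral_iid ht hT hC).hasFDerivAt.hasLineDerivAt a
  have hslope := (hasDerivAt_iff_tendsto_slope.1 hd).pow 2
  have hlim := ((M.tendsto_hsq_div ht a).const_mul (n : ℝ)).mul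
    (((hc.tendsto.comp h0).const_mul 2).add_const (2 * ∫ x, Z x ^ 2 ∂(iidLaw P n t)))
  have hle := le_of_tendsto_of_tendsto hslope hlim ?_
  · refine hle.trans (le_of_eq ?_)
    rw [M.fisherInfo_quadratic htΘ]
    ring
  · have hev : ∀ᶠ s : ℝ in 𝓝[≠] 0, t + s • a ∈ Θ :=
      (h0.eventually (isOpen_interior.mem_nhds ht)).mono fun s hs => interior_subset hs
    filter_upwards [hev, self_mem_nhdsWithin] with s hs hs0
    have hs0' : s ≠ 0 := hs0
    have hs2 : 0 < s ^ 2 := by positivity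
    have h1 := M.abs_integral_iid_sub_le hs htΘ hZm hZC (n := n)
    have e : ∀ θ ∈ Θ, ∫ x, Z x ∂(iidLaw P n θ) = m θ - m t := fun θ hθ => by
      have := M.isProbabilityMeasure_iidLaw hθ n
      rw [hZ, integral_sub (integrable_of_abs_le hT hC) (integrable_const _)]
      simp [hm]
    rw [e _ hs, e _ htΘ, sub_self, sub_zero] at h1
    simp only [slope_def_field, sub_zero, zero_smul, add_zero, Function.comp]
    rw [div_pow, mul_div_assoc', div_mul_eq_mul_div]
    gcongr

theorem IsHellingerModel.continuousAt_hsq_add {t u : Par d} (ht : t ∈ interior Θ)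
    (htu : t + u ∈ interior Θ) : ContinuousAt (fun θ => hsq ν P (θ + u) θ) t := by
  have htΘ := interior_subset ht
  have htuΘ := interior_subset htu
  obtain ⟨D, hD, h⟩ := M.exists_hsq_le ht
  obtain ⟨D', hD', h'⟩ := M.exists_hsq_le htu
  have hshift : Tendsto (fun θ : Par d => θ + u) (𝓝 t) (𝓝 (t + u)) :=
    (continuous_id.add continuous_const).tendsto t
  set A := hsq ν P (t + u) t with hA
  set B : Par d → ℝ := fun θ => (2 * D' + 2 * D) * ‖θ - t‖ ^ 2 with hB
  have hlim : Tendsto (fun θ : Par d => 2 * √(A * B θ) + B θ) (𝓝 t) (𝓝 0) := by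
    have : ContinuousAt (fun θ : Par d => 2 * √(A * B θ) + B θ) t := by fun_prop
    simpa [ContinuousAt, hB] using this
  rw [ContinuousAt, tendsto_iff_dist_tendsto_zero]
  refine squeeze_zero' (Eventually.of_forall fun _ => dist_nonneg) ?_ hlim
  filter_upwards [h, hshift.eventually h'] with θ h1 h2
  let f := rootDensity ν P
  have m1 : MemLp (fun x => f (θ + u) x - f (t + u) x) 2 ν := (M.memLp h2.1).sub (M.memLp htuΘ)
  have m2 : MemLp (fun x => f θ x - f t x) 2 ν := (M.memLp h1.1).sub (M.memLp htΘ)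
  have m0 : MemLp (fun x => f (t + u) x - f t x) 2 ν := (M.memLp htuΘ).sub (M.memLp htΘ)
  have m12 : MemLp (fun x => (f (θ + u) x - f (t + u) x) - (f θ x - f t x)) 2 ν := m1.sub m2
  have key := abs_integral_add_sq_sub_le m0 m12
  have e : ∀ x, (f (t + u) x - f t x) + ((f (θ + u) x - f (t + u) x) - (f θ x - f t x)) =
      f (θ + u) x - f θ x := fun x => by ring
  have hv : ∫ x, ((f (θ + u) x - f (t + u) x) - (f θ x - f t x)) ^ 2 ∂ν ≤ B θ := by
    have h3 : ∫ x, ((f (θ + u) x - f (t + u) x) - (f θ x - f t x)) ^ 2 ∂ν ≤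
        2 * ∫ x, (f (θ + u) x - f (t + u) x) ^ 2 ∂ν + 2 * ∫ x, (f θ x - f t x) ^ 2 ∂ν := by
      rw [← integral_const_mul, ← integral_const_mul,
        ← integral_add (m1.integrable_sq.const_mul 2) (m2.integrable_sq.const_mul 2)]
      refine integral_mono m12.integrable_sq
        ((m1.integrable_sq.const_mul 2).add (m2.integrable_sq.const_mul 2)) fun x => ?_
      simp only
      nlinarith [sq_nonneg ((f (θ + u) x - f (t + u) x) + (f θ x - f t x))]
    refine h3.trans ?_
    change 2 * hsq ν P (θ + u) (t + u) + 2 * hsq ν P θ t ≤ B θ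
    have h4 := h2.2
    rw [add_sub_add_right_eq_sub] at h4
    simp only [hB]
    linarith [h1.2]
  simp_rw [e] at key
  rw [Real.dist_eq]
  refine key.trans ?_
  have hA' : ∫ x, (f (t + u) x - f t x) ^ 2 ∂ν = A := rfl
  rw [hA']
  have hA0 : 0 ≤ A := hsq_nonneg _ _ _ _
  gcongr

/-- The quadratic form of the Fisher information is a pointwise limit of difference quotients of the
squared Hellinger distance, each continuous on an open set; no measurability of the derivative in
the parameter has to be assumed. -/
theorem IsHellingerModel.measurable_indicator_quadratic {S : Set (Par d)} (hS : IsOpen S)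
    (hSΘ : S ⊆ interior Θ) (a : Par d) :
    Measurable (S.indicator fun t => ∫ x, inner ℝ a (ξ t x) ^ 2 ∂ν) := by
  set u : ℕ → ℝ := fun k => 1 / ((k : ℝ) + 1) with hu
  have hu0 : Tendsto u atTop (𝓝[≠] 0) := by
    refine tendsto_nhdsWithin_iff.2 ⟨tendsto_one_div_add_atTop_nhds_zero_nat,
      Eventually.of_forall fun k => ?_⟩
    have : 0 < u k := by positivity
    exact this.ne'
  set U : ℕ → Set (Par d) := fun k => S ∩ (fun t => t + u k • a) ⁻¹' interior Θ with hU
  have hUo : ∀ k, IsOpen (U k) := fun k =>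
    hS.inter (isOpen_interior.preimage (by fun_prop))
  refine measurable_of_tendsto_metrizable
    (f := fun k => (U k).indicator fun t => hsq ν P (t + u k • a) t / u k ^ 2) (fun k => ?_) ?_
  · refine measurable_indicator_of_continuousOn (hUo k) fun t ht => ContinuousAt.continuousWithinAt ?_
    exact (M.continuousAt_hsq_add (hSΘ ht.1) ht.2).div_const _
  · rw [tendsto_pi_nhds]
    intro t
    by_cases ht : t ∈ S
    · rw [Set.indicator_of_mem ht]
      refine ((M.tendsto_hsq_div (hSΘ ht) a).comp hu0).congr' ?_
      have h0 : Tendsto (fun s : ℝ => t + s • a) (𝓝[≠] 0) (𝓝 t) := by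
        have : Continuous fun s : ℝ => t + s • a := by fun_prop
        have := this.tendsto 0
        simp only [zero_smul, add_zero] at this
        exact this.mono_left nhdsWithin_le_nhds
      filter_upwards [hu0.eventually (h0.eventually (isOpen_interior.mem_nhds (hSΘ ht)))] with k hk
      rw [Set.indicator_of_mem (show t ∈ U k from ⟨ht, hk⟩)]
      rfl
    · rw [Set.indicator_of_notMem ht]
      refine tendsto_const_nhds.congr fun k => ?_
      rw [Set.indicator_of_notMem fun h => ht h.1]

theorem IsHellingerModel.memLp_coord {t : Par d} (ht : t ∈ Θ) (i : Fin d) :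
    MemLp (fun x => ξ t x i) 2 ν := by
  have := M.memLp_inner ht (EuclideanSpace.single i 1)
  simpa [EuclideanSpace.inner_single_left] using this

/-- Polarization of the quadratic form at eᵢ + eⱼ and eᵢ - eⱼ; the factor 4 in the Fisher
information is the polarization constant. -/
theorem IsHellingerModel.measurable_indicator_fisherInfo {S : Set (Par d)} (hS : IsOpen S)
    (hSΘ : S ⊆ interior Θ) (i j : Fin d) :
    Measurable (S.indicator fun t => fisherInfo ν (ξ t) i j) := by
  have h1 := M.measurable_indicator_quadratic hS hSΘ
    (EuclideanSpace.single i 1 + EuclideanSpace.single j 1)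
  have h2 := M.measurable_indicator_quadratic hS hSΘ
    (EuclideanSpace.single i 1 - EuclideanSpace.single j 1)
  convert h1.sub h2 using 1
  ext t
  by_cases ht : t ∈ S
  · simp only [Pi.sub_apply, Set.indicator_of_mem ht, fisherInfo, Matrix.of_apply]
    have hi := M.memLp_coord (interior_subset (hSΘ ht)) i
    have hj := M.memLp_coord (interior_subset (hSΘ ht)) j
    have e1 : ∀ x, inner ℝ (EuclideanSpace.single i (1 : ℝ) + EuclideanSpace.single j 1) (ξ t x) =
        ξ t x i + ξ t x j := fun x => by simp [inner_add_left, EuclideanSpace.inner_single_left]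
    have e2 : ∀ x, inner ℝ (EuclideanSpace.single i (1 : ℝ) - EuclideanSpace.single j 1) (ξ t x) =
        ξ t x i - ξ t x j := fun x => by simp [inner_sub_left, EuclideanSpace.inner_single_left]
    simp_rw [e1, e2]
    have h3 : Integrable (fun x => (ξ t x i + ξ t x j) ^ 2) ν := (hi.add hj).integrable_sq
    have h4 : Integrable (fun x => (ξ t x i - ξ t x j) ^ 2) ν := (hi.sub hj).integrable_sq
    rw [← integral_sub h3 h4, ← integral_const_mul]
    refine integral_congr_ae (Eventually.of_forall fun x => ?_)
    ring
  · simp [Set.indicator_of_notMem ht]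

end Model

theorem fisherInfo_diag_nonneg (ν : Measure 𝒳) (f : 𝒳 → Par d) (i : Fin d) :
    0 ≤ fisherInfo ν f i i := by
  simp only [fisherInfo, Matrix.of_apply]
  exact mul_nonneg (by norm_num) (integral_nonneg fun x => mul_self_nonneg _)

theorem fisherInfo_diag_le_trace (ν : Measure 𝒳) (f : 𝒳 → Par d) (i : Fin d) :
    fisherInfo ν f i i ≤ (fisherInfo ν f).trace :=
  Finset.single_le_sum (f := fun i => fisherInfo ν f i i)
    (fun j _ => fisherInfo_diag_nonneg ν f j) (Finset.mem_univ i)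

theorem IsHellingerModel.abs_fisherInfo_le_trace {ν : Measure 𝒳} [SigmaFinite ν]
    {P : Par d → Measure 𝒳} {Θ : Set (Par d)} {ξ : Par d → 𝒳 → Par d}
    (M : IsHellingerModel ν P Θ ξ) {t : Par d} (ht : t ∈ Θ) (i j : Fin d) :
    |fisherInfo ν (ξ t) i j| ≤ (fisherInfo ν (ξ t)).trace := by
  have hi := M.memLp_coord ht i
  have hj := M.memLp_coord ht j
  have h1 := sq_integral_mul_le hi hj
  have h2 := fisherInfo_diag_le_trace ν (ξ t) i
  have h3 := fisherInfo_diag_le_trace ν (ξ t) j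
  have h4 := fisherInfo_diag_nonneg ν (ξ t) i
  have h5 := fisherInfo_diag_nonneg ν (ξ t) j
  have e : ∀ k, fisherInfo ν (ξ t) k k = 4 * ∫ x, ξ t x k ^ 2 ∂ν := fun k => by
    simp only [fisherInfo, Matrix.of_apply, ← sq]
  have e' : fisherInfo ν (ξ t) i j = 4 * ∫ x, ξ t x i * ξ t x j ∂ν := rfl
  have h6 := mul_le_mul h2 h3 h5 (h4.trans h2)
  rw [e, e] at h6
  refine abs_le_of_sq_le_sq ?_ (h4.trans h2)
  rw [sq (Matrix.trace _), e']
  refine le_trans ?_ h6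
  nlinarith

end LAM

namespace LAM

variable {d : ℕ}

/-! ### Integration by parts against a density vanishing at the boundary -/

/-- On smaller closed balls f has a continuous extension to the whole space by Tietze. Line
derivatives depend only on the function near the point, so those of the extensions agree with those
of f inside the smaller balls. -/
theorem measurable_indicator_lineDeriv {f : Par d → ℝ} {θ₀ : Par d} {r : ℝ}
    (hf : ContinuousOn f (Metric.ball θ₀ r)) (v : Par d) :
    Measurable ((Metric.ball θ₀ r).indicator fun t => lineDeriv ℝ f t v) := by
  set ρ : ℕ → ℝ := fun k => r - 1 / ((k : ℝ) + 1) with hρ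
  have hρr : ∀ k, ρ k < r := fun k => by
    have : 0 < 1 / ((k : ℝ) + 1) := by positivity
    simp only [hρ]
    linarith
  have hρlim : Tendsto ρ atTop (𝓝 r) := by
    simpa [hρ] using (tendsto_const_nhds (x := r)).sub
      (tendsto_one_div_add_atTop_nhds_zero_nat (𝕜 := ℝ))
  have hext : ∀ k, ∃ g : C(Par d, ℝ), ∀ t ∈ Metric.closedBall θ₀ (ρ k), g t = f t := fun k => by
    have hc : ContinuousOn f (Metric.closedBall θ₀ (ρ k)) :=
      hf.mono (Metric.closedBall_subset_ball (hρr k))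
    obtain ⟨g, hg⟩ := ContinuousMap.exists_restrict_eq Metric.isClosed_closedBall
      (⟨_, hc.domRestrict⟩ : C(Metric.closedBall θ₀ (ρ k), ℝ))
    exact ⟨g, fun t ht => by simpa using DFunLike.congr_fun hg ⟨t, ht⟩⟩
  choose g hg using hext
  refine measurable_of_tendsto_metrizable
    (f := fun k => (Metric.ball θ₀ (ρ k)).indicator fun t => lineDeriv ℝ (g k) t v)
    (fun k => (measurable_lineDeriv (g k).continuous).indicator Metric.isOpen_ball.measurableSet) ?_
  rw [tendsto_pi_nhds]
  intro t
  by_cases ht : t ∈ Metric.ball θ₀ r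
  · rw [Set.indicator_of_mem ht]
    refine tendsto_const_nhds.congr' ?_
    filter_upwards [hρlim.eventually (lt_mem_nhds (Metric.mem_ball.1 ht))] with k hk
    have hk' : t ∈ Metric.ball θ₀ (ρ k) := hk
    rw [Set.indicator_of_mem hk']
    refine Filter.EventuallyEq.lineDeriv_eq ?_
    filter_upwards [Metric.isOpen_ball.mem_nhds hk'] with s hs
    exact (hg k s (Metric.ball_subset_closedBall hs)).symm
  · rw [Set.indicator_of_notMem ht]
    refine tendsto_const_nhds.congr fun k => ?_
    rw [Set.indicator_of_notMem fun h => ht (Metric.ball_subset_ball (hρr k).le h)]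

theorem deriv_comp_line (f : Par d → ℝ) (t e : Par d) (s : ℝ) :
    deriv (fun u : ℝ => f (t + u • e)) s = lineDeriv ℝ f (t + s • e) e := by
  rw [lineDeriv]
  have : (fun u : ℝ => f (t + s • e + u • e)) = fun u => (fun u : ℝ => f (t + u • e)) (s + u) := by
    ext u
    rw [add_assoc, ← add_smul]
  rw [this, deriv_comp_const_add (f := fun u : ℝ => f (t + u • e)), add_zero]

theorem exists_forall_mem_of_isOpen {S : Set (Par d)} (hS : IsOpen S) {t e : Par d} {s₀ : ℝ}
    (h : t + s₀ • e ∈ S) : ∃ δ > 0, ∀ s ∈ Set.Icc (s₀ - δ) (s₀ + δ), t + s • e ∈ S := by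
  have hc : Continuous fun s : ℝ => t + s • e := by fun_prop
  obtain ⟨δ, hδ, hball⟩ := Metric.mem_nhds_iff.1 (hc.continuousAt.eventually (hS.mem_nhds h))
  refine ⟨δ / 2, by positivity, fun s hs => hball ?_⟩
  rw [← Real.closedBall_eq_Icc] at hs
  exact Metric.closedBall_subset_ball (half_lt_self hδ) hs

theorem IsAbsContOn.comp_line {f : Par d → ℝ} {S : Set (Par d)} (hf : IsAbsContOn f S)
    (hS : Convex ℝ S) {t e : Par d} {x y : ℝ} (hxy : x < y) (hx : t + x • e ∈ S)
    (hy : t + y • e ∈ S) : AbsolutelyContinuousOnInterval (fun s : ℝ => f (t + s • e)) x y := by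
  have hd : 0 < y - x := sub_pos.2 hxy
  have h1 := hf.2 _ _ (hS.segment_subset hx hy)
  have h2 := AbsolutelyContinuousOnInterval.comp_affine (k := 1 / (y - x)) (l := -x / (y - x))
    (a := x) (b := y) (by positivity) (f := fun s => f (t + x • e + s • (t + y • e - (t + x • e))))
    (by convert h1 using 1 <;> (field_simp; try ring))
  convert h2 using 2 with s
  congr 1
  have e1 : t + y • e - (t + x • e) = (y - x) • e := by rw [sub_smul]; abel
  rw [e1, smul_smul, add_assoc, ← add_smul]
  congr 2
  field_simp
  ring

/-- The boundary condition says exactly that extension by zero is continuous along lines parallel to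
e; continuity of q on ℝ^d is not claimed. -/
theorem continuous_line_of_boundary {q : Par d → ℝ} {S : Set (Par d)} (hS : IsOpen S)
    (hq : ContinuousOn q S) (hqz : ∀ t ∉ S, q t = 0) {e : Par d}
    (hb : ∀ x ∈ frontier S, Tendsto (fun s : ℝ => q (x + s • e))
      (𝓝[{s : ℝ | x + s • e ∈ S}] 0) (𝓝 0)) (t : Par d) :
    Continuous fun s : ℝ => q (t + s • e) := by
  have hc : Continuous fun s : ℝ => t + s • e := by fun_prop
  rw [continuous_iff_continuousAt]
  intro s
  by_cases hs : t + s • e ∈ S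
  · exact ContinuousAt.comp (f := fun s : ℝ => t + s • e) (hq.continuousAt (hS.mem_nhds hs))
      hc.continuousAt
  · rw [ContinuousAt, hqz _ hs]
    by_cases hs' : t + s • e ∈ closure S
    · have hf : t + s • e ∈ frontier S := by
        rw [hS.frontier_eq]
        exact ⟨hs', hs⟩
      have hshift : Tendsto (fun u : ℝ => u - s) (𝓝 s) (𝓝 0) := by
        have : Continuous fun u : ℝ => u - s := by fun_prop
        simpa using this.tendsto s
      have h1 := hb _ hf
      have e1 : ∀ u : ℝ, t + s • e + (u - s) • e = t + u • e := fun u => by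
        rw [sub_smul]; abel
      rw [Metric.tendsto_nhds] at h1 ⊢
      intro ε hε
      have h2 := hshift.eventually (eventually_nhdsWithin_iff.1 (h1 ε hε))
      filter_upwards [h2] with u hu
      simp only [e1] at hu
      by_cases huS : t + u • e ∈ S
      · exact hu huS
      · rw [hqz _ huS, dist_self]
        exact hε
    · refine (tendsto_const_nhds (x := (0 : ℝ))).congr' ?_
      filter_upwards [hc.continuousAt.eventually (isClosed_closure.isOpen_compl.mem_nhds hs')] with u hu
      exact (hqz _ fun h => hu (subset_closure h)).symm

theorem integrable_comp_shear {h : Par d → ℝ} (hm : Measurable h) (hi : Integrable h) (e : Par d)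
    (μ : Measure ℝ) [IsFiniteMeasure μ] :
    Integrable (fun p : Par d × ℝ => h (p.1 + p.2 • e)) (volume.prod μ) := by
  have hms : Measurable fun p : Par d × ℝ => h (p.1 + p.2 • e) := hm.comp (by fun_prop)
  rw [integrable_prod_iff' hms.aestronglyMeasurable]
  refine ⟨Eventually.of_forall fun s => hi.comp_add_right (s • e), ?_⟩
  have : (fun s : ℝ => ∫ t, ‖h (t + s • e)‖) = fun _ => ∫ t, ‖h t‖ := by
    ext s
    exact integral_add_right_eq_self (fun t => ‖h t‖) (s • e)
  rw [this]
  exact integrable_const _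

theorem ae_locallyIntegrable_line {h : Par d → ℝ} (hm : Measurable h) (hi : Integrable h)
    (e : Par d) : ∀ᵐ t : Par d, LocallyIntegrable fun s : ℝ => h (t + s • e) := by
  have h1 : ∀ N : ℕ, ∀ᵐ t : Par d, IntegrableOn (fun s : ℝ => h (t + s • e)) (Set.Icc (-(N : ℝ)) N) :=
    fun N => (integrable_comp_shear hm hi e _).prod_right_ae
  filter_upwards [ae_all_iff.2 h1] with t ht s
  obtain ⟨N, hN⟩ := exists_nat_gt |s|
  exact ⟨_, Icc_mem_nhds (abs_lt.1 hN).1 (abs_lt.1 hN).2, ht N⟩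

/-- Translation invariance and Fubini. Averaging over all base points t replaces a splitting of ℝ^d
into the line of e and a complement. -/
theorem integral_integral_line {h : Par d → ℝ} (hm : Measurable h) (hi : Integrable h) (e : Par d) :
    ∫ t, ∫ s in (0 : ℝ)..1, h (t + s • e) = ∫ t, h t := by
  simp_rw [intervalIntegral.integral_of_le zero_le_one]
  rw [integral_integral_swap (integrable_comp_shear hm hi e _)]
  simp_rw [integral_add_right_eq_self]
  simp

theorem abs_softProductDeriv_le {ε : ℝ} (hε : 0 < ε) {M φ Q M' φ' Q' : ℝ} (hQ : 0 ≤ Q) :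
    |softProductDeriv ε M φ Q M' φ' Q'| ≤ |M' * Q| + |φ' * Q| + |(M - φ) * (Q' / Q) * Q| := by
  have h1 : |(M' - φ') * softThreshold ε Q| ≤ |M' * Q| + |φ' * Q| := by
    rw [abs_mul, abs_of_nonneg (softThreshold_nonneg hε Q), abs_mul, abs_mul, abs_of_nonneg hQ,
      ← add_mul]
    exact mul_le_mul (abs_sub _ _) (softThreshold_le hε hQ) (softThreshold_nonneg hε Q) (by positivity)
  have h2 : |(M - φ) * (softThresholdDeriv ε Q * Q')| ≤ |(M - φ) * (Q' / Q) * Q| := by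
    rcases hQ.eq_or_lt with h | h
    · rw [← h, softThresholdDeriv, if_neg hε.le.not_gt]
      simp
    · rw [mul_assoc, div_mul_cancel₀ _ h.ne', abs_mul, abs_mul, abs_mul,
        abs_of_nonneg (softThresholdDeriv_nonneg hε Q)]
      exact mul_le_mul_of_nonneg_left
        (mul_le_of_le_one_left (abs_nonneg _) (softThresholdDeriv_le_one ε Q)) (abs_nonneg _)
  exact (abs_add_le _ _).trans (add_le_add h1 h2)

theorem tendsto_softProductDeriv {M φ Q M' φ' Q' : ℝ} (hQ : 0 ≤ Q) {u : ℕ → ℝ}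
    (hu : Tendsto u atTop (𝓝 0)) (hu0 : ∀ k, 0 < u k) :
    Tendsto (fun k => softProductDeriv (u k) M φ Q M' φ' Q') atTop
      (𝓝 ((M' - φ' + (M - φ) * (Q' / Q)) * Q)) := by
  have h1 := (tendsto_softThreshold hQ hu hu0).const_mul (M' - φ')
  have h2 : Tendsto (fun k => (M - φ) * (softThresholdDeriv (u k) Q * Q')) atTop
      (𝓝 ((M - φ) * (Q' / Q) * Q)) := by
    rcases hQ.eq_or_lt with h | h
    · simp only [← h, mul_zero]
      refine tendsto_const_nhds.congr fun k => ?_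
      rw [softThresholdDeriv, if_neg (hu0 k).le.not_gt]
      simp
    · have := ((tendsto_softThresholdDeriv h hu).mul_const Q').const_mul (M - φ)
      convert this using 2
      field_simp
  rw [add_mul]
  exact h1.add h2

section Stein

variable {θ₀ : Par d} {r : ℝ} {M φ q : Par d → ℝ} {e : Par d}

/-- The one-dimensional identity on [0, 1] is applied on almost every line and integrated over the
base point: the increments F(t + e) - F(t) integrate to 0, and the right-hand side becomes the
integral of W. -/
theorem integral_softProductDeriv_eq_zero (hq0 : ∀ t, 0 ≤ q t)
    (hqz : ∀ t ∉ Metric.ball θ₀ r, q t = 0)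
    (hq : IsAbsContOn q (Metric.ball θ₀ r))
    (hb : ∀ x ∈ frontier (Metric.ball θ₀ r), Tendsto (fun s : ℝ => q (x + s • e))
      (𝓝[{s : ℝ | x + s • e ∈ Metric.ball θ₀ r}] 0) (𝓝 0))
    (hφ : IsAbsContOn φ (Metric.ball θ₀ r))
    (hM : ∀ t ∈ Metric.ball θ₀ r, DifferentiableAt ℝ M t)
    (hM1 : Integrable fun t => lineDeriv ℝ M t e * q t) 
    (hφ1 : Integrable fun t => lineDeriv ℝ φ t e * q t)
    (hMφ : Integrable fun t => (M t - φ t) * q t)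
    (hqd : Integrable fun t => (M t - φ t) * (lineDeriv ℝ q t e / q t) * q t) {ε : ℝ} (hε : 0 < ε) :
    Measurable (fun t => softProductDeriv ε (M t) (φ t) (q t) (lineDeriv ℝ M t e)
      (lineDeriv ℝ φ t e) (lineDeriv ℝ q t e)) ∧ ∫ t, softProductDeriv ε (M t) (φ t) (q t) (lineDeriv ℝ M t e)
      (lineDeriv ℝ φ t e) (lineDeriv ℝ q t e) = 0 := by
  set S := Metric.ball θ₀ r with hSdef
  have hSo : IsOpen S := Metric.isOpen_ball
  have hMc : ContinuousOn M S := fun t ht => (hM t ht).continuousAt.continuousWithinAt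
  set W : Par d → ℝ := fun t => softProductDeriv ε (M t) (φ t) (q t) (lineDeriv ℝ M t e)
    (lineDeriv ℝ φ t e) (lineDeriv ℝ q t e) with hWdef
  set F : Par d → ℝ := fun t => (M t - φ t) * softThreshold ε (q t) with hFdef
  have hqind : q = S.indicator q := by
    ext t
    by_cases ht : t ∈ S
    · rw [Set.indicator_of_mem ht]
    · rw [Set.indicator_of_notMem ht, hqz t ht]
  have hqm : Measurable q := by
    rw [hqind]
    exact measurable_indicator_of_continuousOn hSo hq.1
  have hWm : Measurable W := by
    -- Off the ball q = 0 < ε, so both threshold factors vanish and the uncontrolled values of M and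
    -- φ do not matter.
    have : W = fun t => softProductDeriv ε (S.indicator M t) (S.indicator φ t) (q t)
        (S.indicator (fun t => lineDeriv ℝ M t e) t) (S.indicator (fun t => lineDeriv ℝ φ t e) t)
        (S.indicator (fun t => lineDeriv ℝ q t e) t) := by
      ext t
      by_cases ht : t ∈ S
      · simp only [Set.indicator_of_mem ht, hWdef]
      · simp only [hWdef, softProductDeriv, hqz t ht, softThreshold, softThresholdDeriv,
          hε.le.not_gt, if_false, zero_mul, mul_zero]
    rw [this]
    have h1 := measurable_indicator_of_continuousOn hSo hMc
    have h2 := measurable_indicator_of_continuousOn hSo hφ.1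
    have h3 := measurable_indicator_lineDeriv hMc e
    have h4 := measurable_indicator_lineDeriv hφ.1 e
    have h5 := measurable_indicator_lineDeriv hq.1 e
    exact ((h3.sub h4).mul ((measurable_softThreshold hε).comp hqm)).add
      ((h1.sub h2).mul (((measurable_softThresholdDeriv ε).comp hqm).mul h5))
  have hW : Integrable W := by
    refine ((hM1.abs.add hφ1.abs).add hqd.abs).mono' hWm.aestronglyMeasurable
      (Eventually.of_forall fun t => ?_)
    exact abs_softProductDeriv_le hε (hq0 t)
  have hFm : Measurable F := by
    have : F = fun t => (S.indicator M t - S.indicator φ t) * softThreshold ε (q t) := by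
      ext t
      by_cases ht : t ∈ S
      · simp only [Set.indicator_of_mem ht, hFdef]
      · simp only [hFdef, hqz t ht, softThreshold, hε.le.not_gt, if_false, mul_zero]
    rw [this]
    exact ((measurable_indicator_of_continuousOn hSo hMc).sub
      (measurable_indicator_of_continuousOn hSo hφ.1)).mul ((measurable_softThreshold hε).comp hqm)
  have hF : Integrable F := by
    refine hMφ.mono hFm.aestronglyMeasurable (Eventually.of_forall fun t => ?_)
    simp only [hFdef, norm_mul]
    rw [Real.norm_of_nonneg (softThreshold_nonneg hε _), Real.norm_of_nonneg (hq0 t)]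
    exact mul_le_mul_of_nonneg_left (softThreshold_le hε (hq0 t)) (norm_nonneg _)
  refine ⟨hWm, ?_⟩
  have hM1m : Measurable fun t => lineDeriv ℝ M t e * q t := by
    have : (fun t => lineDeriv ℝ M t e * q t) =
        fun t => S.indicator (fun t => lineDeriv ℝ M t e) t * q t := by
      ext t
      by_cases ht : t ∈ S
      · rw [Set.indicator_of_mem ht]
      · rw [hqz t ht, mul_zero, mul_zero]
    rw [this]
    exact (measurable_indicator_lineDeriv hMc e).mul hqm
  have key : ∀ᵐ t : Par d, F (t + e) - F t = ∫ s in (0 : ℝ)..1, W (t + s • e) := by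
    filter_upwards [ae_locallyIntegrable_line hM1m hM1 e] with t ht
    have hQc := continuous_line_of_boundary hSo hq.1 hqz hb t
    have h1 := integral_softProductDeriv (M := fun s : ℝ => M (t + s • e))
      (φ := fun s : ℝ => φ (t + s • e)) (Q := fun s : ℝ => q (t + s • e)) hQc
      (fun s₀ hs₀ => ?_) hε
    · simpa only [deriv_comp_line, one_smul, zero_smul, add_zero] using h1
    · have hs₀S : t + s₀ • e ∈ S := by
        by_contra h
        exact hs₀.ne' (hqz _ h)
      obtain ⟨δ₁, hδ₁, hin⟩ := exists_forall_mem_of_isOpen hSo hs₀S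
      obtain ⟨δ₂, hδ₂, hlow⟩ := Metric.mem_nhds_iff.1
        (hQc.continuousAt.eventually (lt_mem_nhds (half_lt_self hs₀)))
      have hδ : 0 < min δ₁ (δ₂ / 2) := by positivity
      set δ := min δ₁ (δ₂ / 2) with hδdef
      have hin' : ∀ s ∈ Set.Icc (s₀ - δ) (s₀ + δ), t + s • e ∈ S := fun s hs =>
        hin s ⟨by linarith [hs.1, min_le_left δ₁ (δ₂ / 2)], by linarith [hs.2, min_le_left δ₁ (δ₂ / 2)]⟩
      have hlow' : ∀ s ∈ Set.Icc (s₀ - δ) (s₀ + δ), q (t + s₀ • e) / 2 < q (t + s • e) := by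
        intro s hs
        refine hlow (Metric.closedBall_subset_ball (half_lt_self hδ₂) ?_)
        rw [Real.closedBall_eq_Icc]
        exact ⟨by linarith [hs.1, min_le_right δ₁ (δ₂ / 2)],
          by linarith [hs.2, min_le_right δ₁ (δ₂ / 2)]⟩
      have hl : t + (s₀ - δ) • e ∈ S := hin' _ ⟨le_rfl, by linarith⟩
      have hr : t + (s₀ + δ) • e ∈ S := hin' _ ⟨by linarith, le_rfl⟩
      refine ⟨δ, hδ, ?_, hφ.comp_line (convex_ball _ _) (by linarith) hl hr,
        hq.comp_line (convex_ball _ _) (by linarith) hl hr⟩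
      have hderiv : ∀ s ∈ Set.Icc (s₀ - δ) (s₀ + δ),
          HasDerivAt (fun s : ℝ => M (t + s • e)) (deriv (fun s : ℝ => M (t + s • e)) s) s := by
        intro s hs
        refine DifferentiableAt.hasDerivAt ?_
        exact DifferentiableAt.comp s (hM _ (hin' s hs)) (by fun_prop)
      refine absolutelyContinuousOnInterval_of_hasDerivAt (by linarith) hderiv ?_
      rw [intervalIntegrable_iff_integrableOn_Icc_of_le (by linarith)]
      -- Near s₀ the density exceeds half its value there, so integrability of M' q along the line
      -- yields that of M'. Everywhere differentiability with integrable derivative then gives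
      -- absolute continuity.
      have hint : IntegrableOn (fun s : ℝ => 2 / q (t + s₀ • e) * (lineDeriv ℝ M (t + s • e) e *
          q (t + s • e))) (Set.Icc (s₀ - δ) (s₀ + δ)) :=
        (ht.integrableOn_isCompact isCompact_Icc).const_mul _
      refine Integrable.mono hint (measurable_deriv _).aestronglyMeasurable.restrict ?_
      rw [ae_restrict_iff' measurableSet_Icc]
      refine Eventually.of_forall fun s hs => ?_
      have hlt := hlow' s hs
      have hs₀' : 0 < q (t + s₀ • e) := hs₀
      have hqs : 0 < q (t + s • e) := (half_pos hs₀').trans hlt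
      rw [deriv_comp_line, norm_mul, norm_mul, Real.norm_of_nonneg hqs.le,
        
        Real.norm_of_nonneg (show (0 : ℝ) ≤ 2 / q (t + s₀ • e) by positivity), mul_left_comm]
      refine le_mul_of_one_le_right (norm_nonneg _) ?_
      rw [div_mul_eq_mul_div, le_div_iff₀ hs₀']
      linarith
  have h2 : ∫ t, (F (t + e) - F t) = 0 := by
    rw [integral_sub (hF.comp_add_right e) hF, integral_add_right_eq_self, sub_self]
  rw [integral_congr_ae key, integral_integral_line hWm hW e] at h2
  exact h2

/-- Dominated convergence as the threshold tends to 0; the dominating function is built from the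
three integrable products in the hypotheses. -/
theorem integral_stein_eq_zero (hq0 : ∀ t, 0 ≤ q t) (hqz : ∀ t ∉ Metric.ball θ₀ r, q t = 0)
    (hq : IsAbsContOn q (Metric.ball θ₀ r))
    (hb : ∀ x ∈ frontier (Metric.ball θ₀ r), Tendsto (fun s : ℝ => q (x + s • e))
      (𝓝[{s : ℝ | x + s • e ∈ Metric.ball θ₀ r}] 0) (𝓝 0))
    (hφ : IsAbsContOn φ (Metric.ball θ₀ r))
    (hM : ∀ t ∈ Metric.ball θ₀ r, DifferentiableAt ℝ M t)
    (hM1 : Integrable fun t => lineDeriv ℝ M t e * q t)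
    (hφ1 : Integrable fun t => lineDeriv ℝ φ t e * q t)
    (hMφ : Integrable fun t => (M t - φ t) * q t)
    (hqd : Integrable fun t => (M t - φ t) * (lineDeriv ℝ q t e / q t) * q t) :
    ∫ t, (lineDeriv ℝ M t e - lineDeriv ℝ φ t e + (M t - φ t) * (lineDeriv ℝ q t e / q t)) * q t
      = 0 := by
  have hu : Tendsto (fun k : ℕ => 1 / ((k : ℝ) + 1)) atTop (𝓝 0) :=
    tendsto_one_div_add_atTop_nhds_zero_nat
  have hu0 : ∀ k : ℕ, 0 < 1 / ((k : ℝ) + 1) := fun k => by positivity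
  have h := fun k => integral_softProductDeriv_eq_zero hq0 hqz hq hb hφ hM hM1 hφ1 hMφ hqd (hu0 k)
  have hlim := tendsto_integral_of_dominated_convergence _
    (fun k => (h k).1.aestronglyMeasurable) ((hM1.abs.add hφ1.abs).add hqd.abs)
    (fun k => Eventually.of_forall fun t => abs_softProductDeriv_le (hu0 k) (hq0 t))
    (Eventually.of_forall fun t => tendsto_softProductDeriv (hq0 t) hu hu0)
  simp only [(h _).2] at hlim
  exact tendsto_nhds_unique hlim tendsto_const_nhds

end Stein

end LAM

namespace LAM

variable {d : ℕ}

/-! ### Nice priors and their information matrices -/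

theorem integral_priorMeasure {q : Par d → ℝ} (hqm : Measurable q) (hq0 : ∀ t, 0 ≤ q t)
    (f : Par d → ℝ) : ∫ t, f t ∂(priorMeasure q) = ∫ t, f t * q t := by
  rw [priorMeasure, integral_withDensity_eq_integral_toReal_smul hqm.ennreal_ofReal (by simp)]
  refine integral_congr_ae (Eventually.of_forall fun t => ?_)
  simp only [ENNReal.toReal_ofReal (hq0 t), smul_eq_mul, mul_comm]

theorem integrable_priorMeasure_iff {q : Par d → ℝ} (hqm : Measurable q) (hq0 : ∀ t, 0 ≤ q t)
    {f : Par d → ℝ} : Integrable f (priorMeasure q) ↔ Integrable fun t => f t * q t := by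
  rw [priorMeasure, integrable_withDensity_iff_integrable_smul' hqm.ennreal_ofReal (by simp)]
  refine integrable_congr (Eventually.of_forall fun t => ?_)
  simp only [ENNReal.toReal_ofReal (hq0 t), smul_eq_mul, mul_comm]

theorem ae_mem_priorMeasure {q : Par d → ℝ} (hqm : Measurable q) {S : Set (Par d)}
    (hqz : ∀ t ∉ S, q t = 0) : ∀ᵐ t ∂(priorMeasure q), t ∈ S := by
  rw [priorMeasure, ae_withDensity_iff hqm.ennreal_ofReal]
  refine Eventually.of_forall fun t ht => ?_
  by_contra h
  exact ht (by rw [hqz t h, ENNReal.ofReal_zero])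

/-- The score `∂ᵢq / q` of a density. -/
noncomputable def priorScore (q : Par d → ℝ) (i : Fin d) (t : Par d) : ℝ := partialDeriv q i t / q t

/-- The information matrix `I(Q) + n ∫ I(t) dQ` of the van Trees inequality. -/
noncomputable def vanTreesInfo (S : Set (Par d)) (I : Par d → Matrix (Fin d) (Fin d) ℝ) (n : ℕ)
    (q : Par d → ℝ) : Matrix (Fin d) (Fin d) ℝ :=
  priorFisherInfo S q + (n : ℝ) • Matrix.of fun i j => ∫ t, I t i j ∂(priorMeasure q)

section Prior

variable {θ₀ : Par d} {r : ℝ} {I : Par d → Matrix (Fin d) (Fin d) ℝ} {φ q : Par d → ℝ}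
  (hq : IsNicePrior (Metric.ball θ₀ r) I φ q)
include hq

theorem IsNicePrior.measurable : Measurable q := by
  have : q = (Metric.ball θ₀ r).indicator q := by
    ext t
    by_cases ht : t ∈ Metric.ball θ₀ r
    · rw [Set.indicator_of_mem ht]
    · rw [Set.indicator_of_notMem ht, hq.eq_zero t ht]
  rw [this]
  exact measurable_indicator_of_continuousOn Metric.isOpen_ball hq.absCont.1

theorem IsNicePrior.integral_eq (f : Par d → ℝ) :
    ∫ t, f t ∂(priorMeasure q) = ∫ t, f t * q t :=
  integral_priorMeasure hq.measurable hq.nonneg f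

theorem IsNicePrior.integrable_iff {f : Par d → ℝ} :
    Integrable f (priorMeasure q) ↔ Integrable fun t => f t * q t :=
  integrable_priorMeasure_iff hq.measurable hq.nonneg

theorem IsNicePrior.ae_mem : ∀ᵐ t ∂(priorMeasure q), t ∈ Metric.ball θ₀ r :=
  ae_mem_priorMeasure hq.measurable hq.eq_zero

theorem IsNicePrior.aestronglyMeasurable {f : Par d → ℝ}
    (hf : Measurable ((Metric.ball θ₀ r).indicator f)) :
    AEStronglyMeasurable f (priorMeasure q) := by
  refine hf.aestronglyMeasurable.congr ?_
  filter_upwards [hq.ae_mem] with t ht using Set.indicator_of_mem ht f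

theorem IsNicePrior.memLp_score (i : Fin d) : MemLp (priorScore q i) 2 (priorMeasure q) := by
  have hm : AEStronglyMeasurable (priorScore q i) (priorMeasure q) := by
    refine hq.aestronglyMeasurable ?_
    have h1 := (measurable_indicator_lineDeriv hq.absCont.1
      (EuclideanSpace.single i (1 : ℝ))).div hq.measurable
    convert h1 using 1
    ext t
    by_cases ht : t ∈ Metric.ball θ₀ r
    · simp only [Set.indicator_of_mem ht, Pi.div_apply]
      rfl
    · simp [Set.indicator_of_notMem ht]
  rw [memLp_two_iff_integrable_sq hm, hq.integrable_iff]
  have h2 := (hq.finite_info i).integrable_of_forall_notMem_eq_zero fun t ht => by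
    rw [hq.eq_zero t ht, div_zero]
  refine h2.congr (Eventually.of_forall fun t => ?_)
  simp only [priorScore]
  rcases (hq.nonneg t).eq_or_lt with h | h
  · simp [← h]
  · field_simp

theorem IsNicePrior.priorFisherInfo_apply (i j : Fin d) :
    priorFisherInfo (Metric.ball θ₀ r) q i j =
      ∫ t, priorScore q i t * priorScore q j t ∂(priorMeasure q) := by
  rw [priorFisherInfo, Matrix.of_apply, hq.integral_eq,
    setIntegral_eq_integral_of_forall_compl_eq_zero fun t ht => by
      rw [hq.eq_zero t ht, div_zero]]
  refine integral_congr_ae (Eventually.of_forall fun t => ?_)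
  simp only [priorScore]
  rcases (hq.nonneg t).eq_or_lt with h | h
  · simp [← h]
  · field_simp

variable (hIm : ∀ i j, Measurable ((Metric.ball θ₀ r).indicator fun t => I t i j))
  (hIle : ∀ t ∈ Metric.ball θ₀ r, ∀ i j, |I t i j| ≤ (I t).trace)
include hIm hIle

theorem IsNicePrior.integrable_info (i j : Fin d) :
    Integrable (fun t => I t i j) (priorMeasure q) := by
  refine hq.integrable_trace.mono' (hq.aestronglyMeasurable (hIm i j)) ?_
  filter_upwards [hq.ae_mem] with t ht using hIle t ht i j

theorem IsNicePrior.vanTreesInfo_quadratic (n : ℕ) (a : Fin d → ℝ) :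
    a ⬝ᵥ (vanTreesInfo (Metric.ball θ₀ r) I n q *ᵥ a) =
      ∫ t, ((∑ i, a i * priorScore q i t) ^ 2 + n * (a ⬝ᵥ (I t *ᵥ a))) ∂(priorMeasure q) := by
  have hint : ∀ i j, Integrable (fun t => priorScore q i t * priorScore q j t + n * I t i j)
      (priorMeasure q) := fun i j =>
    ((hq.memLp_score i).integrable_mul (hq.memLp_score j)).add
      ((hq.integrable_info hIm hIle i j).const_mul _)
  have hentry : ∀ i j, vanTreesInfo (Metric.ball θ₀ r) I n q i j =
      ∫ t, (priorScore q i t * priorScore q j t + n * I t i j) ∂(priorMeasure q) := by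
    intro i j
    have hss : Integrable (fun t => priorScore q i t * priorScore q j t) (priorMeasure q) :=
      (hq.memLp_score i).integrable_mul (hq.memLp_score j)
    rw [integral_add hss ((hq.integrable_info hIm hIle i j).const_mul _), integral_const_mul,
      ← hq.priorFisherInfo_apply]
    rfl
  have e : ∀ t, (∑ i, a i * priorScore q i t) ^ 2 + n * (a ⬝ᵥ (I t *ᵥ a)) =
      ∑ i, ∑ j, a i * (priorScore q i t * priorScore q j t + n * I t i j) * a j := by
    intro t
    rw [sq, Finset.sum_mul_sum]
    simp only [dotProduct, Matrix.mulVec, Finset.mul_sum]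
    rw [← Finset.sum_add_distrib]
    refine Finset.sum_congr rfl fun i _ => ?_
    rw [← Finset.sum_add_distrib]
    exact Finset.sum_congr rfl fun j _ => by ring
  simp_rw [e]
  rw [integral_finsetSum _ fun i _ => integrable_finsetSum _ fun j _ =>
    ((hint i j).const_mul (a i)).mul_const (a j)]
  simp only [dotProduct, Matrix.mulVec, Finset.mul_sum]
  refine Finset.sum_congr rfl fun i _ => ?_
  rw [integral_finsetSum _ fun j _ => ((hint i j).const_mul (a i)).mul_const (a j)]
  refine Finset.sum_congr rfl fun j _ => ?_
  rw [integral_mul_const, integral_const_mul, hentry]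
  ring

/-- The prior's own information is positive definite, and averaging the model information adds a
positive semidefinite matrix. -/
theorem IsNicePrior.posDef_vanTreesInfo (hIp : ∀ t ∈ Metric.ball θ₀ r, (I t).PosSemidef) (n : ℕ) :
    (vanTreesInfo (Metric.ball θ₀ r) I n q).PosDef := by
  refine hq.posDef_info.add_posSemidef (Matrix.PosSemidef.of_dotProduct_mulVec_nonneg ?_ fun x => ?_)
  · ext i j
    simp only [Matrix.conjTranspose_apply, Matrix.smul_apply, Matrix.of_apply, star_trivial]
    congr 1
    refine integral_congr_ae ?_
    filter_upwards [hq.ae_mem] with t ht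
    simpa using (hIp t ht).1.apply i j
  · have e : ∀ t, x ⬝ᵥ (I t *ᵥ x) = ∑ i, ∑ j, x i * I t i j * x j := by
      intro t
      simp only [dotProduct, Matrix.mulVec, Finset.mul_sum]
      exact Finset.sum_congr rfl fun i _ => Finset.sum_congr rfl fun j _ => by ring
    have h1 : 0 ≤ ∫ t, x ⬝ᵥ (I t *ᵥ x) ∂(priorMeasure q) := by
      refine integral_nonneg_of_ae ?_
      filter_upwards [hq.ae_mem] with t ht
      simpa using (hIp t ht).dotProduct_mulVec_nonneg x
    have h2 : ∫ t, x ⬝ᵥ (I t *ᵥ x) ∂(priorMeasure q) =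
        x ⬝ᵥ ((Matrix.of fun i j => ∫ t, I t i j ∂(priorMeasure q)) *ᵥ x) := by
      simp_rw [e]
      have hint := hq.integrable_info hIm hIle
      rw [integral_finsetSum _ fun i _ => integrable_finsetSum _ fun j _ =>
        ((hint i j).const_mul (x i)).mul_const (x j)]
      simp only [dotProduct, Matrix.mulVec, Finset.mul_sum, Matrix.of_apply]
      refine Finset.sum_congr rfl fun i _ => ?_
      rw [integral_finsetSum _ fun j _ => ((hint i j).const_mul (x i)).mul_const (x j)]
      refine Finset.sum_congr rfl fun j _ => ?_
      rw [integral_mul_const, integral_const_mul]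
      ring
    rw [Matrix.smul_mulVec, dotProduct_smul, star_trivial, ← h2]
    exact smul_nonneg n.cast_nonneg h1

end Prior

end LAM

namespace LAM

variable {d : ℕ} {𝒳 : Type*} [MeasurableSpace 𝒳]

/-! ### The van Trees inequality with an approximating functional -/

theorem sum_smul_single (a : Par d) : ∑ i, a i • EuclideanSpace.single i (1 : ℝ) = a := by
  ext j
  simp [Finset.sum_apply, Pi.single_apply]

/-- Two-dimensional Cauchy–Schwarz for the vectors (√V, x) and (√J, c). It merges Cramér–Rao with
the contribution of the prior score. -/
theorem sq_add_mul_le {D x c V J : ℝ} (hV : 0 ≤ V) (hJ : 0 ≤ J) (hD : D ^ 2 ≤ V * J) :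
    (D + x * c) ^ 2 ≤ (V + x ^ 2) * (J + c ^ 2) := by
  have h1 : D * (x * c) ≤ (V * c ^ 2 + x ^ 2 * J) / 2 := by
    have h2 : |D| ≤ √V * √J := by
      rw [← Real.sqrt_mul hV]
      exact Real.abs_le_sqrt hD
    have h3 : D * (x * c) ≤ |D| * |x * c| := by
      rw [← abs_mul]
      exact le_abs_self _
    have h4 : |D| * |x * c| ≤ (√V * |c|) * (√J * |x|) := by
      rw [abs_mul]
      have := mul_le_mul_of_nonneg_right h2 (mul_nonneg (abs_nonneg x) (abs_nonneg c))
      linarith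
    have h5 := two_mul_le_add_sq (√V * |c|) (√J * |x|)
    rw [mul_pow, mul_pow, Real.sq_sqrt hV, Real.sq_sqrt hJ, sq_abs, sq_abs] at h5
    linarith
  nlinarith

theorem sqrt_integral_sq_add_le {Ω : Type*} [MeasurableSpace Ω] {μ : Measure Ω}
    [IsProbabilityMeasure μ] {g : Ω → ℝ} (hg : MemLp g 2 μ) {ρ : ℝ} (hρ : 0 ≤ ρ) :
    ∫ t, (ρ + |g t|) ^ 2 ∂μ ≤ (ρ + √(∫ t, g t ^ 2 ∂μ)) ^ 2 := by
  have e : ∀ t, (ρ + |g t|) ^ 2 = ρ ^ 2 + 2 * ρ * |g t| + g t ^ 2 := fun t => by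
    rw [add_sq, sq_abs]
  have h1 : Integrable (fun t => |g t|) μ := (hg.integrable (by norm_num)).abs
  have h2 : Integrable (fun t => ρ ^ 2 + 2 * ρ * |g t|) μ :=
    (integrable_const _).add (h1.const_mul _)
  simp_rw [e]
  rw [integral_add h2 hg.integrable_sq, integral_add (integrable_const _) (h1.const_mul _),
    integral_const_mul]
  have h3 : ∫ t, |g t| ∂μ ≤ √(∫ t, g t ^ 2 ∂μ) := by
    have hga : MemLp (fun t => |g t|) 2 μ := hg.abs
    have := sq_integral_mul_le (memLp_const (1 : ℝ) (μ := μ) (p := 2)) hga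
    simp only [one_mul, one_pow, sq_abs, integral_const, probReal_univ, smul_eq_mul, mul_one] at this
    exact Real.le_sqrt_of_sq_le this
  have h4 : 0 ≤ ∫ t, g t ^ 2 ∂μ := integral_nonneg fun _ => sq_nonneg _
  rw [add_sq, Real.sq_sqrt h4]
  simp only [integral_const, probReal_univ, smul_eq_mul, one_mul]
  nlinarith

theorem abs_le_one_add_of_sq_le {D X : ℝ} (h : D ^ 2 ≤ X) : |D| ≤ 1 + X := by
  rw [← sq_abs D] at h
  nlinarith [sq_nonneg (|D| - 1), abs_nonneg D]

theorem integral_sub_sq_eq_variance_add {Ω : Type*} [MeasurableSpace Ω] {μ : Measure Ω}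
    [IsProbabilityMeasure μ] {T : Ω → ℝ} (hT : MemLp T 2 μ) (c : ℝ) :
    ∫ x, (T x - c) ^ 2 ∂μ = ∫ x, (T x - ∫ y, T y ∂μ) ^ 2 ∂μ + (∫ y, T y ∂μ - c) ^ 2 := by
  set m := ∫ y, T y ∂μ with hm
  have h1 : MemLp (fun x => T x - m) 2 μ := hT.sub (memLp_const m)
  have e : ∀ x, (T x - c) ^ 2 = (T x - m) ^ 2 + 2 * (m - c) * (T x - m) + (m - c) ^ 2 := fun x => by
    ring
  have h2 : Integrable (fun x => 2 * (m - c) * (T x - m)) μ :=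
    (h1.integrable (by norm_num)).const_mul _
  have h3 : Integrable (fun x => (T x - m) ^ 2 + 2 * (m - c) * (T x - m)) μ :=
    h1.integrable_sq.add h2
  simp_rw [e]
  rw [integral_add h3 (integrable_const _), integral_add h1.integrable_sq h2, integral_const_mul,
    integral_sub (hT.integrable (by norm_num)) (integrable_const _)]
  simp [← hm]

section Model

variable {ν : Measure 𝒳} [SigmaFinite ν] {P : Par d → Measure 𝒳} {Θ : Set (Par d)}
  {ξ : Par d → 𝒳 → Par d} (M : IsHellingerModel ν P Θ ξ)
include M

theorem IsHellingerModel.fisherInfo_quadratic_nonneg {t : Par d} (ht : t ∈ Θ) (a : Par d) :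
    0 ≤ (a : Fin d → ℝ) ⬝ᵥ (fisherInfo ν (ξ t) *ᵥ a) := by
  rw [M.fisherInfo_quadratic ht]
  exact mul_nonneg (by norm_num) (integral_nonneg fun _ => sq_nonneg _)

theorem IsHellingerModel.posSemidef_fisherInfo {t : Par d} (ht : t ∈ Θ) :
    (fisherInfo ν (ξ t)).PosSemidef := by
  refine Matrix.PosSemidef.of_dotProduct_mulVec_nonneg ?_ fun x => ?_
  · ext i j
    simp [fisherInfo, mul_comm]
  · simpa using M.fisherInfo_quadratic_nonneg ht (WithLp.toLp 2 x)

section Bound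

variable {θ₀ : Par d} {r : ℝ} (hS : Metric.ball θ₀ r ⊆ interior Θ) {n : ℕ} {T : (Fin n → 𝒳) → ℝ}
  (hT : Measurable T) {C : ℝ} (hC : ∀ x, |T x| ≤ C) {φ q : Par d → ℝ}
  (hφ : IsAbsContOn φ (Metric.ball θ₀ r))
  (hq : IsNicePrior (Metric.ball θ₀ r) (fun t => fisherInfo ν (ξ t)) φ q)
include hS hT hC hq

/-- By Cramér–Rao the squared derivative is bounded by a multiple of the trace of the Fisher
information plus, through |D| ≤ 1 + D², a constant; the prior integrates the trace. -/
theorem IsHellingerModel.integrable_partialDeriv_integral (i : Fin d) :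
    Integrable (partialDeriv (fun θ => ∫ x, T x ∂(iidLaw P n θ)) i) (priorMeasure q) := by
  have hQ := hq.isProbabilityMeasure
  have hdiff : ∀ t ∈ Metric.ball θ₀ r,
      DifferentiableAt ℝ (fun θ => ∫ x, T x ∂(iidLaw P n θ)) t := fun t ht =>
    M.differentiableAt_integral_iid (hS ht) hT hC
  have hc : ContinuousOn (fun θ => ∫ x, T x ∂(iidLaw P n θ)) (Metric.ball θ₀ r) := fun t ht =>
    (hdiff t ht).continuousAt.continuousWithinAt
  have hm : AEStronglyMeasurable (fun t => lineDeriv ℝ (fun θ => ∫ x, T x ∂(iidLaw P n θ)) t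
      (EuclideanSpace.single i (1 : ℝ))) (priorMeasure q) :=
    hq.aestronglyMeasurable (measurable_indicator_lineDeriv hc _)
  have hg : Integrable (fun t => 1 + (2 * C) ^ 2 * (n * (fisherInfo ν (ξ t)).trace))
      (priorMeasure q) :=
    (integrable_const _).add ((hq.integrable_trace.const_mul _).const_mul _)
  refine hg.mono' hm ?_
  filter_upwards [hq.ae_mem] with t ht
  have htΘ := interior_subset (hS ht)
  have hp := M.isProbabilityMeasure_iidLaw htΘ n
  have h1 := M.cramerRao (hS ht) hT hC (EuclideanSpace.single i 1)
  have h2 : partialDeriv (fun θ => ∫ x, T x ∂(iidLaw P n θ)) i t =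
      fderiv ℝ (fun θ => ∫ x, T x ∂(iidLaw P n θ)) t (EuclideanSpace.single i 1) :=
    (hdiff t ht).lineDeriv_eq_fderiv
  have h3 : ∫ x, (T x - ∫ y, T y ∂(iidLaw P n t)) ^ 2 ∂(iidLaw P n t) ≤ (2 * C) ^ 2 := by
    refine (abs_le.1 (abs_integral_le_of_abs_le fun x => ?_)).2
    rw [abs_of_nonneg (sq_nonneg _), ← sq_abs]
    refine pow_le_pow_left₀ (abs_nonneg _) ((abs_sub _ _).trans ?_) 2
    have := abs_integral_le_of_abs_le (μ := iidLaw P n t) hC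
    linarith [hC x]
  have h4 : ((EuclideanSpace.single i (1 : ℝ) : Par d) : Fin d → ℝ) ⬝ᵥ
      (fisherInfo ν (ξ t) *ᵥ (EuclideanSpace.single i (1 : ℝ) : Par d)) ≤
      (fisherInfo ν (ξ t)).trace := by
    refine le_trans (le_of_eq ?_) (fisherInfo_diag_le_trace ν (ξ t) i)
    simp
  have h5 := M.fisherInfo_quadratic_nonneg htΘ (EuclideanSpace.single i 1)
  rw [h2, Real.norm_eq_abs]
  exact abs_le_one_add_of_sq_le (h1.trans (mul_le_mul h3
    (mul_le_mul_of_nonneg_left h4 n.cast_nonneg) (mul_nonneg n.cast_nonneg h5) (sq_nonneg _)))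

include hφ in
-- Let a solve A a = ∫ ∇φ dQ, with A the van Trees information. Then Γ is both aᵀ A a and the
-- integral of D_a m + (m - φ) s, where s is the prior score in direction a. Bounding the second
-- expression pointwise yields Γ ≤ (√ρ + ‖ψ - φ‖_{L²(Q)}) √Γ.
theorem IsHellingerModel.sqrt_vanTreesGamma_le {ψ : Par d → ℝ}
    (hψ : ContinuousOn ψ (Metric.ball θ₀ r)) {K : ℝ} (hK : ∀ θ ∈ Metric.ball θ₀ r, |ψ θ| ≤ K) {ρ : ℝ}
    (hρ : ∀ t ∈ Metric.ball θ₀ r, ∫ x, (T x - ψ t) ^ 2 ∂(iidLaw P n t) ≤ ρ)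
    (hψφ : Integrable (fun t => (ψ t - φ t) ^ 2) (priorMeasure q)) :
    √(vanTreesGamma (Metric.ball θ₀ r) (fun t => fisherInfo ν (ξ t)) n φ q) ≤
      √ρ + √(∫ t, (ψ t - φ t) ^ 2 ∂(priorMeasure q)) := by
  set S := Metric.ball θ₀ r with hSdef
  set I : Par d → Matrix (Fin d) (Fin d) ℝ := fun t => fisherInfo ν (ξ t) with hI
  set Q := priorMeasure q with hQdef
  have hQ : IsProbabilityMeasure Q := hq.isProbabilityMeasure
  have hSo : IsOpen S := Metric.isOpen_ball
  set m : Par d → ℝ := fun θ => ∫ x, T x ∂(iidLaw P n θ) with hmdef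
  have hdiff : ∀ t ∈ S, DifferentiableAt ℝ m t := fun t ht =>
    M.differentiableAt_integral_iid (hS ht) hT hC
  have hmc : ContinuousOn m S := fun t ht => (hdiff t ht).continuousAt.continuousWithinAt
  have hIm := M.measurable_indicator_fisherInfo hSo hS
  have hIle : ∀ t ∈ S, ∀ i j, |I t i j| ≤ (I t).trace := fun t ht =>
    M.abs_fisherInfo_le_trace (interior_subset (hS ht))
  have hmC : ∀ t ∈ S, |m t| ≤ C := fun t ht => by
    have := M.isProbabilityMeasure_iidLaw (interior_subset (hS ht)) n
    exact abs_integral_le_of_abs_le hC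
  have mψφ : MemLp (fun t => ψ t - φ t) 2 Q := by
    refine (memLp_two_iff_integrable_sq (hq.aestronglyMeasurable ?_)).2 hψφ
    have := (measurable_indicator_of_continuousOn hSo hψ).sub
      (measurable_indicator_of_continuousOn hSo hφ.1)
    rwa [← Set.indicator_sub'] at this
  have mmψ : MemLp (fun t => m t - ψ t) 2 Q := by
    refine MemLp.of_bound (hq.aestronglyMeasurable ?_) (C + K) ?_
    · have := (measurable_indicator_of_continuousOn hSo hmc).sub
        (measurable_indicator_of_continuousOn hSo hψ)
      rwa [← Set.indicator_sub'] at this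
    · filter_upwards [hq.ae_mem] with t ht
      exact (abs_sub _ _).trans (add_le_add (hmC t ht) (hK t ht))
  have mmφ : MemLp (fun t => m t - φ t) 2 Q := by
    convert mmψ.add mψφ using 1
    ext t
    simp only [Pi.add_apply]
    ring
  have hj1 : ∀ i, Integrable (partialDeriv m i) Q :=
    M.integrable_partialDeriv_integral hS hT hC hq
  have hj3 : ∀ i, Integrable (fun t => (m t - φ t) * priorScore q i t) Q := fun i =>
    mmφ.integrable_mul (hq.memLp_score i)
  have hj13 : ∀ i, Integrable (fun t => partialDeriv m i t + (m t - φ t) * priorScore q i t) Q :=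
    fun i => (hj1 i).add (hj3 i)
  -- Integration by parts trades the derivative of φ for that of m plus a score term. It is applied
  -- to m - φ, so no integral of q against a boundary value remains.
  have hstein : ∀ i, ∫ t, partialDeriv φ i t ∂Q =
      ∫ t, (partialDeriv m i t + (m t - φ t) * priorScore q i t) ∂Q := by
    intro i
    have j1 := hj1 i
    have j2 := hq.integrable_grad i
    have j3 := hj3 i
    have h0 := integral_stein_eq_zero (e := EuclideanSpace.single i 1) hq.nonneg hq.eq_zero
      hq.absCont (fun x hx => hq.boundary x hx i) hφ hdiff (hq.integrable_iff.1 j1)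
      (hq.integrable_iff.1 j2) (hq.integrable_iff.1 (mmφ.integrable (by norm_num)))
      (hq.integrable_iff.1 j3)
    rw [← hq.integral_eq] at h0
    have h1 : ∫ t, (partialDeriv m i t - partialDeriv φ i t + (m t - φ t) * priorScore q i t) ∂Q = 0 :=
      h0
    have h2 : ∫ t, (partialDeriv m i t + (m t - φ t) * priorScore q i t) ∂Q -
        ∫ t, partialDeriv φ i t ∂Q = 0 := by
      rw [← integral_sub (hj13 i) j2, ← h1]
      exact integral_congr_ae (Eventually.of_forall fun t => by ring)
    linarith
  set g : Fin d → ℝ := fun i => ∫ t, partialDeriv φ i t ∂Q with hg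
  set A := vanTreesInfo S I n q with hA
  have hApd : A.PosDef := hq.posDef_vanTreesInfo hIm hIle
    (fun t ht => M.posSemidef_fisherInfo (interior_subset (hS ht))) n
  set a : Par d := WithLp.toLp 2 (A⁻¹ *ᵥ g) with ha
  have hAa : A *ᵥ (a : Fin d → ℝ) = g := by
    simp only [ha]
    rw [Matrix.mulVec_mulVec, Matrix.mul_nonsing_inv _ ((Matrix.isUnit_iff_isUnit_det _).1 hApd.isUnit),
      Matrix.one_mulVec]
  have hΓ : vanTreesGamma S I n φ q = (a : Fin d → ℝ) ⬝ᵥ g := by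
    rw [dotProduct_comm]
    rfl
  set Γ := vanTreesGamma S I n φ q with hΓdef
  set s : Par d → ℝ := fun t => ∑ i, a i * priorScore q i t with hs
  have ms : MemLp s 2 Q := memLp_finsetSum _ fun i _ => (hq.memLp_score i).const_mul _
  have hΓ2 : Γ = ∫ t, (s t ^ 2 + n * ((a : Fin d → ℝ) ⬝ᵥ (I t *ᵥ a))) ∂Q := by
    rw [hΓ, ← hq.vanTreesInfo_quadratic hIm hIle, hAa]
  have hΓ1 : Γ = ∫ t, (fderiv ℝ m t a + (m t - φ t) * s t) ∂Q := by
    rw [hΓ, dotProduct]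
    simp_rw [hg, hstein, ← integral_const_mul]
    rw [← integral_finsetSum _ fun i _ => (hj13 i).const_mul (a i)]
    refine integral_congr_ae ?_
    filter_upwards [hq.ae_mem] with t ht
    have h1 : fderiv ℝ m t a = ∑ i, a i * partialDeriv m i t := by
      conv_lhs => rw [← sum_smul_single a]
      rw [map_sum]
      refine Finset.sum_congr rfl fun i _ => ?_
      rw [map_smul, smul_eq_mul, partialDeriv, (hdiff t ht).lineDeriv_eq_fderiv]
    rw [h1, hs]
    simp only [Finset.mul_sum]
    rw [← Finset.sum_add_distrib]
    exact Finset.sum_congr rfl fun i _ => by ring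
  set J : Par d → ℝ := fun t => n * ((a : Fin d → ℝ) ⬝ᵥ (I t *ᵥ a)) with hJ
  have hJ0 : ∀ t ∈ S, 0 ≤ J t := fun t ht =>
    mul_nonneg n.cast_nonneg (M.fisherInfo_quadratic_nonneg (interior_subset (hS ht)) a)
  have hJi : Integrable J Q := by
    have e : J = fun t => ∑ i, ∑ j, n * (a i * a j) * I t i j := by
      ext t
      simp only [hJ, dotProduct, Matrix.mulVec, Finset.mul_sum]
      exact Finset.sum_congr rfl fun i _ => Finset.sum_congr rfl fun j _ => by ring
    rw [e]
    exact integrable_finsetSum _ fun i _ => integrable_finsetSum _ fun j _ =>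
      (hq.integrable_info hIm hIle i j).const_mul _
  have hvi : Integrable (fun t => s t ^ 2 + J t) Q := ms.integrable_sq.add hJi
  have hΓ0 : 0 ≤ Γ := by
    rw [hΓ2]
    refine integral_nonneg_of_ae ?_
    filter_upwards [hq.ae_mem] with t ht using add_nonneg (sq_nonneg _) (hJ0 t ht)
  have hvsq : ∀ᵐ t ∂Q, √(s t ^ 2 + J t) ^ 2 = s t ^ 2 + J t := by
    filter_upwards [hq.ae_mem] with t ht
    exact Real.sq_sqrt (add_nonneg (sq_nonneg _) (hJ0 t ht))
  have mv : MemLp (fun t => √(s t ^ 2 + J t)) 2 Q := by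
    have hvm : AEStronglyMeasurable (fun t => √(s t ^ 2 + J t)) Q :=
      Real.continuous_sqrt.comp_aestronglyMeasurable hvi.1
    have hv2 : Integrable (fun t => √(s t ^ 2 + J t) ^ 2) Q :=
      hvi.congr (hvsq.mono fun t ht => ht.symm)
    exact (memLp_two_iff_integrable_sq hvm).2 hv2
  have mabs : MemLp (fun t => |ψ t - φ t|) 2 Q := mψφ.abs
  have mconst : MemLp (fun _ : Par d => √ρ) 2 Q := memLp_const _
  have mu : MemLp (fun t => √ρ + |ψ t - φ t|) 2 Q := mconst.add mabs
  -- Cramér–Rao bounds the derivative of m by the variance, and variance plus squared bias is the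
  -- risk at t; replacing ψ by φ in the bias costs |ψ - φ|.
  have hpt : ∀ᵐ t ∂Q, ‖fderiv ℝ m t a + (m t - φ t) * s t‖ ≤
      (√ρ + |ψ t - φ t|) * √(s t ^ 2 + J t) := by
    filter_upwards [hq.ae_mem] with t ht
    have htΘ := interior_subset (hS ht)
    have hp := M.isProbabilityMeasure_iidLaw htΘ n
    have hTL : MemLp T 2 (iidLaw P n t) :=
      MemLp.of_bound hT.aestronglyMeasurable C (Eventually.of_forall hC)
    have h1 := M.cramerRao (hS ht) hT hC a
    have h2 := hρ t ht
    rw [integral_sub_sq_eq_variance_add hTL] at h2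
    set V := ∫ x, (T x - m t) ^ 2 ∂(iidLaw P n t) with hV
    have hV0 : 0 ≤ V := integral_nonneg fun _ => sq_nonneg _
    have h3 := sq_add_mul_le (x := m t - φ t) (c := s t) hV0 (hJ0 t ht) h1
    change V + (m t - ψ t) ^ 2 ≤ ρ at h2
    have hρ0 : 0 ≤ ρ := by nlinarith [sq_nonneg (m t - ψ t)]
    have h4 : |m t - ψ t| ≤ √ρ := Real.abs_le_sqrt (by linarith)
    have h5 : V + (m t - φ t) ^ 2 ≤ (√ρ + |ψ t - φ t|) ^ 2 := by
      have h6 : (m t - ψ t) * (ψ t - φ t) ≤ √ρ * |ψ t - φ t| := by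
        refine (le_abs_self _).trans ?_
        rw [abs_mul]
        exact mul_le_mul_of_nonneg_right h4 (abs_nonneg _)
      have h7 : (m t - φ t) ^ 2 = (m t - ψ t) ^ 2 + 2 * ((m t - ψ t) * (ψ t - φ t)) +
          (ψ t - φ t) ^ 2 := by ring
      rw [add_sq, Real.sq_sqrt hρ0, sq_abs, h7]
      linarith
    rw [Real.norm_eq_abs]
    refine abs_le_of_sq_le_sq ?_ (by positivity)
    rw [mul_pow, Real.sq_sqrt (add_nonneg (sq_nonneg _) (hJ0 t ht)), add_comm (s t ^ 2)]
    exact h3.trans (mul_le_mul_of_nonneg_right h5 (add_nonneg (hJ0 t ht) (sq_nonneg _)))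
  have hCS : Γ ^ 2 ≤ (√ρ + √(∫ t, (ψ t - φ t) ^ 2 ∂Q)) ^ 2 * Γ := by
    have h1 : |Γ| ≤ ∫ t, (√ρ + |ψ t - φ t|) * √(s t ^ 2 + J t) ∂Q := by
      rw [hΓ1]
      exact norm_integral_le_of_norm_le (mu.integrable_mul mv) hpt
    have h2 := sq_integral_mul_le mu mv
    rw [integral_congr_ae hvsq, ← hΓ2] at h2
    have h3 := sqrt_integral_sq_add_le mψφ (Real.sqrt_nonneg ρ)
    calc Γ ^ 2 = |Γ| ^ 2 := (sq_abs Γ).symm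
      _ ≤ (∫ t, (√ρ + |ψ t - φ t|) * √(s t ^ 2 + J t) ∂Q) ^ 2 :=
        pow_le_pow_left₀ (abs_nonneg _) h1 2
      _ ≤ _ := h2
      _ ≤ _ := mul_le_mul_of_nonneg_right h3 hΓ0
  -- A factor Γ is cancelled, so Γ = 0 is treated apart.
  rcases hΓ0.eq_or_lt with h | h
  · rw [← h, Real.sqrt_zero]
    positivity
  · refine Real.sqrt_le_iff.2 ⟨by positivity, ?_⟩
    rw [sq] at hCS
    exact le_of_mul_le_mul_right hCS h

end Bound

theorem IsHellingerModel.approximationBound_le {θ₀ : Par d} {r : ℝ}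
    (hS : Metric.ball θ₀ r ⊆ interior Θ) {n : ℕ} {ψ : Par d → ℝ}
    (hψ : ContinuousOn ψ (Metric.ball θ₀ r)) {K : ℝ} (hK : ∀ θ ∈ Metric.ball θ₀ r, |ψ θ| ≤ K) :
    approximationBound (fun t => fisherInfo ν (ξ t)) ψ n (Metric.ball θ₀ r) ≤
      minimaxRisk P ψ n (Metric.ball θ₀ r) := by
  refine le_minimaxRisk_of_bounded hK fun T hT hTK => iSup₂_le fun φ hφ => iSup₂_le fun q hq => ?_
  set ρ := ⨆ θ ∈ Metric.ball θ₀ r, ∫⁻ x, ENNReal.ofReal ((T x - ψ θ) ^ 2) ∂(iidLaw P n θ) with hρdef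
  by_cases hρ : ρ = ⊤
  · rw [hρ]
    exact le_top
  set B := ∫⁻ t, ENNReal.ofReal ((ψ t - φ t) ^ 2) ∂(priorMeasure q) with hB
  by_cases hBt : B = ⊤
  · rw [hBt, ENNReal.top_rpow_of_pos (by norm_num), ENNReal.sub_top]
    simp
  have hm : AEStronglyMeasurable (fun t => (ψ t - φ t) ^ 2) (priorMeasure q) := by
    refine (hq.aestronglyMeasurable (f := fun t => ψ t - φ t) ?_).pow 2
    have := (measurable_indicator_of_continuousOn Metric.isOpen_ball hψ).sub
      (measurable_indicator_of_continuousOn Metric.isOpen_ball hφ.1)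
    rwa [← Set.indicator_sub'] at this
  have hψφ : Integrable (fun t => (ψ t - φ t) ^ 2) (priorMeasure q) :=
    ⟨hm, by
      rw [hasFiniteIntegral_iff_ofReal (Eventually.of_forall fun t => sq_nonneg _)]
      exact lt_top_iff_ne_top.2 hBt⟩
  have hBr : B = ENNReal.ofReal (∫ t, (ψ t - φ t) ^ 2 ∂(priorMeasure q)) :=
    (ofReal_integral_eq_lintegral_ofReal hψφ (Eventually.of_forall fun t => sq_nonneg _)).symm
  have hrisk : ∀ t ∈ Metric.ball θ₀ r, ∫ x, (T x - ψ t) ^ 2 ∂(iidLaw P n t) ≤ ρ.toReal := by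
    intro t ht
    rw [integral_eq_lintegral_of_nonneg_ae (Eventually.of_forall fun x => sq_nonneg _)
      ((hT.sub_const _).pow_const 2).aestronglyMeasurable]
    exact ENNReal.toReal_mono hρ (le_iSup₂_of_le t ht le_rfl)
  have key := M.sqrt_vanTreesGamma_le hS hT hTK hφ hq hψ hK hrisk hψφ
  set Γ := vanTreesGamma (Metric.ball θ₀ r) (fun t => fisherInfo ν (ξ t)) n φ q with hΓ
  have e : ∀ x : ℝ, ENNReal.ofReal x ^ (1 / 2 : ℝ) = ENNReal.ofReal √x := fun x => by
    rcases le_or_gt 0 x with hx | hx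
    · rw [ENNReal.ofReal_rpow_of_nonneg hx (by norm_num), Real.sqrt_eq_rpow]
    · rw [ENNReal.ofReal_of_nonpos hx.le, Real.sqrt_eq_zero_of_nonpos hx.le]
      simp
  rw [hBr, e, e, ← ENNReal.ofReal_sub _ (Real.sqrt_nonneg _)]
  calc ENNReal.ofReal (√Γ - √(∫ t, (ψ t - φ t) ^ 2 ∂(priorMeasure q))) ^ 2
      ≤ ENNReal.ofReal √ρ.toReal ^ 2 := by
        gcongr
        linarith
    _ = ρ := by
        rw [← ENNReal.ofReal_pow (Real.sqrt_nonneg _), Real.sq_sqrt ENNReal.toReal_nonneg,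
          ENNReal.ofReal_toReal hρ]

end Model

end LAM

namespace LAM

variable {d : ℕ}

/-! ### A nice prior on a ball -/

theorem IsAbsContOn.of_contDiff {f g : Par d → ℝ} {S : Set (Par d)} (hf : ContDiff ℝ 1 f)
    (hfg : ∀ t ∈ S, g t = f t) : IsAbsContOn g S := by
  refine ⟨hf.continuous.continuousOn.congr hfg, fun a b hab => ?_⟩
  have h1 : ContDiff ℝ 1 fun s : ℝ => f (a + s • (b - a)) := hf.comp (by fun_prop)
  have h2 := h1.contDiffOn.absolutelyContinuousOnInterval (a := (0 : ℝ)) (b := 1)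
  rw [absolutelyContinuousOnInterval_iff] at h2 ⊢
  intro ε hε
  obtain ⟨δ, hδ, h⟩ := h2 ε hε
  refine ⟨δ, hδ, fun E hE hEδ => ?_⟩
  have e : ∀ s ∈ Set.uIcc (0 : ℝ) 1, g (a + s • (b - a)) = f (a + s • (b - a)) := by
    intro s hs
    rw [Set.uIcc_of_le zero_le_one] at hs
    refine hfg _ (hab ?_)
    rw [segment_eq_image']
    exact ⟨s, hs, rfl⟩
  convert h E hE hEδ using 1
  exact Finset.sum_congr rfl fun i hi => by rw [e _ (hE.1 i hi).1, e _ (hE.1 i hi).2]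

/-- The mass of the kernel `(r² - ‖t - θ₀‖²)²` on the ball of radius `r` at `θ₀`. -/
noncomputable def biweightMass (θ₀ : Par d) (r : ℝ) : ℝ :=
  ∫ t in Metric.ball θ₀ r, (r ^ 2 - ‖t - θ₀‖ ^ 2) ^ 2

/-- The biweight density on the ball of radius `r` at `θ₀`. -/
noncomputable def biweight (θ₀ : Par d) (r : ℝ) : Par d → ℝ :=
  (Metric.ball θ₀ r).indicator fun t => (biweightMass θ₀ r)⁻¹ * (r ^ 2 - ‖t - θ₀‖ ^ 2) ^ 2

theorem integrableOn_ball_of_continuous {f : Par d → ℝ} (hf : Continuous f) (θ₀ : Par d) (r : ℝ) :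
    IntegrableOn f (Metric.ball θ₀ r) :=
  (hf.continuousOn.integrableOn_compact (isCompact_closedBall θ₀ r)).mono_set
    Metric.ball_subset_closedBall

theorem volume_real_ball_half (θ₀ : Par d) {r : ℝ} (hr : 0 < r) :
    volume.real (Metric.ball θ₀ (r / 2)) = (1 / 2) ^ d * volume.real (Metric.ball θ₀ r) := by
  rw [measureReal_def, measureReal_def, Measure.addHaar_ball_of_pos _ _ (half_pos hr),
    Measure.addHaar_ball_of_pos _ _ hr, ENNReal.toReal_mul, ENNReal.toReal_mul,
    ENNReal.toReal_ofReal (by positivity), ENNReal.toReal_ofReal (by positivity),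
    finrank_euclideanSpace_fin]
  rw [div_pow, div_pow]
  ring

theorem volume_real_ball_pos (θ₀ : Par d) {r : ℝ} (hr : 0 < r) :
    0 < volume.real (Metric.ball θ₀ r) := by
  rw [measureReal_def]
  exact ENNReal.toReal_pos (Metric.measure_ball_pos volume θ₀ hr).ne' measure_ball_lt_top.ne

/-- On the ball of half the radius r² - ‖t - θ₀‖² ≥ (3/4) r², whence 9/16; the power of 1/2 is the
volume ratio. -/
theorem le_biweightMass (θ₀ : Par d) {r : ℝ} (hr : 0 < r) :
    9 / 16 * r ^ 4 * ((1 / 2) ^ d * volume.real (Metric.ball θ₀ r)) ≤ biweightMass θ₀ r := by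
  rw [← volume_real_ball_half θ₀ hr]
  have hc : Continuous fun t : Par d => (r ^ 2 - ‖t - θ₀‖ ^ 2) ^ 2 := by fun_prop
  have h1 : ∫ t in Metric.ball θ₀ (r / 2), (r ^ 2 - ‖t - θ₀‖ ^ 2) ^ 2 ≤ biweightMass θ₀ r :=
    setIntegral_mono_set (integrableOn_ball_of_continuous hc θ₀ r)
      (Eventually.of_forall fun t => sq_nonneg _)
      (Metric.ball_subset_ball (by linarith)).eventuallyLE
  refine le_trans ?_ h1
  have h2 : ∫ _t in Metric.ball θ₀ (r / 2), 9 / 16 * r ^ 4 ≤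
      ∫ t in Metric.ball θ₀ (r / 2), (r ^ 2 - ‖t - θ₀‖ ^ 2) ^ 2 := by
    refine setIntegral_mono_on (integrableOn_ball_of_continuous continuous_const _ _)
      (integrableOn_ball_of_continuous hc _ _) measurableSet_ball fun t ht => ?_
    rw [mem_ball_iff_norm] at ht
    have h3 : 3 / 4 * r ^ 2 ≤ r ^ 2 - ‖t - θ₀‖ ^ 2 := by nlinarith [norm_nonneg (t - θ₀)]
    have := pow_le_pow_left₀ (by positivity) h3 2
    nlinarith
  rw [setIntegral_const, smul_eq_mul, mul_comm] at h2
  exact h2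

theorem biweightMass_pos (θ₀ : Par d) {r : ℝ} (hr : 0 < r) : 0 < biweightMass θ₀ r := by
  have := volume_real_ball_pos θ₀ hr
  exact lt_of_lt_of_le (by positivity) (le_biweightMass θ₀ hr)

theorem norm_add_smul_single_sq (x : Par d) (i : Fin d) (s : ℝ) :
    ‖x + s • EuclideanSpace.single i (1 : ℝ)‖ ^ 2 = ‖x‖ ^ 2 + 2 * s * x i + s ^ 2 := by
  rw [norm_add_sq_real, inner_smul_right, EuclideanSpace.inner_single_right, norm_smul]
  simp only [conj_trivial, one_mul, mul_one, PiLp.norm_single, norm_one, Real.norm_eq_abs, sq_abs]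
  ring

theorem partialDeriv_biweight {θ₀ : Par d} {r : ℝ} {t : Par d} (ht : t ∈ Metric.ball θ₀ r)
    (i : Fin d) : partialDeriv (biweight θ₀ r) i t =
      -4 * (biweightMass θ₀ r)⁻¹ * (r ^ 2 - ‖t - θ₀‖ ^ 2) * (t - θ₀) i := by
  have h1 : biweight θ₀ r =ᶠ[𝓝 t] fun t => (biweightMass θ₀ r)⁻¹ * (r ^ 2 - ‖t - θ₀‖ ^ 2) ^ 2 := by
    filter_upwards [Metric.isOpen_ball.mem_nhds ht] with s hs using Set.indicator_of_mem hs _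
  rw [partialDeriv, h1.lineDeriv_eq, lineDeriv]
  have e : ∀ s : ℝ, t + s • EuclideanSpace.single i (1 : ℝ) - θ₀ =
      (t - θ₀) + s • EuclideanSpace.single i (1 : ℝ) := fun s => by abel
  simp_rw [e, norm_add_smul_single_sq]
  refine HasDerivAt.deriv ?_
  have h2 : HasDerivAt (fun s : ℝ => r ^ 2 - (‖t - θ₀‖ ^ 2 + 2 * s * (t - θ₀) i + s ^ 2))
      (-(2 * (t - θ₀) i)) 0 := by
    have := (((((hasDerivAt_id (0 : ℝ)).const_mul 2).mul_const ((t - θ₀) i)).const_add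
      (‖t - θ₀‖ ^ 2)).add (hasDerivAt_pow 2 (0 : ℝ))).const_sub (r ^ 2)
    simpa using this
  have h3 := (h2.fun_pow 2).const_mul (biweightMass θ₀ r)⁻¹
  refine h3.congr_deriv ?_
  norm_num
  ring

theorem measurable_biweight (θ₀ : Par d) (r : ℝ) : Measurable (biweight θ₀ r) :=
  Measurable.indicator (by fun_prop) measurableSet_ball

theorem biweight_nonneg (θ₀ : Par d) (r : ℝ) (t : Par d) : 0 ≤ biweight θ₀ r t := by
  refine Set.indicator_nonneg (fun s _ => mul_nonneg (inv_nonneg.2 ?_) (sq_nonneg _)) t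
  exact integral_nonneg fun _ => sq_nonneg _

theorem biweight_eq_zero {θ₀ : Par d} {r : ℝ} {t : Par d} (ht : t ∉ Metric.ball θ₀ r) :
    biweight θ₀ r t = 0 := Set.indicator_of_notMem ht _

/-- The square in the kernel makes ∂ᵢq ∂ⱼq / q a polynomial: the factor that vanishes on the
boundary cancels, so the information is finite. -/
theorem biweight_score_mul {θ₀ : Par d} {r : ℝ} (hr : 0 < r) {t : Par d}
    (ht : t ∈ Metric.ball θ₀ r) (i j : Fin d) :
    partialDeriv (biweight θ₀ r) i t * partialDeriv (biweight θ₀ r) j t / biweight θ₀ r t =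
      16 * (biweightMass θ₀ r)⁻¹ * ((t - θ₀) i * (t - θ₀) j) := by
  rw [partialDeriv_biweight ht, partialDeriv_biweight ht, biweight, Set.indicator_of_mem ht]
  have hZ := (biweightMass_pos θ₀ hr).ne'
  have hpos : r ^ 2 - ‖t - θ₀‖ ^ 2 ≠ 0 := by
    rw [mem_ball_iff_norm] at ht
    have : 0 < r ^ 2 - ‖t - θ₀‖ ^ 2 := by nlinarith [norm_nonneg (t - θ₀)]
    exact this.ne'
  field_simp
  ring

theorem priorFisherInfo_biweight_quadratic {θ₀ : Par d} {r : ℝ} (hr : 0 < r) (a : Par d) :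
    (a : Fin d → ℝ) ⬝ᵥ (priorFisherInfo (Metric.ball θ₀ r) (biweight θ₀ r) *ᵥ a) =
      16 * (biweightMass θ₀ r)⁻¹ * ∫ t in Metric.ball θ₀ r, inner ℝ a (t - θ₀) ^ 2 := by
  have hentry : ∀ i j, priorFisherInfo (Metric.ball θ₀ r) (biweight θ₀ r) i j =
      ∫ t in Metric.ball θ₀ r, 16 * (biweightMass θ₀ r)⁻¹ * ((t - θ₀) i * (t - θ₀) j) :=
    fun i j => setIntegral_congr_fun measurableSet_ball fun t ht => biweight_score_mul hr ht i j
  have hint : ∀ i j, IntegrableOn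
      (fun t : Par d => 16 * (biweightMass θ₀ r)⁻¹ * ((t - θ₀) i * (t - θ₀) j))
      (Metric.ball θ₀ r) := fun i j =>
    integrableOn_ball_of_continuous (by fun_prop) θ₀ r
  have e : ∀ t : Par d, 16 * (biweightMass θ₀ r)⁻¹ * inner ℝ a (t - θ₀) ^ 2 =
      ∑ i, ∑ j, a i * (16 * (biweightMass θ₀ r)⁻¹ * ((t - θ₀) i * (t - θ₀) j)) * a j := by
    intro t
    simp only [PiLp.inner_apply, RCLike.inner_apply, conj_trivial]
    rw [sq, Finset.sum_mul_sum, Finset.mul_sum]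
    refine Finset.sum_congr rfl fun i _ => ?_
    rw [Finset.mul_sum]
    exact Finset.sum_congr rfl fun j _ => by ring
  rw [← integral_const_mul]
  simp_rw [e]
  rw [integral_finsetSum _ fun i _ => integrable_finsetSum _ fun j _ =>
    ((hint i j).const_mul (a i)).mul_const (a j)]
  simp only [dotProduct, Matrix.mulVec, Finset.mul_sum]
  refine Finset.sum_congr rfl fun i _ => ?_
  rw [integral_finsetSum _ fun j _ => ((hint i j).const_mul (a i)).mul_const (a j)]
  refine Finset.sum_congr rfl fun j _ => ?_
  rw [integral_mul_const, integral_const_mul, hentry]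
  ring

/-- What matters is the order r⁻²: with r = c n^{-1/2} it is n/c², a vanishing fraction of n as c
grows. -/
theorem priorFisherInfo_biweight_le {θ₀ : Par d} {r : ℝ} (hr : 0 < r) (a : Par d) :
    (a : Fin d → ℝ) ⬝ᵥ (priorFisherInfo (Metric.ball θ₀ r) (biweight θ₀ r) *ᵥ a) ≤
      256 / 9 * 2 ^ d * ‖a‖ ^ 2 / r ^ 2 := by
  rw [priorFisherInfo_biweight_quadratic hr]
  have hZ := biweightMass_pos θ₀ hr
  have hv := volume_real_ball_pos θ₀ hr
  have h1 : ∫ t in Metric.ball θ₀ r, inner ℝ a (t - θ₀) ^ 2 ≤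
      ‖a‖ ^ 2 * r ^ 2 * volume.real (Metric.ball θ₀ r) := by
    have h2 : ∫ t in Metric.ball θ₀ r, inner ℝ a (t - θ₀) ^ 2 ≤
        ∫ _t in Metric.ball θ₀ r, ‖a‖ ^ 2 * r ^ 2 := by
      refine setIntegral_mono_on (integrableOn_ball_of_continuous (by fun_prop) _ _)
        (integrableOn_ball_of_continuous continuous_const _ _) measurableSet_ball fun t ht => ?_
      rw [mem_ball_iff_norm] at ht
      rw [← mul_pow, ← sq_abs]
      exact pow_le_pow_left₀ (abs_nonneg _) ((abs_real_inner_le_norm _ _).trans (by gcongr)) 2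
    rw [setIntegral_const, smul_eq_mul, mul_comm] at h2
    exact h2
  have h3 := le_biweightMass θ₀ hr
  rw [mul_assoc, ← div_eq_inv_mul, mul_div_assoc', div_le_div_iff₀ hZ (by positivity)]
  have h4 : 256 / 9 * 2 ^ d * ‖a‖ ^ 2 *
      (9 / 16 * r ^ 4 * ((1 / 2) ^ d * volume.real (Metric.ball θ₀ r))) =
      16 * (‖a‖ ^ 2 * r ^ 2 * volume.real (Metric.ball θ₀ r)) * r ^ 2 := by
    have : (2 : ℝ) ^ d * (1 / 2) ^ d = 1 := by rw [← mul_pow]; norm_num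
    linear_combination (16 * ‖a‖ ^ 2 * r ^ 4 * volume.real (Metric.ball θ₀ r)) * this
  calc 16 * (∫ t in Metric.ball θ₀ r, inner ℝ a (t - θ₀) ^ 2) * r ^ 2
      ≤ 16 * (‖a‖ ^ 2 * r ^ 2 * volume.real (Metric.ball θ₀ r)) * r ^ 2 := by gcongr
    _ ≤ _ := by rw [← h4]; gcongr

theorem posDef_priorFisherInfo_biweight (θ₀ : Par d) {r : ℝ} (hr : 0 < r) :
    (priorFisherInfo (Metric.ball θ₀ r) (biweight θ₀ r)).PosDef := by
  refine Matrix.PosDef.of_dotProduct_mulVec_pos ?_ fun x hx => ?_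
  · ext i j
    simp [priorFisherInfo, mul_comm]
  · have h := priorFisherInfo_biweight_quadratic (θ₀ := θ₀) hr (WithLp.toLp 2 x)
    rw [star_trivial]
    change x ⬝ᵥ (priorFisherInfo (Metric.ball θ₀ r) (biweight θ₀ r) *ᵥ x) = _ at h
    rw [h]
    have hZ := biweightMass_pos θ₀ hr
    refine mul_pos (by positivity) ?_
    set a : Par d := WithLp.toLp 2 x with ha
    have ha0 : a ≠ 0 := by
      intro h0
      exact hx (by simpa [ha] using congrArg WithLp.ofLp h0)
    have hna : 0 < ‖a‖ := norm_pos_iff.2 ha0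
    rw [setIntegral_pos_iff_support_of_nonneg_ae (Eventually.of_forall fun t => sq_nonneg _)
      (integrableOn_ball_of_continuous (by fun_prop) _ _)]
    have hopen : IsOpen (Function.support (fun t : Par d => inner ℝ a (t - θ₀) ^ 2) ∩
        Metric.ball θ₀ r) := by
      refine IsOpen.inter ?_ Metric.isOpen_ball
      exact (isOpen_ne_fun (by fun_prop) continuous_const)
    refine hopen.measure_pos volume ⟨θ₀ + (r / (2 * ‖a‖)) • a, ?_, ?_⟩
    · rw [Function.mem_support, add_sub_cancel_left, inner_smul_right, real_inner_self_eq_norm_sq]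
      positivity
    · rw [mem_ball_iff_norm, add_sub_cancel_left, norm_smul, Real.norm_of_nonneg (by positivity)]
      have : r / (2 * ‖a‖) * ‖a‖ = r / 2 := by field_simp
      rw [this]
      linarith

theorem isProbabilityMeasure_biweight (θ₀ : Par d) {r : ℝ} (hr : 0 < r) :
    IsProbabilityMeasure (priorMeasure (biweight θ₀ r)) := by
  have hZ := biweightMass_pos θ₀ hr
  refine ⟨?_⟩
  have hi : Integrable (biweight θ₀ r) :=
    (integrable_indicator_iff measurableSet_ball).2
      (integrableOn_ball_of_continuous (by fun_prop) θ₀ r)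
  rw [priorMeasure, withDensity_apply _ MeasurableSet.univ, setLIntegral_univ,
    ← ofReal_integral_eq_lintegral_ofReal hi (Eventually.of_forall (biweight_nonneg θ₀ r)),
    biweight, integral_indicator measurableSet_ball, integral_const_mul]
  change ENNReal.ofReal ((biweightMass θ₀ r)⁻¹ * biweightMass θ₀ r) = 1
  rw [inv_mul_cancel₀ hZ.ne', ENNReal.ofReal_one]

theorem partialDeriv_affine (b : ℝ) (g θ₀ : Par d) (i : Fin d) (t : Par d) :
    partialDeriv (fun t => b + inner ℝ g (t - θ₀)) i t = g i := by
  rw [partialDeriv, lineDeriv]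
  have e : ∀ s : ℝ, b + inner ℝ g (t + s • EuclideanSpace.single i (1 : ℝ) - θ₀) =
      b + inner ℝ g (t - θ₀) + s * g i := fun s => by
    rw [add_sub_right_comm, inner_add_right, inner_smul_right, EuclideanSpace.inner_single_right]
    simp only [conj_trivial, one_mul]
    ring
  simp_rw [e]
  refine HasDerivAt.deriv ?_
  simpa using ((hasDerivAt_id (0 : ℝ)).mul_const (g i)).const_add (b + inner ℝ g (t - θ₀))

theorem isNicePrior_biweight {θ₀ : Par d} {r : ℝ} (hr : 0 < r)
    {I : Par d → Matrix (Fin d) (Fin d) ℝ}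
    (hI : Measurable ((Metric.ball θ₀ r).indicator fun t => (I t).trace)) {C : ℝ}
    (hC : ∀ t ∈ Metric.ball θ₀ r, |(I t).trace| ≤ C) (b : ℝ) (g : Par d) :
    IsNicePrior (Metric.ball θ₀ r) I (fun t => b + inner ℝ g (t - θ₀)) (biweight θ₀ r) where
  nonneg := biweight_nonneg θ₀ r
  eq_zero _ ht := biweight_eq_zero ht
  isProbabilityMeasure := isProbabilityMeasure_biweight θ₀ hr
  absCont := by
    refine IsAbsContOn.of_contDiff
      (f := fun t => (biweightMass θ₀ r)⁻¹ * (r ^ 2 - ‖t - θ₀‖ ^ 2) ^ 2) ?_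
      fun t ht => Set.indicator_of_mem ht _
    have h1 : ContDiff ℝ 1 fun t : Par d => ‖t - θ₀‖ ^ 2 :=
      (contDiff_id.sub contDiff_const).norm_sq ℝ
    exact contDiff_const.mul ((contDiff_const.sub h1).pow 2)
  finite_info i := by
    refine (integrableOn_congr_fun (g := fun t =>
      16 * (biweightMass θ₀ r)⁻¹ * ((t - θ₀) i * (t - θ₀) i)) (fun t ht => ?_) measurableSet_ball).2
      (integrableOn_ball_of_continuous (by fun_prop) θ₀ r)
    simp only
    rw [sq, biweight_score_mul hr ht]
  posDef_info := posDef_priorFisherInfo_biweight θ₀ hr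
  integrable_phi := by
    have := isProbabilityMeasure_biweight θ₀ hr
    have hc : Continuous fun t : Par d => b + inner ℝ g (t - θ₀) := by fun_prop
    refine Integrable.of_bound hc.aestronglyMeasurable (|b| + ‖g‖ * r) ?_
    filter_upwards [ae_mem_priorMeasure (measurable_biweight θ₀ r) fun t => biweight_eq_zero]
      with t ht
    rw [mem_ball_iff_norm] at ht
    refine (norm_add_le _ _).trans (add_le_add le_rfl ((norm_inner_le_norm _ _).trans ?_))
    gcongr
  integrable_grad i := by
    have := isProbabilityMeasure_biweight θ₀ hr
    refine (integrable_const (g i)).congr (Eventually.of_forall fun t => ?_)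
    exact (partialDeriv_affine b g θ₀ i t).symm
  integrable_trace := by
    have := isProbabilityMeasure_biweight θ₀ hr
    have hmem := ae_mem_priorMeasure (measurable_biweight θ₀ r)
      fun t (ht : t ∉ Metric.ball θ₀ r) => biweight_eq_zero ht
    refine Integrable.of_bound (hI.aestronglyMeasurable.congr ?_) C ?_
    · filter_upwards [hmem] with t ht using Set.indicator_of_mem ht _
    · filter_upwards [hmem] with t ht using hC t ht
  boundary x hx i := by
    have hx' : ‖x - θ₀‖ = r := mem_sphere_iff_norm.1 (Metric.frontier_ball_subset_sphere hx)
    have hc : Continuous fun s : ℝ => (biweightMass θ₀ r)⁻¹ *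
      (r ^ 2 - ‖x + s • EuclideanSpace.single i (1 : ℝ) - θ₀‖ ^ 2) ^ 2 := by fun_prop
    have h0 := hc.tendsto 0
    simp only [zero_smul, add_zero, hx', sub_self, ne_eq, OfNat.ofNat_ne_zero, not_false_eq_true,
      zero_pow, mul_zero] at h0
    refine (h0.mono_left nhdsWithin_le_nhds).congr' ?_
    filter_upwards [self_mem_nhdsWithin] with s hs
    exact (Set.indicator_of_mem hs fun t =>
      (biweightMass θ₀ r)⁻¹ * (r ^ 2 - ‖t - θ₀‖ ^ 2) ^ 2).symm

end LAM

namespace LAM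

variable {d : ℕ} {𝒳 : Type*} [MeasurableSpace 𝒳]

/-! ### Asymptotics of the approximation bound -/

/-- Cauchy–Schwarz for the form of A applied to a and A⁻¹m, from the discriminant of its values
along a + s A⁻¹m. It bounds Γ from below without inverting the information matrix. -/
theorem sq_dotProduct_le_of_posDef {ι : Type*} [Fintype ι] [DecidableEq ι] {A : Matrix ι ι ℝ}
    (hA : A.PosDef) (m a : ι → ℝ) :
    0 ≤ m ⬝ᵥ (A⁻¹ *ᵥ m) ∧ (m ⬝ᵥ a) ^ 2 ≤ (m ⬝ᵥ (A⁻¹ *ᵥ m)) * (a ⬝ᵥ (A *ᵥ a)) := by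
  set b := A⁻¹ *ᵥ m with hb
  have hAb : A *ᵥ b = m := by
    rw [hb, Matrix.mulVec_mulVec, Matrix.mul_nonsing_inv _
      ((Matrix.isUnit_iff_isUnit_det _).1 hA.isUnit), Matrix.one_mulVec]
  have hs : ∀ x y : ι → ℝ, x ⬝ᵥ (A *ᵥ y) = y ⬝ᵥ (A *ᵥ x) := fun x y => by
    rw [Matrix.dotProduct_mulVec, ← Matrix.mulVec_transpose, dotProduct_comm]
    have : A.transpose = A := by simpa [Matrix.IsSymm] using hA.1
    rw [this]
  have hn : ∀ x : ι → ℝ, 0 ≤ x ⬝ᵥ (A *ᵥ x) := fun x => by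
    simpa using hA.posSemidef.dotProduct_mulVec_nonneg x
  refine ⟨by have := hn b; rwa [hAb, dotProduct_comm] at this, ?_⟩
  have h : ∀ s : ℝ, 0 ≤ (m ⬝ᵥ b) * (s * s) + (2 * (m ⬝ᵥ a)) * s + a ⬝ᵥ (A *ᵥ a) := fun s => by
    have h1 := hn (a + s • b)
    rw [Matrix.mulVec_add, Matrix.mulVec_smul, hAb, add_dotProduct, dotProduct_add, dotProduct_add,
      smul_dotProduct, smul_dotProduct, dotProduct_smul, dotProduct_smul, hs b a, hAb,
      dotProduct_comm a m, dotProduct_comm b m] at h1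
    simp only [smul_eq_mul] at h1
    linarith
  have h2 := discrim_le_zero h
  rw [discrim] at h2
  nlinarith

/-- The integral formula for the quadratic form at sample size 0 isolates the prior part; the model
part is bounded pointwise. -/
theorem IsNicePrior.vanTreesInfo_quadratic_le {θ₀ : Par d} {r : ℝ}
    {I : Par d → Matrix (Fin d) (Fin d) ℝ} {φ q : Par d → ℝ}
    (hq : IsNicePrior (Metric.ball θ₀ r) I φ q)
    (hIm : ∀ i j, Measurable ((Metric.ball θ₀ r).indicator fun t => I t i j))
    (hIle : ∀ t ∈ Metric.ball θ₀ r, ∀ i j, |I t i j| ≤ (I t).trace) {a : Fin d → ℝ} {w : ℝ}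
    (h0 : ∀ t ∈ Metric.ball θ₀ r, 0 ≤ a ⬝ᵥ (I t *ᵥ a))
    (hw : ∀ t ∈ Metric.ball θ₀ r, a ⬝ᵥ (I t *ᵥ a) ≤ w) (n : ℕ) :
    a ⬝ᵥ (vanTreesInfo (Metric.ball θ₀ r) I n q *ᵥ a) ≤
      a ⬝ᵥ (priorFisherInfo (Metric.ball θ₀ r) q *ᵥ a) + n * w := by
  have hQ := hq.isProbabilityMeasure
  have hz : vanTreesInfo (Metric.ball θ₀ r) I 0 q = priorFisherInfo (Metric.ball θ₀ r) q := by
    simp [vanTreesInfo]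
  have hs : MemLp (fun t => ∑ i, a i * priorScore q i t) 2 (priorMeasure q) :=
    memLp_finsetSum _ fun i _ => (hq.memLp_score i).const_mul _
  rw [← hz, hq.vanTreesInfo_quadratic hIm hIle, hq.vanTreesInfo_quadratic hIm hIle]
  simp only [Nat.cast_zero, zero_mul, add_zero]
  have h1 : ∫ t, ((∑ i, a i * priorScore q i t) ^ 2 + n * (a ⬝ᵥ (I t *ᵥ a))) ∂(priorMeasure q) ≤
      ∫ t, ((∑ i, a i * priorScore q i t) ^ 2 + n * w) ∂(priorMeasure q) := by
    refine integral_mono_of_nonneg ?_ (hs.integrable_sq.add (integrable_const _)) ?_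
    · filter_upwards [hq.ae_mem] with t ht
      have := h0 t ht
      simp only [Pi.zero_apply]
      positivity
    · filter_upwards [hq.ae_mem] with t ht
      have := mul_le_mul_of_nonneg_left (hw t ht) n.cast_nonneg
      linarith
  refine h1.trans (le_of_eq ?_)
  rw [integral_add hs.integrable_sq (integrable_const _)]
  simp

theorem ofReal_rpow_half (x : ℝ) : ENNReal.ofReal x ^ (1 / 2 : ℝ) = ENNReal.ofReal √x := by
  rcases le_or_gt 0 x with hx | hx
  · rw [ENNReal.ofReal_rpow_of_nonneg hx (by norm_num), Real.sqrt_eq_rpow]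
  · rw [ENNReal.ofReal_of_nonpos hx.le, Real.sqrt_eq_zero_of_nonpos hx.le]
    simp

theorem sqrt_sub_le_of_mul_le {v v₁ Γ c η : ℝ} {n : ℕ} (hn : 0 < n) (hΓ : v₁ ≤ n * Γ)
    (hη : η * c ≤ √v₁ - √v) : √(v / n) ≤ √Γ - η * (c / √n) := by
  have hn' : (0 : ℝ) < n := Nat.cast_pos.2 hn
  have hsn : 0 < √(n : ℝ) := Real.sqrt_pos.2 hn'
  have h1 : √v₁ / √n ≤ √Γ := by
    rw [← Real.sqrt_div' _ hn'.le]
    exact Real.sqrt_le_sqrt ((div_le_iff₀' hn').2 hΓ)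
  have h2 : √(v / n) = √v / √n := Real.sqrt_div' _ hn'.le
  have h3 : √v / √n ≤ (√v₁ - η * c) / √n := by gcongr; linarith
  rw [sub_div] at h3
  rw [h2, ← mul_div_assoc]
  linarith

/-- The gap √v₁ - √v, divided by √n, is reserved for the approximation error of φ, which is at most
η times the radius. -/
theorem le_mul_sq_sub_rpow_half {v v₁ Γ c η : ℝ} {n : ℕ} (hn : 0 < n) (hv : 0 ≤ v)
    (hΓ : v₁ ≤ n * Γ) (hη : η * c ≤ √v₁ - √v) (hη0 : 0 ≤ η * c) {B : ℝ≥0∞}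
    (hB : B ≤ ENNReal.ofReal ((η * (c / √n)) ^ 2)) :
    ENNReal.ofReal v ≤ n * (ENNReal.ofReal Γ ^ (1 / 2 : ℝ) - B ^ (1 / 2 : ℝ)) ^ 2 := by
  have hn' : (0 : ℝ) < n := Nat.cast_pos.2 hn
  have h0 : 0 ≤ η * (c / √n) := by rw [← mul_div_assoc]; positivity
  have h1 : B ^ (1 / 2 : ℝ) ≤ ENNReal.ofReal (η * (c / √n)) := by
    refine (ENNReal.rpow_le_rpow hB (by norm_num)).trans_eq ?_
    rw [ofReal_rpow_half, Real.sqrt_sq h0]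
  have h2 : ENNReal.ofReal √(v / n) ≤ ENNReal.ofReal Γ ^ (1 / 2 : ℝ) - B ^ (1 / 2 : ℝ) := by
    refine le_trans ?_ (tsub_le_tsub_left h1 _)
    rw [ofReal_rpow_half, ← ENNReal.ofReal_sub _ h0]
    exact ENNReal.ofReal_le_ofReal (sqrt_sub_le_of_mul_le hn hΓ hη)
  calc ENNReal.ofReal v = n * ENNReal.ofReal √(v / n) ^ 2 := by
        rw [← ENNReal.ofReal_pow (Real.sqrt_nonneg _), Real.sq_sqrt (by positivity),
          ← ENNReal.ofReal_natCast, ← ENNReal.ofReal_mul hn'.le, mul_div_cancel₀ _ hn'.ne']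
    _ ≤ _ := by gcongr

theorem lintegral_bias_le {ψ φ q : Par d → ℝ} {θ₀ : Par d} {r η : ℝ}
    (hQ : IsProbabilityMeasure (priorMeasure q))
    (hmem : ∀ᵐ t ∂(priorMeasure q), t ∈ Metric.ball θ₀ r) (hη : 0 ≤ η)
    (h : ∀ t ∈ Metric.ball θ₀ r, |ψ t - φ t| ≤ η * ‖t - θ₀‖) :
    ∫⁻ t, ENNReal.ofReal ((ψ t - φ t) ^ 2) ∂(priorMeasure q) ≤ ENNReal.ofReal ((η * r) ^ 2) := by
  calc _ ≤ ∫⁻ _t, ENNReal.ofReal ((η * r) ^ 2) ∂(priorMeasure q) := by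
        refine lintegral_mono_ae ?_
        filter_upwards [hmem] with t ht
        refine ENNReal.ofReal_le_ofReal ?_
        rw [← sq_abs]
        refine pow_le_pow_left₀ (abs_nonneg _) ((h t ht).trans ?_) 2
        rw [mem_ball_iff_norm] at ht
        gcongr
    _ = _ := by simp

theorem eventually_abs_sub_affine_le {ψ : Par d → ℝ} {θ₀ : Par d} (hψ : DifferentiableAt ℝ ψ θ₀)
    {η : ℝ} (hη : 0 < η) :
    ∀ᶠ t in 𝓝 θ₀, |ψ t - (ψ θ₀ + inner ℝ (gradient ψ θ₀) (t - θ₀))| ≤ η * ‖t - θ₀‖ := by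
  have h := (hasGradientAt_iff_isLittleO.1 hψ.hasGradientAt).def hη
  filter_upwards [h] with t ht
  rw [Real.norm_eq_abs] at ht
  rwa [← sub_sub]

/-- For affine φ the averaged gradient is g itself. Testing the van Trees information in direction a
adds the prior term of order n/c² to the model term n w, and the factor n cancels. -/
theorem IsHellingerModel.mul_vanTreesGamma_biweight {ν : Measure 𝒳} [SigmaFinite ν]
    {P : Par d → Measure 𝒳} {Θ : Set (Par d)} {ξ : Par d → 𝒳 → Par d}
    (M : IsHellingerModel ν P Θ ξ) {θ₀ : Par d} {c : ℝ} (hc : 0 < c) {n : ℕ} (hn : 0 < n)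
    (hS : localBall θ₀ c n ⊆ interior Θ) {C : ℝ}
    (hC : ∀ t ∈ localBall θ₀ c n, |(fisherInfo ν (ξ t)).trace| ≤ C) (b : ℝ) (g a : Par d) {w : ℝ}
    (hw : ∀ t ∈ localBall θ₀ c n, (a : Fin d → ℝ) ⬝ᵥ (fisherInfo ν (ξ t) *ᵥ a) ≤ w) :
    IsNicePrior (localBall θ₀ c n) (fun t => fisherInfo ν (ξ t))
        (fun t => b + inner ℝ g (t - θ₀)) (biweight θ₀ (c / √n)) ∧
      inner ℝ g a ^ 2 ≤ n * vanTreesGamma (localBall θ₀ c n) (fun t => fisherInfo ν (ξ t)) n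
        (fun t => b + inner ℝ g (t - θ₀)) (biweight θ₀ (c / √n)) *
          (256 / 9 * 2 ^ d * ‖a‖ ^ 2 / c ^ 2 + w) := by
  have hn' : (0 : ℝ) < n := Nat.cast_pos.2 hn
  have hsn : 0 < √(n : ℝ) := Real.sqrt_pos.2 hn'
  rw [localBall] at *
  set r := c / √(n : ℝ) with hr
  have hr0 : 0 < r := div_pos hc hsn
  have hIm := fun i j => M.measurable_indicator_fisherInfo Metric.isOpen_ball hS i j
  have hIle : ∀ t ∈ Metric.ball θ₀ r, ∀ i j, |fisherInfo ν (ξ t) i j| ≤ (fisherInfo ν (ξ t)).trace :=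
    fun t ht i j => M.abs_fisherInfo_le_trace (interior_subset (hS ht)) i j
  have htr : Measurable ((Metric.ball θ₀ r).indicator fun t => (fisherInfo ν (ξ t)).trace) := by
    have : ((Metric.ball θ₀ r).indicator fun t => (fisherInfo ν (ξ t)).trace) =
        fun t => ∑ i, (Metric.ball θ₀ r).indicator (fun t => fisherInfo ν (ξ t) i i) t := by
      ext t
      by_cases ht : t ∈ Metric.ball θ₀ r
      · simp only [Set.indicator_of_mem ht]
        rfl
      · simp [Set.indicator_of_notMem ht]
    rw [this]
    exact Finset.measurable_fun_sum _ fun i _ => hIm i i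
  have hq := isNicePrior_biweight hr0 htr hC b g
  refine ⟨hq, ?_⟩
  have hQ := hq.isProbabilityMeasure
  have hpd := hq.posDef_vanTreesInfo hIm hIle
    (fun t ht => M.posSemidef_fisherInfo (interior_subset (hS ht))) n
  obtain ⟨hΓ0, hΓ⟩ := sq_dotProduct_le_of_posDef hpd (g : Fin d → ℝ) a
  have hΓe : vanTreesGamma (Metric.ball θ₀ r) (fun t => fisherInfo ν (ξ t)) n
      (fun t => b + inner ℝ g (t - θ₀)) (biweight θ₀ r) = (g : Fin d → ℝ) ⬝ᵥ
      ((vanTreesInfo (Metric.ball θ₀ r) (fun t => fisherInfo ν (ξ t)) n (biweight θ₀ r))⁻¹ *ᵥ g) := by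
    have : (fun i => ∫ t, partialDeriv (fun t => b + inner ℝ g (t - θ₀)) i t
        ∂(priorMeasure (biweight θ₀ r))) = (g : Fin d → ℝ) := by
      ext i
      simp [partialDeriv_affine]
    simp only [vanTreesGamma, this]
    rfl
  rw [← hΓe] at hΓ hΓ0
  have hga : (g : Fin d → ℝ) ⬝ᵥ a = inner ℝ g a := by
    simp only [PiLp.inner_apply, RCLike.inner_apply, conj_trivial, dotProduct]
    exact Finset.sum_congr rfl fun i _ => mul_comm _ _
  have hA := hq.vanTreesInfo_quadratic_le hIm hIle
    (fun t ht => M.fisherInfo_quadratic_nonneg (interior_subset (hS ht)) a) hw n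
  have hp := priorFisherInfo_biweight_le (θ₀ := θ₀) hr0 a
  have e : 256 / 9 * 2 ^ d * ‖a‖ ^ 2 / r ^ 2 = n * (256 / 9 * 2 ^ d * ‖a‖ ^ 2 / c ^ 2) := by
    rw [hr, div_pow, Real.sq_sqrt hn'.le]
    field_simp
  rw [← hga]
  refine hΓ.trans ?_
  rw [mul_comm (n : ℝ), mul_assoc]
  refine mul_le_mul_of_nonneg_left ?_ hΓ0
  linarith

/-- With φ the affine tangent of ψ and a the efficient direction, nΓ is at least V² divided by a
quantity that tends to V: continuity of the information at θ₀ handles the model term, large c the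
prior term. The bias of φ is o(n^{-1/2}) for fixed c. -/
theorem IsHellingerModel.le_localLiminf_approximationBound {ν : Measure 𝒳} [SigmaFinite ν]
    {P : Par d → Measure 𝒳} {Θ : Set (Par d)} {ξ : Par d → 𝒳 → Par d}
    (M : IsHellingerModel ν P Θ ξ) {ψ : Par d → ℝ} {θ₀ : Par d} (h₀ : θ₀ ∈ interior Θ)
    (hc : ContinuousAt (fun t => fisherInfo ν (ξ t)) θ₀)
    (hI : (fisherInfo ν (ξ θ₀)).PosDef) (hψ : DifferentiableAt ℝ ψ θ₀) :
    ENNReal.ofReal (lamConst ψ θ₀ (fisherInfo ν (ξ θ₀))) ≤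
      localLiminf fun c n => approximationBound (fun t => fisherInfo ν (ξ t)) ψ n
        (localBall θ₀ c n) := by
  set V := lamConst ψ θ₀ (fisherInfo ν (ξ θ₀)) with hV
  set a := effDir ψ θ₀ (fisherInfo ν (ξ θ₀)) with ha
  set g := gradient ψ θ₀ with hg
  have hga : inner ℝ g a = V := inner_gradient_effDir ψ θ₀ _
  have haa : (a : Fin d → ℝ) ⬝ᵥ (fisherInfo ν (ξ θ₀) *ᵥ a) = V := by
    rw [ha, dotProduct_fisher_effDir hI, inner_gradient_effDir]
  have hV0 : 0 ≤ V := lamConst_nonneg hI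
  refine le_localLiminf fun v hv hvV => ?_
  obtain ⟨v₁, hv₁, hv₁V⟩ := exists_between hvV
  have hv₁0 : 0 < v₁ := hv.trans_lt hv₁
  have hVpos : 0 < V := hv₁0.trans hv₁V
  -- Half of the slack V²/v₁ - V goes to the prior information, the other half to the variation of
  -- the model information.
  set δ := (V ^ 2 / v₁ - V) / 2 with hδ
  have hδ0 : 0 < δ := by
    have : V < V ^ 2 / v₁ := by rw [lt_div_iff₀ hv₁0]; nlinarith
    linarith
  have hδe : v₁ * (δ + (V + δ)) = V ^ 2 := by
    rw [hδ]
    field_simp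
    ring
  have hKc : Tendsto (fun c : ℝ => 256 / 9 * 2 ^ d * ‖a‖ ^ 2 / c ^ 2) atTop (𝓝 0) :=
    (tendsto_pow_atTop two_ne_zero).const_div_atTop _
  filter_upwards [hKc.eventually (gt_mem_nhds hδ0), eventually_gt_atTop 0] with c hcδ hc0
  -- The slope tolerance for the tangent: times the radius c/√n, it costs exactly (√v₁ - √v)/√n.
  have hη : 0 < (√v₁ - √v) / c := div_pos (sub_pos.2 (Real.sqrt_lt_sqrt hv hv₁)) hc0
  have hquad : ContinuousAt
      (fun t => (a : Fin d → ℝ) ⬝ᵥ (fisherInfo ν (ξ t) *ᵥ (a : Fin d → ℝ))) θ₀ :=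
    (Continuous.dotProduct continuous_const
      (continuous_id.matrix_mulVec continuous_const)).continuousAt.comp hc
  have htrace : ContinuousAt (fun t => |(fisherInfo ν (ξ t)).trace|) θ₀ :=
    (continuous_id.matrix_trace.continuousAt.comp hc).abs
  have hev : ∀ᶠ t in 𝓝 θ₀, t ∈ interior Θ ∧
      (a : Fin d → ℝ) ⬝ᵥ (fisherInfo ν (ξ t) *ᵥ a) ≤ V + δ ∧
      |(fisherInfo ν (ξ t)).trace| ≤ |(fisherInfo ν (ξ θ₀)).trace| + 1 ∧
      |ψ t - (ψ θ₀ + inner ℝ g (t - θ₀))| ≤ (√v₁ - √v) / c * ‖t - θ₀‖ := by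
    filter_upwards [isOpen_interior.mem_nhds h₀,
      hquad.eventually (gt_mem_nhds (haa.trans_lt (lt_add_of_pos_right V hδ0))),
      htrace.eventually (gt_mem_nhds (lt_add_one _)), eventually_abs_sub_affine_le hψ hη]
      with t h1 h2 h3 h4
    exact ⟨h1, h2.le, h3.le, h4⟩
  filter_upwards [eventually_localBall_subset hev c, eventually_gt_atTop 0] with n hn hn0
  obtain ⟨hq, hΓ⟩ := M.mul_vanTreesGamma_biweight hc0 hn0 (fun t ht => (hn ht).1)
    (fun t ht => (hn ht).2.2.1) (ψ θ₀) g a (fun t ht => (hn ht).2.1)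
  have hΓ' : v₁ ≤ n * vanTreesGamma (localBall θ₀ c n) (fun t => fisherInfo ν (ξ t)) n
      (fun t => ψ θ₀ + inner ℝ g (t - θ₀)) (biweight θ₀ (c / √n)) := by
    rw [hga, ← hδe] at hΓ
    by_contra hlt
    push Not at hlt
    have hpos : 0 < 256 / 9 * 2 ^ d * ‖a‖ ^ 2 / c ^ 2 + (V + δ) := by positivity
    have h1 := mul_lt_mul_of_pos_right hlt hpos
    have h2 : v₁ * (256 / 9 * 2 ^ d * ‖a‖ ^ 2 / c ^ 2 + (V + δ)) ≤ v₁ * (δ + (V + δ)) := by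
      gcongr
    linarith
  have hB := lintegral_bias_le hq.isProbabilityMeasure hq.ae_mem hη.le fun t ht => (hn ht).2.2.2
  have hηc : (√v₁ - √v) / c * c = √v₁ - √v := div_mul_cancel₀ _ hc0.ne'
  refine (le_mul_sq_sub_rpow_half hn0 hv hΓ' hηc.le (by positivity) hB).trans ?_
  gcongr
  refine le_iSup₂_of_le (fun t => ψ θ₀ + inner ℝ g (t - θ₀)) (IsAbsContOn.of_contDiff
    (f := fun t => ψ θ₀ + inner ℝ g (t - θ₀)) ?_ fun _ _ => rfl) (le_iSup₂_of_le _ hq le_rfl)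
  exact contDiff_const.add (contDiff_const.inner ℝ (contDiff_id.sub contDiff_const))

end LAM

/-! ### Assembly of the bounds. -/

theorem mainTheorem5 {d : ℕ} {𝒳 : Type*} [MeasurableSpace 𝒳] (ν : Measure 𝒳) [SigmaFinite ν]
    (Θ : Set (LAM.Par d)) (P : LAM.Par d → Measure 𝒳)
    (hP : ∀ θ ∈ Θ, IsProbabilityMeasure (P θ)) (hPν : ∀ θ ∈ Θ, P θ ≪ ν)
    (ξ : LAM.Par d → 𝒳 → LAM.Par d)
    (hξ : ∀ t ∈ Θ, LAM.HasHellingerDerivWithinAt ν P Θ t (ξ t))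
    (θ₀ : LAM.Par d) (hθ₀ : θ₀ ∈ interior Θ)
    (hI : ContinuousAt (fun t => LAM.fisherInfo ν (ξ t)) θ₀)
    (hI₀ : (LAM.fisherInfo ν (ξ θ₀)).PosDef)
    (ψ : LAM.Par d → ℝ) (hψ : ∀ᶠ t in 𝓝 θ₀, DifferentiableAt ℝ ψ t)
    (hψ' : ContinuousAt (gradient ψ) θ₀) :
    let I : LAM.Par d → Matrix (Fin d) (Fin d) ℝ := fun t => LAM.fisherInfo ν (ξ t)
    let V : ℝ := LAM.lamConst ψ θ₀ (I θ₀)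
    let R : ℝ → ℕ → ℝ≥0∞ := fun c n => LAM.minimaxRisk P ψ n (LAM.localBall θ₀ c n)
    let bApprox : ℝ → ℕ → ℝ≥0∞ := fun c n =>
      LAM.approximationBound I ψ n (LAM.localBall θ₀ c n)
    let bChiSq : ℝ → ℕ → ℝ≥0∞ := fun c n => LAM.chiSqBound P ψ n (LAM.localBall θ₀ c n)
    let bHell : ℝ → ℕ → ℝ≥0∞ := fun c n => LAM.hellingerBound P ψ n (LAM.localBall θ₀ c n)
    let bArctan : ℝ → ℕ → ℝ≥0∞ := fun c n =>
      LAM.arctanHellingerBound P ψ n θ₀ (c / √(n : ℝ))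
    let bTwo : ℝ → ℕ → ℝ≥0∞ := fun c n => LAM.twoPointBound P ψ n (LAM.localBall θ₀ c n)
    -- the local asymptotic minimax bound
    (ENNReal.ofReal V ≤ LAM.localLiminf R) ∧
    -- (i) the approximation bound yields it
    ((∀ c > 0, ∀ᶠ n in atTop, bApprox c n ≤ R c n) ∧
      ENNReal.ofReal V ≤ LAM.localLiminf bApprox) ∧
    -- (ii) the chi-squared mixture bound yields it, if the Fisher defect vanishes
    (LAM.fisherDefect ν (P θ₀) (ξ θ₀) = 0 →
      (∀ c > 0, ∀ᶠ n in atTop, bChiSq c n ≤ R c n) ∧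
      ENNReal.ofReal V ≤ LAM.localLiminf bChiSq) ∧
    -- (iii) the Hellinger mixture bound yields it, already with arctangent diffeomorphisms
    ((∀ c > 0, ∀ᶠ n in atTop, bHell c n ≤ R c n) ∧
      ENNReal.ofReal V ≤ LAM.localLiminf bHell ∧
      (∀ r > 0, ∀ γ > 0, LAM.IsDiffeoOnto (LAM.arctanMap θ₀ r γ) (Metric.ball θ₀ r)) ∧
      ENNReal.ofReal V ≤ LAM.localLiminf bArctan) ∧
    -- (iv) the two-point bound yields it up to the factor `C`, and no more
    ((∀ c > 0, ∀ᶠ n in atTop, bTwo c n ≤ R c n) ∧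
      LAM.localLiminf bTwo = ENNReal.ofReal (LAM.twoPointConst * V) ∧
      |LAM.twoPointConst - 0.28953| ≤ 5 * (10 : ℝ)⁻¹ ^ 6) := by
  intro I V R bApprox bChiSq bHell bArctan bTwo
  have M : LAM.IsHellingerModel ν P Θ ξ := ⟨hP, hPν, hξ⟩
  have hψ₀ : DifferentiableAt ℝ ψ θ₀ := hψ.self_of_nhds
  obtain ⟨K, hK⟩ : ∃ K : ℝ, ∀ᶠ t in 𝓝 θ₀, |ψ t| ≤ K :=
    ⟨|ψ θ₀| + 1, (hψ₀.continuousAt.abs.eventually (gt_mem_nhds (lt_add_one _))).mono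
      fun _ h => h.le⟩
  have hnear : ∀ c : ℝ, ∀ᶠ n : ℕ in atTop, LAM.localBall θ₀ c n ⊆ interior Θ ∧
      ContinuousOn ψ (LAM.localBall θ₀ c n) ∧ ∀ θ ∈ LAM.localBall θ₀ c n, |ψ θ| ≤ K := by
    intro c
    filter_upwards [LAM.eventually_localBall_subset
      (inter_mem (inter_mem (isOpen_interior.mem_nhds hθ₀) hψ) hK) c] with n hn
    exact ⟨fun t ht => (hn ht).1.1,
      fun t ht => (hn ht).1.2.continuousAt.continuousWithinAt, fun t ht => (hn ht).2⟩
  have hApp : ∀ c > 0, ∀ᶠ n in atTop, bApprox c n ≤ R c n := fun c _ => by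
    filter_upwards [hnear c] with n hn
    exact M.approximationBound_le hn.1 hn.2.1 hn.2.2
  have hChi : ∀ c > 0, ∀ᶠ n in atTop, bChiSq c n ≤ R c n := fun c _ => by
    filter_upwards [hnear c] with n hn
    exact M.chiSqBound_le hn.1 hn.2.1 hn.2.2
  have hHC : ∀ c > 0, ∀ᶠ n in atTop, bHell c n ≤ bChiSq c n := fun c _ => by
    filter_upwards [hnear c] with n hn
    exact M.hellingerBound_le hn.1
  have hAH : ∀ c > 0, ∀ᶠ n in atTop, bArctan c n ≤ bHell c n := fun c hc => by
    filter_upwards [eventually_gt_atTop 0] with n hn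
    have hn' : (0 : ℝ) < n := Nat.cast_pos.2 hn
    exact LAM.arctanHellingerBound_le P ψ n θ₀ (by positivity)
  have hTwo : ∀ c > 0, ∀ᶠ n in atTop, bTwo c n ≤ R c n := fun c _ => by
    filter_upwards [hnear c] with n hn
    exact M.twoPointBound_le (hn.1.trans interior_subset)
  -- The one sharpness result for mixtures; it propagates upwards along arctangent ≤ Hellinger ≤ χ²
  -- ≤ minimax risk.
  have hA := M.le_localLiminf_arctan hθ₀ hI₀ hψ
  have hH : ENNReal.ofReal V ≤ LAM.localLiminf bHell := hA.trans (LAM.localLiminf_mono hAH)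
  have hC : ENNReal.ofReal V ≤ LAM.localLiminf bChiSq := hH.trans (LAM.localLiminf_mono hHC)
  refine ⟨hC.trans (LAM.localLiminf_mono hChi), ⟨hApp,
    M.le_localLiminf_approximationBound hθ₀ hI hI₀ hψ₀⟩, fun _ => ⟨hChi, hC⟩,
    ⟨fun c hc => ?_, hH, fun r hr γ hγ => LAM.isDiffeoOnto_arctanMap θ₀ hr hγ, hA⟩,
    hTwo, ?_, LAM.abs_twoPointConst_sub_le⟩
  · filter_upwards [hHC c hc, hChi c hc] with n h1 h2
    exact h1.trans h2
  · exact le_antisymm (M.localLiminf_twoPointBound_le hθ₀ hI₀ hψ₀)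
      (M.le_localLiminf_twoPointBound hθ₀ hI₀ hψ₀)
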